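/- Let $E$ be the $\mathbb S$-bimodule over $\mathbb C$ freely generated by a product $\mu$ of biarity $(1,2)$ (one output, two inputs) and a coproduct $\Delta$ of biarity $(2,1)$, both without symmetry, and let $\mathcal F(E)$ be the free properad on $E$: in biarity $(m,n)$ it has as a basis the isomorphism classes of connected directed acyclic graphs with $m$ numbered outputs and $n$ numbered inputs whose vertices are labelled by $\mu$ or $\Delta$ (the monomials). It is graded by the weight, i.e. the number of vertices; $\mathcal F^{(w)}(E)$ is the part of weight $w$. For $a=(a_1,a_2,a_3,a_4)\in\mathbb C^4$ let $R_a\subseteq\mathcal F(E)$ be the ideal generated by associativity, coassociativity and one relation rewriting $\Delta\circ\mu$; in Sweedler's notation the three relations are $$(xy)z-x(yz),\qquad (\Delta\otimes\mathrm{id})\Delta-(\mathrm{id}\otimes\Delta)\Delta,$$ $$\Delta(xy)-a_1\,x_{(1)}\otimes x_{(2)}y-a_2\,xy_{(1)}\otimes y_{(2)}-a_3\,x_{(1)}y\otimes x_{(2)}-a_4\,y_{(1)}\otimes xy_{(2)},$$ and let $\mathcal P_a=\mathcal F(E)/R_a$, with the induced weight grading. Rewriting. The rewriting rules in weight $2$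 are $(xy)z\to x(yz)$, $(\Delta\otimes\mathrm{id})\Delta\to(\mathrm{id}\otimes\Delta)\Delta$ and $$\Delta(xy)\to a_1\,x_{(1)}\otimes x_{(2)}y+a_2\,xy_{(1)}\otimes y_{(2)}+a_3\,x_{(1)}y\otimes x_{(2)}+a_4\,y_{(1)}\otimes xy_{(2)}.$$ They induce rules $G\to h$ on the monomials $G$ of weight $3$, by replacing a two-vertex subgraph of $G$ that is a left-hand side of one of these rules by the corresponding right-hand side. An element $f\in\mathcal F^{(3)}(E)$ rewrites in one step to $f-c\,G+c\,h$ whenever $G\to h$ is an induced rule and the coefficient $c$ of the monomial $G$ in $f$ is nonzero. Write $\twoheadrightarrow$ for a finite (possibly empty) sequence of steps. One says that $\mathcal P_a$ induces a confluent system if this rewriting system on $\mathcal F^{(3)}(E)$ is confluent: whenever $g\twoheadleftarrow f\twoheadrightarrow h$, there is $k$ with $g\twoheadrightarrow k\twoheadleftarrow h$. The morphism $\varphi_a$. Let $\mathcal A=\mathcal F(\mu)/((xy)z-x(yz))$ be the properad of associative algebras and $\mathcal C=\mathcal F(\Delta)/((\Delta\otimes\mathrm{id})\Delta-(\mathrm{id}\otimes\Delta)\Delta)$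 that of coassociative coalgebras, both graded by the weight, let $\boxtimes$ be the connected composition product of $\mathbb S$-bimodules (two-level connected composites, here elements of $\mathcal C$ followed by elements of $\mathcal A$), and let $\varphi_a:\mathcal A\boxtimes\mathcal C\to\mathcal P_a$ be the morphism of $\mathbb S$-bimodules that maps the elements of $\mathcal A$ and $\mathcal C$ to $\mathcal P_a$ and composes them there; it preserves the total weight. **Theorem.** Let $a\in\mathbb C^4$. The following are equivalent: 1. the properad $\mathcal P_a$ induces a confluent system; 2. $\varphi_a$ is an isomorphism of $\mathbb S$-bimodules in weight $3$, i.e. for all $m,n$ it maps the weight $3$ part of $(\mathcal A\boxtimes\mathcal C)(m,n)$ bijectively onto the weight $3$ part of $\mathcal P_a(m,n)$. -/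

import Mathlib

/-- A signature: a set of operations, each with finitely many outputs and inputs.  It stands for
the `𝕊`-bimodule freely generated by these operations, that is, a copy of
`ℂ[𝕊_m × 𝕊_n^op]` in biarity `(m, n)` for every operation with `m` outputs and `n` inputs. -/
structure Sig where
  Op : Type
  out : Op → ℕ
  inp : Op → ℕ

/-- The signature with set of operations `T`, the arities being taken along `f`. -/
abbrev Sig.restrict (S : Sig) {T : Type} (f : T → S.Op) : Sig where
  Op := T
  out t := S.out (f t)
  inp t := S.inp (f t)

/-- A directed graph with vertices `V` labelled by operations, inputs `I` and outputs `O`.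
Every wire starts at an input of the graph or at an output of a vertex, and ends at an output
of the graph or at an input of a vertex. -/
structure Wiring (S : Sig) (V I O : Type) where
  label : V → S.Op
  wire : I ⊕ (Σ v, Fin (S.out (label v))) ≃ O ⊕ (Σ v, Fin (S.inp (label v)))

namespace Wiring
variable {S : Sig}

/-- Renaming of the vertices. -/
abbrev reindex {V W I O : Type} (G : Wiring S V I O) (e : W ≃ V) : Wiring S W I O where
  label w := G.label (e w)
  wire := ((Equiv.refl I).sumCongr
      (Equiv.sigmaCongrLeft (β := fun v => Fin (S.out (G.label v))) e)).trans
    (G.wire.trans ((Equiv.refl O).sumCongr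
      (Equiv.sigmaCongrLeft (β := fun v => Fin (S.inp (G.label v))) e).symm))

/-- Renaming of the inputs and outputs: the input `x` of the new graph is the input `e x` of `G`,
and the output `y` of `G` is the output `f y` of the new graph. -/
abbrev bdry {V I O I' O' : Type} (G : Wiring S V I O) (e : I' ≃ I) (f : O ≃ O') :
    Wiring S V I' O' where
  label := G.label
  wire := (e.sumCongr (Equiv.refl _)).trans (G.wire.trans (f.sumCongr (Equiv.refl _)))

/-- The disjoint union of a family of graphs. -/
abbrev par {ι : Type} {V I O : ι → Type} (G : ∀ i, Wiring S (V i) (I i) (O i)) :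
    Wiring S (Σ i, V i) (Σ i, I i) (Σ i, O i) where
  label x := (G x.1).label x.2
  wire :=
    { toFun := fun s => match s with
        | .inl ⟨i, x⟩ =>
            Sum.map (fun o => ⟨i, o⟩) (fun y => ⟨⟨i, y.1⟩, y.2⟩) ((G i).wire (.inl x))
        | .inr ⟨⟨i, v⟩, p⟩ =>
            Sum.map (fun o => ⟨i, o⟩) (fun y => ⟨⟨i, y.1⟩, y.2⟩) ((G i).wire (.inr ⟨v, p⟩))
      invFun := fun t => match t with
        | .inl ⟨i, x⟩ =>
            Sum.map (fun o => ⟨i, o⟩) (fun y => ⟨⟨i, y.1⟩, y.2⟩) ((G i).wire.symm (.inl x))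
        | .inr ⟨⟨i, v⟩, p⟩ =>
            Sum.map (fun o => ⟨i, o⟩) (fun y => ⟨⟨i, y.1⟩, y.2⟩) ((G i).wire.symm (.inr ⟨v, p⟩))
      left_inv := by
        rintro (⟨i, x⟩ | ⟨⟨i, v⟩, p⟩)
        · rcases h : (G i).wire (.inl x) with o | ⟨w, q⟩ <;> simp [h, (Equiv.symm_apply_eq _).mpr h.symm]
        · rcases h : (G i).wire (.inr ⟨v, p⟩) with o | ⟨w, q⟩ <;> simp [h, (Equiv.symm_apply_eq _).mpr h.symm]
      right_inv := by
        rintro (⟨i, x⟩ | ⟨⟨i, v⟩, p⟩)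
        · rcases h : (G i).wire.symm (.inl x) with o | ⟨w, q⟩ <;> simp [h, (Equiv.eq_symm_apply _).mp h.symm]
        · rcases h : (G i).wire.symm (.inr ⟨v, p⟩) with o | ⟨w, q⟩ <;> simp [h, (Equiv.eq_symm_apply _).mp h.symm] }

/-- Sequential composition: the outputs of `G` are plugged into the inputs of `H`. -/
abbrev seq {V W I M O : Type} (G : Wiring S V I M) (H : Wiring S W M O) :
    Wiring S (V ⊕ W) I O where
  label := Sum.elim G.label H.label
  wire :=
    { toFun := fun s =>
        let fromH : O ⊕ (Σ w, Fin (S.inp (H.label w))) →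
            O ⊕ (Σ u, Fin (S.inp (Sum.elim G.label H.label u))) :=
          Sum.map id (fun y => ⟨.inr y.1, y.2⟩)
        let fromG : M ⊕ (Σ v, Fin (S.inp (G.label v))) →
            O ⊕ (Σ u, Fin (S.inp (Sum.elim G.label H.label u))) :=
          Sum.elim (fun m => fromH (H.wire (.inl m))) (fun y => .inr ⟨.inl y.1, y.2⟩)
        match s with
        | .inl i => fromG (G.wire (.inl i))
        | .inr ⟨.inl v, p⟩ => fromG (G.wire (.inr ⟨v, p⟩))
        | .inr ⟨.inr w, p⟩ => fromH (H.wire (.inr ⟨w, p⟩))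
      invFun := fun t =>
        let fromG : I ⊕ (Σ v, Fin (S.out (G.label v))) →
            I ⊕ (Σ u, Fin (S.out (Sum.elim G.label H.label u))) :=
          Sum.map id (fun y => ⟨.inl y.1, y.2⟩)
        let fromH : M ⊕ (Σ w, Fin (S.out (H.label w))) →
            I ⊕ (Σ u, Fin (S.out (Sum.elim G.label H.label u))) :=
          Sum.elim (fun m => fromG (G.wire.symm (.inl m))) (fun y => .inr ⟨.inr y.1, y.2⟩)
        match t with
        | .inl o => fromH (H.wire.symm (.inl o))
        | .inr ⟨.inr w, p⟩ => fromH (H.wire.symm (.inr ⟨w, p⟩))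
        | .inr ⟨.inl v, p⟩ => fromG (G.wire.symm (.inr ⟨v, p⟩))
      left_inv := by
        rintro (i | ⟨v | w, p⟩)
        · rcases h : G.wire (.inl i) with m | ⟨v, q⟩
          · rcases h' : H.wire (.inl m) with o | ⟨w, q⟩ <;> 
              simp [h, h', (Equiv.symm_apply_eq _).mpr h.symm, (Equiv.symm_apply_eq _).mpr h'.symm]
          · simp [h, (Equiv.symm_apply_eq _).mpr h.symm]
        · rcases h : G.wire (.inr ⟨v, p⟩) with m | ⟨v, q⟩
          · rcases h' : H.wire (.inl m) with o | ⟨w, q⟩ <;> 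
              simp [h, h', (Equiv.symm_apply_eq _).mpr h.symm, (Equiv.symm_apply_eq _).mpr h'.symm]
          · simp [h, (Equiv.symm_apply_eq _).mpr h.symm]
        · rcases h : H.wire (.inr ⟨w, p⟩) with m | ⟨v, q⟩ <;> simp [h, (Equiv.symm_apply_eq _).mpr h.symm]
      right_inv := by
        rintro (i | ⟨v | w, p⟩)
        · rcases h : H.wire.symm (.inl i) with m | ⟨v, q⟩
          · rcases h' : G.wire.symm (.inl m) with o | ⟨w, q⟩ <;> 
              simp [h, h', (Equiv.eq_symm_apply _).mp h.symm, (Equiv.eq_symm_apply _).mp h'.symm]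
          · simp [h, (Equiv.eq_symm_apply _).mp h.symm]
        · rcases h : G.wire.symm (.inr ⟨v, p⟩) with m | ⟨v, q⟩ <;> simp [h, (Equiv.eq_symm_apply _).mp h.symm]
        · rcases h : H.wire.symm (.inr ⟨w, p⟩) with m | ⟨v, q⟩
          · rcases h' : G.wire.symm (.inl m) with o | ⟨w, q⟩ <;> 
              simp [h, h', (Equiv.eq_symm_apply _).mp h.symm, (Equiv.eq_symm_apply _).mp h'.symm]
          · simp [h, (Equiv.eq_symm_apply _).mp h.symm] }

/-- Changing the labels along `f`. -/
abbrev relabel {T V I O : Type} (f : T → S.Op) (G : Wiring (S.restrict f) V I O) :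
    Wiring S V I O where
  label v := f (G.label v)
  wire := G.wire

/-- `u` and `w` are incident: a wire (named by its starting point) leaves or enters a vertex. -/
inductive Adj {V I O : Type} (G : Wiring S V I O) :
    V ⊕ (I ⊕ (Σ v, Fin (S.out (G.label v)))) → V ⊕ (I ⊕ (Σ v, Fin (S.out (G.label v)))) → Prop
  | leave (v : V) (p : Fin (S.out (G.label v))) : G.Adj (.inl v) (.inr (.inr ⟨v, p⟩))
  | enter (s : I ⊕ (Σ v, Fin (S.out (G.label v)))) (v : V) (p : Fin (S.inp (G.label v)))
      (h : G.wire s = .inr ⟨v, p⟩) : G.Adj (.inr s) (.inl v)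

/-- The graph, seen as the topological space formed by its vertices and wires, is nonempty and
connected. -/
def Connected {V I O : Type} (G : Wiring S V I O) : Prop :=
  Nonempty (V ⊕ (I ⊕ (Σ v, Fin (S.out (G.label v))))) ∧ ∀ x y, Relation.EqvGen G.Adj x y

/-- There is no directed cycle: the vertices have levels that increase along internal wires. -/
def Acyclic {V I O : Type} (G : Wiring S V I O) : Prop :=
  ∃ level : V → ℕ, ∀ v p w q, G.wire (.inr ⟨v, p⟩) = .inr ⟨w, q⟩ → level v < level w

/-- Isomorphism of graphs, fixing the inputs and the outputs. -/
def Iso {V W I O : Type} (G : Wiring S V I O) (H : Wiring S W I O) : Prop :=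
  ∃ (e : V ≃ W) (h : ∀ v, G.label v = H.label (e v)), ∀ s,
    H.wire (Sum.map id (fun x => ⟨e x.1, Fin.cast (by rw [h]) x.2⟩) s) =
      Sum.map id (fun x => ⟨e x.1, Fin.cast (by rw [h]) x.2⟩) (G.wire s)

/-! Compatibility of these constructions with each other. -/

theorem Iso.of_wire {V I O : Type} {G H : Wiring S V I O} (h : ∀ v, G.label v = H.label v)
    (hw : ∀ s, H.wire (Sum.map id (fun x => ⟨x.1, Fin.cast (by rw [h]) x.2⟩) s) =
      Sum.map id (fun x => ⟨x.1, Fin.cast (by rw [h]) x.2⟩) (G.wire s)) : G.Iso H :=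
  ⟨Equiv.refl V, h, hw⟩

theorem Iso.refl {V I O : Type} (G : Wiring S V I O) : G.Iso G :=
  ⟨Equiv.refl V, fun _ => rfl, fun s => by
    rcases s with i | ⟨v, p⟩
    · rcases h : G.wire (.inl i) with o | ⟨w, q⟩ <;> simp [h]
    · rcases h : G.wire (.inr ⟨v, p⟩) with o | ⟨w, q⟩ <;> simp [h]⟩

theorem Iso.trans {V W U I O : Type} {G : Wiring S V I O} {H : Wiring S W I O}
    {K : Wiring S U I O} : G.Iso H → H.Iso K → G.Iso K := by
  rintro ⟨e, he, h⟩ ⟨f, hf, h'⟩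
  refine ⟨e.trans f, fun v => (he v).trans (hf _), fun s => ?_⟩
  have h1 := h' (Sum.map id (fun x => ⟨e x.1, Fin.cast (by rw [he]) x.2⟩) s)
  rw [h s] at h1
  simpa [Sum.map_map, Function.comp_def] using h1

theorem sigma_cast {α : Type} (n : α → ℕ) {v v' : α} (h : v = v') (p : Fin (n v))
    (h' : n v = n v') : (⟨v', Fin.cast h' p⟩ : Σ v, Fin (n v)) = ⟨v, p⟩ := by
  subst h; rfl

theorem Iso.symm {V W I O : Type} {G : Wiring S V I O} {H : Wiring S W I O} :
    G.Iso H → H.Iso G := by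
  rintro ⟨e, he, h⟩
  obtain ⟨lab, wire⟩ := G
  obtain rfl : lab = fun v => H.label (e v) := funext he
  simp only [Fin.cast_eq_self] at h
  have hs : ∀ (A : Type) (n : W → ℕ) (t : A ⊕ Σ w, Fin (n w)),
      Sum.map id (fun x : Σ v, Fin (n (e v)) => (⟨e x.1, x.2⟩ : Σ w, Fin (n w)))
        (Sum.map id (fun x => ⟨e.symm x.1, Fin.cast (by simp) x.2⟩) t) = t := by
    rintro A n (a | ⟨w, p⟩)
    · rfl
    · simp only [Sum.map_inr]
      rw [sigma_cast n (by simp)]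
  have inj : ∀ (A : Type) (n : W → ℕ), Function.Injective (Sum.map (id : A → A)
      (fun x : Σ v, Fin (n (e v)) => (⟨e x.1, x.2⟩ : Σ w, Fin (n w)))) := by
    intro A n
    refine Function.Injective.sumMap (fun _ _ h => h) ?_
    rintro ⟨v, p⟩ ⟨v', p'⟩ h
    simp only [Sigma.mk.injEq, EmbeddingLike.apply_eq_iff_eq] at h
    obtain ⟨rfl, h⟩ := h
    simpa using h
  refine ⟨e.symm, fun w => by simp, fun s => ?_⟩
  apply inj O (fun w => S.inp (H.label w))
  have h1 := h (Sum.map id (fun x => ⟨e.symm x.1, Fin.cast (by simp) x.2⟩) s)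
  rw [hs I (fun w => S.out (H.label w))] at h1
  refine Eq.trans h1.symm (hs O (fun w => S.inp (H.label w)) _).symm

theorem reindex_iso {V W I O : Type} (G : Wiring S V I O) (e : W ≃ V) : (G.reindex e).Iso G := by
  refine ⟨e, fun _ => rfl, fun s => ?_⟩
  have h1 : ∀ (A : Type) (n : V → ℕ) (t : A ⊕ Σ w, Fin (n w)),
      Sum.map id (fun x : Σ w, Fin (n (e w)) => (⟨e x.1, x.2⟩ : Σ v, Fin (n v)))
        (((Equiv.refl A).sumCongr
        (Equiv.sigmaCongrLeft (β := fun v => Fin (n v)) e).symm) t) = t := by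
    intro A n t
    exact ((Equiv.refl A).sumCongr
        (Equiv.sigmaCongrLeft (β := fun v => Fin (n v)) e)).apply_symm_apply t
  simp only [Fin.cast_eq_self]
  refine Eq.trans ?_ (h1 O (fun v => S.inp (G.label v)) _).symm
  rcases s with i | ⟨w, p⟩ <;> rfl

theorem Iso.bdry {V W I O I' O' : Type} {G : Wiring S V I O} {H : Wiring S W I O}
    (h : G.Iso H) (e : I' ≃ I) (f : O ≃ O') : (G.bdry e f).Iso (H.bdry e f) := by
  obtain ⟨u, hu, h⟩ := h
  obtain ⟨lab, wire⟩ := G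
  obtain rfl : lab = fun v => H.label (u v) := funext hu
  refine ⟨u, hu, fun s => ?_⟩
  rcases s with i | ⟨w, p⟩
  · have := h (.inl (e i))
    simp [Wiring.bdry] at this ⊢
    rw [this]
    rcases wire (.inl (e i)) <;> simp
  · have := h (.inr ⟨w, p⟩)
    simp [Wiring.bdry] at this ⊢
    rw [this]
    rcases wire (.inr ⟨w, p⟩) <;> simp

theorem Iso.par {ι : Type} {V W I O : ι → Type} {G : ∀ i, Wiring S (V i) (I i) (O i)}
    {H : ∀ i, Wiring S (W i) (I i) (O i)} (h : ∀ i, (G i).Iso (H i)) :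
    (Wiring.par G).Iso (Wiring.par H) := by
  choose u hu h using h
  refine ⟨Equiv.sigmaCongrRight u, fun v => hu _ _, fun s => ?_⟩
  rcases s with ⟨i, x⟩ | ⟨⟨i, v⟩, p⟩
  · refine (congrArg (Sum.map (fun o => (⟨i, o⟩ : Σ i, O i)) (fun y =>
      (⟨⟨i, y.1⟩, y.2⟩ : Σ x : (Σ i, W i), Fin (S.inp ((H x.1).label x.2)))))
        (h i (.inl x))).trans ?_
    simp [Wiring.par]
    rcases (G i).wire (.inl x) <;> simp <;> rfl
  · refine (congrArg (Sum.map (fun o => (⟨i, o⟩ : Σ i, O i)) (fun y =>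
      (⟨⟨i, y.1⟩, y.2⟩ : Σ x : (Σ i, W i), Fin (S.inp ((H x.1).label x.2)))))
        (h i (.inr ⟨v, p⟩))).trans ?_
    simp [Wiring.par]
    rcases (G i).wire (.inr ⟨v, p⟩) <;> simp <;> rfl

theorem Iso.seq {V W V' W' I M O : Type} {G : Wiring S V I M} {G' : Wiring S V' I M}
    {H : Wiring S W M O} {H' : Wiring S W' M O} (h : G.Iso G') (k : H.Iso H') :
    (G.seq H).Iso (G'.seq H') := by
  obtain ⟨u, hu, h⟩ := h
  obtain ⟨t, ht, k⟩ := k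
  refine ⟨u.sumCongr t, fun v => by rcases v with v | v; exacts [hu v, ht v], fun s => ?_⟩
  have fromG : ∀ x : M ⊕ Σ v, Fin (S.inp (G.label v)), Sum.elim (fun m => Sum.map id (fun y => (⟨.inr y.1, y.2⟩ :
        Σ u, Fin (S.inp (Sum.elim G'.label H'.label u)))) (H'.wire (.inl m)))
        (fun y : Σ v, Fin (S.inp (G'.label v)) => .inr ⟨.inl y.1, y.2⟩)
        (Sum.map id (fun x => (⟨u x.1, Fin.cast (by rw [hu]) x.2⟩ :
          Σ v, Fin (S.inp (G'.label v)))) x) =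
      Sum.map id (fun x => (⟨u.sumCongr t x.1, Fin.cast (by
          rcases x with ⟨v | v, p⟩
          exacts [congrArg S.inp (hu v), congrArg S.inp (ht v)]) x.2⟩ :
          Σ v, Fin (S.inp (Sum.elim G'.label H'.label v))))
        (Sum.elim (fun m => Sum.map id (fun y => (⟨.inr y.1, y.2⟩ :
        Σ u, Fin (S.inp (Sum.elim G.label H.label u)))) (H.wire (.inl m)))
        (fun y => .inr ⟨.inl y.1, y.2⟩) x) := by
    rintro (m | x)
    · have := k (.inl m)
      simp at this ⊢
      rw [this]
      rcases H.wire (.inl m) <;> simp <;> rfl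
    · rfl
  rcases s with i | ⟨v | w, p⟩
  · refine (congrArg (Sum.elim (fun m => Sum.map id (fun y => (⟨.inr y.1, y.2⟩ :
        Σ u, Fin (S.inp (Sum.elim G'.label H'.label u)))) (H'.wire (.inl m)))
        (fun y => .inr ⟨.inl y.1, y.2⟩)) (h (.inl i))).trans (fromG _)
  · refine (congrArg (Sum.elim (fun m => Sum.map id (fun y => (⟨.inr y.1, y.2⟩ :
        Σ u, Fin (S.inp (Sum.elim G'.label H'.label u)))) (H'.wire (.inl m)))
        (fun y => .inr ⟨.inl y.1, y.2⟩)) (h (.inr ⟨v, p⟩))).trans (fromG _)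
  · refine (congrArg (Sum.map id (fun y => (⟨.inr y.1, y.2⟩ :
        Σ u, Fin (S.inp (Sum.elim G'.label H'.label u))))) (k (.inr ⟨w, p⟩))).trans ?_
    simp [Wiring.seq]
    rcases H.wire (.inr ⟨w, p⟩) <;> simp <;> rfl

theorem seq_bdry {V W I I' M M' M'' O O' : Type} (G : Wiring S V I M) (H : Wiring S W M'' O)
    (e : I' ≃ I) (g : M ≃ M') (g' : M' ≃ M'') (f : O ≃ O') :
    (G.bdry e g).seq (H.bdry g' f) =
      (G.seq (H.bdry (g.trans g') (Equiv.refl _))).bdry e f := by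
  refine congrArg (Wiring.mk _) (Equiv.ext fun s => ?_)
  rcases s with i | ⟨v | w, p⟩
  · simp [Wiring.seq, Wiring.bdry]
    rcases G.wire (.inl (e i)) with m | x <;> simp
  · simp [Wiring.seq, Wiring.bdry]
    rcases G.wire (.inr ⟨v, p⟩) with m | x <;> simp
  · simp [Wiring.seq, Wiring.bdry]

theorem bdry_bdry {V I O I' O' I'' O'' : Type} (G : Wiring S V I O) (e : I' ≃ I) (f : O ≃ O')
    (e' : I'' ≃ I') (f' : O' ≃ O'') :
    (G.bdry e f).bdry e' f' = G.bdry (e'.trans e) (f.trans f') := by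
  refine congrArg (Wiring.mk _) (Equiv.ext fun s => ?_)
  rcases s with i | ⟨v, p⟩ <;> simp

theorem seq_bdry_right {V W I M M' O O' : Type} (G : Wiring S V I M) (H : Wiring S W M' O)
    (g : M ≃ M') (f : O ≃ O') :
    G.seq (H.bdry g f) = (G.seq (H.bdry g (Equiv.refl _))).bdry (Equiv.refl _) f := by
  refine congrArg (Wiring.mk _) (Equiv.ext fun s => ?_)
  rcases s with i | ⟨v | w, p⟩
  · simp [Wiring.seq, Wiring.bdry]
    rcases G.wire (.inl i) with m | x <;> simp
  · simp [Wiring.seq, Wiring.bdry]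
    rcases G.wire (.inr ⟨v, p⟩) with m | x <;> simp
  · simp [Wiring.seq, Wiring.bdry]

theorem seq_relabel {T V W I M O : Type} (f : T → S.Op) (G : Wiring (S.restrict f) V I M)
    (H : Wiring (S.restrict f) W M O) :
    ((G.seq H).relabel f).Iso ((G.relabel f).seq (H.relabel f)) := by
  have hl : ∀ v, f (Sum.elim G.label H.label v) =
      Sum.elim (fun v => f (G.label v)) (fun w => f (H.label w)) v := by
    rintro (v | v) <;> rfl
  have fromH : ∀ t : O ⊕ Σ w, Fin (S.inp (f (H.label w))),
      Sum.map id (fun y => (⟨.inr y.1, y.2⟩ :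
        Σ u, Fin (S.inp (Sum.elim (fun v => f (G.label v)) (fun w => f (H.label w)) u)))) t =
      Sum.map id (fun x => ⟨x.1, Fin.cast (by rw [hl]) x.2⟩) (Sum.map id (fun y =>
        (⟨.inr y.1, y.2⟩ : Σ u, Fin (S.inp (f (Sum.elim G.label H.label u))))) t) := by
    rintro (o | y) <;> rfl
  have fromG : ∀ t : M ⊕ Σ w, Fin (S.inp (f (G.label w))),
      Sum.elim (fun m => Sum.map id (fun y => (⟨.inr y.1, y.2⟩ :
        Σ u, Fin (S.inp (Sum.elim (fun v => f (G.label v)) (fun w => f (H.label w)) u))))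
          (H.wire (.inl m))) (fun y => .inr ⟨.inl y.1, y.2⟩) t =
      Sum.map id (fun x => ⟨x.1, Fin.cast (by rw [hl]) x.2⟩)
        (Sum.elim (fun m => Sum.map id (fun y =>
          (⟨.inr y.1, y.2⟩ : Σ u, Fin (S.inp (f (Sum.elim G.label H.label u)))))
            (H.wire (.inl m))) (fun y => .inr ⟨.inl y.1, y.2⟩) t) := by
    rintro (o | y)
    · exact fromH _
    · rfl
  refine Iso.of_wire hl fun s => ?_
  rcases s with i | ⟨v | w, p⟩
  · exact fromG (G.wire (.inl i))
  · exact fromG (G.wire (.inr ⟨v, p⟩))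
  · exact fromH (H.wire (.inr ⟨w, p⟩))

theorem bdry_relabel {T V I O I' O' : Type} (f : T → S.Op) (G : Wiring (S.restrict f) V I O)
    (e : I' ≃ I) (h : O ≃ O') : (G.bdry e h).relabel f = (G.relabel f).bdry e h := rfl

theorem par_relabel {T ι : Type} {V I O : ι → Type} (f : T → S.Op)
    (G : ∀ i, Wiring (S.restrict f) (V i) (I i) (O i)) :
    (par G).relabel f = par fun i => (G i).relabel f := by
  refine congrArg (Wiring.mk _) (Equiv.ext fun s => ?_)
  rcases s with ⟨i, x⟩ | ⟨⟨i, v⟩, p⟩ <;> rfl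

theorem Iso.relabel {T V W I O : Type} (f : T → S.Op) {G : Wiring (S.restrict f) V I O}
    {H : Wiring (S.restrict f) W I O} (h : G.Iso H) : (G.relabel f).Iso (H.relabel f) := by
  obtain ⟨u, hu, h⟩ := h
  exact ⟨u, fun v => congrArg f (hu v), h⟩

theorem par_bdry {ι : Type} {V I O I' O' : ι → Type} (G : ∀ i, Wiring S (V i) (I i) (O i))
    (e : ∀ i, I' i ≃ I i) (f : ∀ i, O i ≃ O' i) :
    par (fun i => (G i).bdry (e i) (f i)) =
      (par G).bdry (Equiv.sigmaCongrRight e) (Equiv.sigmaCongrRight f) := by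
  refine congrArg (Wiring.mk _) (Equiv.ext fun s => ?_)
  rcases s with ⟨i, x⟩ | ⟨⟨i, v⟩, p⟩
  · simp [Wiring.par, Wiring.bdry]
    rcases (G i).wire (.inl (e i x)) <;> simp
  · simp [Wiring.par, Wiring.bdry]
    rcases (G i).wire (.inr ⟨v, p⟩) <;> simp

theorem par_comp_iso {ι κ : Type} {V I O : ι → Type} (G : ∀ i, Wiring S (V i) (I i) (O i))
    (τ : κ ≃ ι) :
    (par fun k => G (τ k)).Iso ((par G).bdry (Equiv.sigmaCongrLeft (β := I) τ)
      (Equiv.sigmaCongrLeft (β := O) τ).symm) := by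
  have aux : ∀ k (t : O (τ k) ⊕ Σ v, Fin (S.inp ((G (τ k)).label v))),
      Sum.map (Equiv.sigmaCongrLeft (β := O) τ).symm id
        (Sum.map (fun o => (⟨τ k, o⟩ : Σ i, O i)) (fun y =>
          (⟨⟨τ k, y.1⟩, y.2⟩ : Σ x : (Σ i, V i), Fin (S.inp ((G x.1).label x.2)))) t) =
      Sum.map id (fun x : Σ x : (Σ k, V (τ k)), Fin (S.inp ((G (τ x.1)).label x.2)) =>
        (⟨⟨τ x.1.1, x.1.2⟩, x.2⟩ : Σ x : (Σ i, V i), Fin (S.inp ((G x.1).label x.2))))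
        (Sum.map (fun o => (⟨k, o⟩ : Σ k, O (τ k))) (fun y => ⟨⟨k, y.1⟩, y.2⟩) t) := by
    rintro k (o | y)
    · exact congrArg Sum.inl ((Equiv.sigmaCongrLeft (β := O) τ).symm_apply_apply ⟨k, o⟩)
    · rfl
  refine ⟨Equiv.sigmaCongrLeft (β := V) τ, fun _ => rfl, fun s => ?_⟩
  rcases s with ⟨k, x⟩ | ⟨⟨k, v⟩, p⟩
  · exact aux k _
  · exact aux k _

/-! Connectedness and acyclicity of composites. -/

theorem eqvGen_map {α β : Type} {r : α → α → Prop} {t : β → β → Prop} (f : α → β)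
    (h : ∀ x y, r x y → Relation.EqvGen t (f x) (f y)) {x y : α} (hxy : Relation.EqvGen r x y) :
    Relation.EqvGen t (f x) (f y) := by
  induction hxy with
  | rel x y hr => exact h x y hr
  | refl x => exact .refl _
  | symm x y _ ih => exact .symm _ _ ih
  | trans x y z _ _ ih ih' => exact .trans _ _ _ ih ih'

theorem Iso.acyclic {V W I O : Type} {G : Wiring S V I O} {H : Wiring S W I O} (h : G.Iso H)
    (hG : H.Acyclic) : G.Acyclic := by
  obtain ⟨u, hu, h⟩ := h
  obtain ⟨l, hl⟩ := hG
  refine ⟨fun v => l (u v), fun v p w q hvw => ?_⟩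
  have := h (.inr ⟨v, p⟩)
  rw [hvw] at this
  exact hl _ _ _ _ this

theorem Iso.connected {V W I O : Type} {G : Wiring S V I O} {H : Wiring S W I O} (h : G.Iso H)
    (hG : G.Connected) : H.Connected := by
  obtain ⟨u, hu, h⟩ := h
  obtain ⟨⟨x0⟩, hG⟩ := hG
  obtain ⟨lab, wire⟩ := G
  obtain rfl : lab = fun v => H.label (u v) := funext hu
  let f : V ⊕ (I ⊕ (Σ v, Fin (S.out (H.label (u v))))) →
    W ⊕ (I ⊕ (Σ v, Fin (S.out (H.label v)))) :=
    Sum.map u (Sum.map id (fun x => ⟨u x.1, x.2⟩))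
  have hf : Function.Surjective f := by
    refine Function.Surjective.sumMap u.surjective
      (Function.Surjective.sumMap (fun x => ⟨x, rfl⟩) ?_)
    rintro ⟨w, p⟩
    obtain ⟨v, rfl⟩ := u.surjective w
    exact ⟨⟨v, p⟩, rfl⟩
  refine ⟨⟨f x0⟩, fun x y => ?_⟩
  obtain ⟨x, rfl⟩ := hf x
  obtain ⟨y, rfl⟩ := hf y
  refine eqvGen_map f ?_ (hG x y)
  rintro _ _ (⟨v, p⟩ | ⟨s, v, p, hs⟩)
  · exact .rel _ _ (.leave _ _)
  · refine .rel _ _ (.enter _ _ p ?_)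
    have := h s
    rw [hs] at this
    exact this

theorem relabel_connected {T V I O : Type} (f : T → S.Op) {G : Wiring (S.restrict f) V I O}
    (h : G.Connected) : (G.relabel f).Connected := by
  refine ⟨h.1, fun x y => eqvGen_map id ?_ (h.2 x y)⟩
  rintro _ _ (⟨v, p⟩ | ⟨s, v, p, hs⟩)
  · exact .rel _ _ (.leave (G := G.relabel f) v p)
  · exact .rel _ _ (.enter (G := G.relabel f) s v p hs)

theorem bdry_acyclic {V I O I' O' : Type} {G : Wiring S V I O} (e : I' ≃ I) (f : O ≃ O')
    (h : G.Acyclic) : (G.bdry e f).Acyclic := by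
  obtain ⟨l, hl⟩ := h
  refine ⟨l, fun v p w q hvw => hl v p w q ?_⟩
  simp at hvw
  rcases hs : G.wire (.inr ⟨v, p⟩) with o | y
  · simp [hs] at hvw
  · simpa [hs] using hvw

theorem bdry_connected {V I O I' O' : Type} {G : Wiring S V I O} (e : I' ≃ I) (f : O ≃ O')
    (h : G.Connected) : (G.bdry e f).Connected := by
  obtain ⟨⟨x0⟩, h⟩ := h
  let g : V ⊕ (I ⊕ (Σ v, Fin (S.out (G.label v)))) → V ⊕ (I' ⊕ (Σ v, Fin (S.out (G.label v)))) :=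
    Sum.map id (Sum.map e.symm id)
  have hg : Function.Surjective g :=
    Function.Surjective.sumMap (fun x => ⟨x, rfl⟩)
      (Function.Surjective.sumMap e.symm.surjective (fun x => ⟨x, rfl⟩))
  refine ⟨⟨g x0⟩, fun x y => ?_⟩
  obtain ⟨x, rfl⟩ := hg x
  obtain ⟨y, rfl⟩ := hg y
  refine eqvGen_map g ?_ (h x y)
  rintro _ _ (⟨v, p⟩ | ⟨s, v, p, hs⟩)
  · exact .rel _ _ (.leave (G := G.bdry e f) v p)
  · refine .rel _ _ (.enter (G := G.bdry e f) _ v p ?_)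
    rcases s with i | y <;> simp [hs]

theorem par_acyclic {ι : Type} {V I O : ι → Type} {G : ∀ i, Wiring S (V i) (I i) (O i)}
    (h : ∀ i, (G i).Acyclic) : (par G).Acyclic := by
  choose l hl using h
  refine ⟨fun v => l v.1 v.2, ?_⟩
  rintro ⟨i, v⟩ p ⟨i', w⟩ q hvw
  simp at hvw
  rcases hs : (G i).wire (.inr ⟨v, p⟩) with o | ⟨y, q'⟩
  · simp [hs] at hvw
  · simp [hs] at hvw
    obtain ⟨⟨rfl, h1⟩, -⟩ := hvw
    obtain rfl := eq_of_heq h1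
    exact hl i _ _ _ _ hs

theorem seq_acyclic {V W I M O : Type} [Finite V] {G : Wiring S V I M} {H : Wiring S W M O}
    (hG : G.Acyclic) (hH : H.Acyclic) : (G.seq H).Acyclic := by
  obtain ⟨l, hl⟩ := hG
  obtain ⟨l', hl'⟩ := hH
  obtain ⟨B, hB⟩ := (Set.finite_range l).bddAbove
  have hB : ∀ v, l v ≤ B := fun v => hB ⟨v, rfl⟩
  refine ⟨Sum.elim l (fun w => B + 1 + l' w), ?_⟩
  rintro (v | v) p (w | w) q hvw
  · rcases hs : G.wire (.inr ⟨v, p⟩) with m | ⟨y, q'⟩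
    · rcases hm : H.wire (.inl m) with o | y
      · simp [hs, hm] at hvw
      · simp [hs, hm] at hvw
        exact absurd (congrArg Sigma.fst hvw) (by simp)
    · simp [hs] at hvw
      obtain ⟨rfl, -⟩ := hvw
      exact hl _ _ _ _ hs
  · have := hB v
    simp
    omega
  · rcases hs : H.wire (.inr ⟨v, p⟩) with m | ⟨y, q'⟩
    · simp [hs] at hvw
    · simp [hs] at hvw
      exact absurd (congrArg Sigma.fst hvw) (by simp)
  · rcases hs : H.wire (.inr ⟨v, p⟩) with m | ⟨y, q'⟩
    · simp [hs] at hvw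
    · simp [hs] at hvw
      obtain ⟨rfl, -⟩ := hvw
      have := hl' _ _ _ _ hs
      simpa using this

/-- Two blocks are linked by `σ` when `σ` sends a point of the first to a point of the second. -/
def Link {ι κ : Type} {J : ι → Type} {K : κ → Type} (σ : (Σ i, J i) ≃ Σ r, K r)
    (u v : ι ⊕ κ) : Prop :=
  ∃ x : Σ i, J i, u = .inl x.1 ∧ v = .inr (σ x).1

/-- `σ` is a connected permutation: the graph with the blocks as vertices, linked by `σ`, is
nonempty and connected. -/
def ConnectedPerm {ι κ : Type} {J : ι → Type} {K : κ → Type} (σ : (Σ i, J i) ≃ Σ r, K r) : Prop :=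
  Nonempty (ι ⊕ κ) ∧ ∀ u v, Relation.EqvGen (Link σ) u v

/-- The two-level graph: the graphs `P i` followed by the graphs `Q r`, the outputs of the former
being plugged into the inputs of the latter along `σ`. -/
abbrev twoLevel {ι κ : Type} {V I J : ι → Type} {W K L : κ → Type}
    (P : ∀ i, Wiring S (V i) (I i) (J i)) (Q : ∀ r, Wiring S (W r) (K r) (L r))
    (σ : (Σ i, J i) ≃ Σ r, K r) : Wiring S ((Σ i, V i) ⊕ Σ r, W r) (Σ i, I i) (Σ r, L r) :=
  (par P).seq ((par Q).bdry σ (Equiv.refl _))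

theorem twoLevel_acyclic {ι κ : Type} {V I J : ι → Type} {W K L : κ → Type} [Finite (Σ i, V i)]
    {P : ∀ i, Wiring S (V i) (I i) (J i)} {Q : ∀ r, Wiring S (W r) (K r) (L r)}
    (σ : (Σ i, J i) ≃ Σ r, K r) (hP : ∀ i, (P i).Acyclic) (hQ : ∀ r, (Q r).Acyclic) :
    (twoLevel P Q σ).Acyclic :=
  seq_acyclic (par_acyclic hP) (bdry_acyclic _ _ (par_acyclic hQ))

theorem twoLevel_connected {ι κ : Type} {V I J : ι → Type} {W K L : κ → Type}
    {P : ∀ i, Wiring S (V i) (I i) (J i)} {Q : ∀ r, Wiring S (W r) (K r) (L r)}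
    {σ : (Σ i, J i) ≃ Σ r, K r} (hσ : ConnectedPerm σ)
    (hP : ∀ i, (P i).Connected) (hQ : ∀ r, (Q r).Connected) : (twoLevel P Q σ).Connected := by
  let T := twoLevel P Q σ
  let sP : ∀ i, (I i ⊕ (Σ v, Fin (S.out ((P i).label v)))) →
      ((Σ i, I i) ⊕ (Σ v, Fin (S.out (T.label v)))) := fun i =>
    Sum.map (fun x => ⟨i, x⟩) (fun y => ⟨.inl ⟨i, y.1⟩, y.2⟩)
  let fP : ∀ i, V i ⊕ (I i ⊕ (Σ v, Fin (S.out ((P i).label v)))) →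
      ((Σ i, V i) ⊕ Σ r, W r) ⊕ ((Σ i, I i) ⊕ (Σ v, Fin (S.out (T.label v)))) := fun i =>
    Sum.map (fun v => .inl ⟨i, v⟩) (sP i)
  let sM : (Σ i, J i) → ((Σ i, I i) ⊕ (Σ v, Fin (S.out (T.label v)))) := fun x =>
    sP x.1 ((P x.1).wire.symm (.inl x.2))
  let fQ : ∀ r, W r ⊕ (K r ⊕ (Σ v, Fin (S.out ((Q r).label v)))) →
      ((Σ i, V i) ⊕ Σ r, W r) ⊕ ((Σ i, I i) ⊕ (Σ v, Fin (S.out (T.label v)))) := fun r =>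
    Sum.map (fun w => .inr ⟨r, w⟩) (Sum.elim
      (fun y => sM (σ.symm ⟨r, y⟩))
      (fun y => .inr ⟨.inr ⟨r, y.1⟩, y.2⟩))
  have wP : ∀ i s v p, (P i).wire s = .inr ⟨v, p⟩ → T.wire (sP i s) = .inr ⟨.inl ⟨i, v⟩, p⟩ := by
    rintro i (x | ⟨v, p⟩) w q h <;> simp [T, sP, h]
  have wPQ : ∀ i s z, (P i).wire s = .inl z → ∀ w p,
      (Q (σ ⟨i, z⟩).1).wire (.inl (σ ⟨i, z⟩).2) = .inr ⟨w, p⟩ →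
      T.wire (sP i s) = .inr ⟨.inr ⟨_, w⟩, p⟩ := by
    rintro i (x | ⟨v, p⟩) z h w q h' <;> simp [T, sP, h, h']
  have wM : ∀ q w p, (Q q.1).wire (.inl q.2) = .inr ⟨w, p⟩ →
      T.wire (sM (σ.symm q)) = .inr ⟨.inr ⟨q.1, w⟩, p⟩ := by
    intro q w p h
    obtain ⟨x, rfl⟩ := σ.surjective q
    rw [Equiv.symm_apply_apply]
    exact wPQ x.1 _ x.2 (Equiv.apply_symm_apply _ _) w p h
  have adjP : ∀ i x y, (P i).Adj x y → Relation.EqvGen T.Adj (fP i x) (fP i y) := by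
    rintro i _ _ (⟨v, p⟩ | ⟨s, v, p, hs⟩)
    · exact .rel _ _ (.leave (G := T) (.inl ⟨i, v⟩) p)
    · exact .rel _ _ (.enter (G := T) _ (.inl ⟨i, v⟩) p (wP i s v p hs))
  have adjQ : ∀ r x y, (Q r).Adj x y → Relation.EqvGen T.Adj (fQ r x) (fQ r y) := by
    rintro r _ _ (⟨v, p⟩ | ⟨y | y, v, p, hs⟩)
    · exact .rel _ _ (.leave (G := T) (.inr ⟨r, v⟩) p)
    · exact .rel _ _ (.enter (G := T) _ (.inr ⟨r, v⟩) p (wM ⟨r, y⟩ v p hs))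
    · refine .rel _ _ (.enter (G := T) _ (.inr ⟨r, v⟩) p ?_)
      simp [T, hs]
  have cP : ∀ i x y, Relation.EqvGen T.Adj (fP i x) (fP i y) :=
    fun i x y => eqvGen_map (fP i) (adjP i) ((hP i).2 x y)
  have cQ : ∀ i x y, Relation.EqvGen T.Adj (fQ i x) (fQ i y) :=
    fun i x y => eqvGen_map (fQ i) (adjQ i) ((hQ i).2 x y)
  let rep : ι ⊕ κ → ((Σ i, V i) ⊕ Σ r, W r) ⊕ ((Σ i, I i) ⊕ (Σ v, Fin (S.out (T.label v)))) :=
    Sum.elim (fun i => fP i (Classical.choice (hP i).1)) (fun r => fQ r (Classical.choice (hQ r).1))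
  have hrep : ∀ u v, Link σ u v → Relation.EqvGen T.Adj (rep u) (rep v) := by
    rintro _ _ ⟨⟨i, z⟩, rfl, rfl⟩
    refine .trans _ _ _ (cP i _ (.inr ((P i).wire.symm (.inl z)))) ?_
    have : fP i (.inr ((P i).wire.symm (.inl z))) = fQ (σ ⟨i, z⟩).1 (.inr (.inl (σ ⟨i, z⟩).2)) :=
      (congrArg (fun x => Sum.inr (sM x)) (σ.symm_apply_apply ⟨i, z⟩)).symm
    rw [this]
    exact cQ _ _ _
  have all : ∀ x, ∃ u, Relation.EqvGen T.Adj x (rep u) := by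
    rintro ((⟨i, v⟩ | ⟨r, w⟩) | (⟨i, x⟩ | ⟨⟨i, v⟩ | ⟨r, w⟩, p⟩))
    · exact ⟨.inl i, cP i (.inl v) _⟩
    · exact ⟨.inr r, cQ r (.inl w) _⟩
    · exact ⟨.inl i, cP i (.inr (.inl x)) _⟩
    · exact ⟨.inl i, cP i (.inr (.inr ⟨v, p⟩)) _⟩
    · exact ⟨.inr r, cQ r (.inr (.inr ⟨w, p⟩)) _⟩
  obtain ⟨⟨u0⟩, hσ⟩ := hσ
  refine ⟨⟨rep u0⟩, fun x y => ?_⟩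
  obtain ⟨u, hu⟩ := all x
  obtain ⟨v, hv⟩ := all y
  exact .trans _ _ _ hu (.trans _ _ _ (eqvGen_map rep hrep (hσ u v)) (.symm _ _ hv))

end Wiring

open scoped BigOperators

/-- A connected directed acyclic graph with numbered vertices, `m` outputs and `n` inputs. -/
structure DGraph (S : Sig) (m n : ℕ) where
  size : ℕ
  graph : Wiring S (Fin size) (Fin n) (Fin m)
  connected : graph.Connected
  acyclic : graph.Acyclic

/-- Graphs are considered up to isomorphism (renumbering of the vertices). -/
instance DGraph.setoid (S : Sig) (m n : ℕ) : Setoid (DGraph S m n) where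
  r G H := G.graph.Iso H.graph
  iseqv := ⟨fun G => Wiring.Iso.refl G.graph, fun h => h.symm, fun h h' => h.trans h'⟩

/-- The monomials: isomorphism classes of connected directed acyclic graphs. -/
def Monomial (S : Sig) (m n : ℕ) : Type := Quotient (DGraph.setoid S m n)

/-- The combinatorial part of a two-level composition, with `m` outputs and `n` inputs:
`a` blocks of biarities `(j x, i x)`, followed by `b` blocks of biarities `(l y, k y)`, a
connected permutation `σ₂` between the two levels, and permutations `σ₁` of the inputs and `σ₃`
of the outputs. -/
structure Shape (m n : ℕ) where
  b : ℕ
  a : ℕ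
  l : Fin b → ℕ
  k : Fin b → ℕ
  j : Fin a → ℕ
  i : Fin a → ℕ
  σ₃ : (Σ y, Fin (l y)) ≃ Fin m
  σ₂ : (Σ x, Fin (j x)) ≃ Σ y, Fin (k y)
  σ₁ : Fin n ≃ Σ x, Fin (i x)
  connected : Wiring.ConnectedPerm σ₂

/-- The group `𝕊_m × 𝕊_n^op`. -/
abbrev BiPerm (m n : ℕ) : Type := Equiv.Perm (Fin m) × (Equiv.Perm (Fin n))ᵐᵒᵖ

namespace Shape
variable {m n : ℕ}

/-- The outer action: `σ₃` becomes `σ σ₃` and `σ₁` becomes `σ₁ τ`. -/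
abbrev outer (s : Shape m n) (g : BiPerm m n) : Shape m n :=
  { s with σ₃ := s.σ₃.trans g.1, σ₁ := Equiv.trans g.2.unop s.σ₁ }

/-- Absorbing permutations of the blocks of the second level into `σ₃` and `σ₂`. -/
abbrev absorbSnd (s : Shape m n) (g : ∀ y, BiPerm (s.l y) (s.k y)) : Shape m n :=
  { s with
    σ₃ := (Equiv.sigmaCongrRight fun y => (g y).1).trans s.σ₃
    σ₂ := s.σ₂.trans (Equiv.sigmaCongrRight fun y => (g y).2.unop)
    connected := s.connected }

/-- Absorbing permutations of the blocks of the first level into `σ₂` and `σ₁`. -/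
abbrev absorbFst (s : Shape m n) (g : ∀ x, BiPerm (s.j x) (s.i x)) : Shape m n :=
  { s with
    σ₂ := (Equiv.sigmaCongrRight fun x => (g x).1).trans s.σ₂
    σ₁ := s.σ₁.trans (Equiv.sigmaCongrRight fun x => (g x).2.unop)
    connected := by
      refine ⟨s.connected.1, fun u v =>
        Wiring.eqvGen_map id ?_ (s.connected.2 u v)⟩
      rintro _ _ ⟨x, rfl, rfl⟩
      obtain ⟨x, rfl⟩ := (Equiv.sigmaCongrRight fun x => (g x).1).surjective x
      exact .rel _ _ ⟨x, rfl, rfl⟩ }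

/-- Renumbering the blocks of both levels. -/
abbrev block (s : Shape m n) (ρ : Equiv.Perm (Fin s.b)) (τ : Equiv.Perm (Fin s.a)) : Shape m n where
  b := s.b
  a := s.a
  l y := s.l (ρ y)
  k y := s.k (ρ y)
  j x := s.j (τ x)
  i x := s.i (τ x)
  σ₃ := (Equiv.sigmaCongrLeft (β := fun y => Fin (s.l y)) ρ).trans s.σ₃
  σ₂ := (Equiv.sigmaCongrLeft (β := fun x => Fin (s.j x)) τ).trans
    (s.σ₂.trans (Equiv.sigmaCongrLeft (β := fun y => Fin (s.k y)) ρ).symm)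
  σ₁ := s.σ₁.trans (Equiv.sigmaCongrLeft (β := fun x => Fin (s.i x)) τ).symm
  connected := by
    refine ⟨s.connected.1, fun u v => ?_⟩
    have := Wiring.eqvGen_map (Sum.map τ.symm ρ.symm) (t := Wiring.Link
      ((Equiv.sigmaCongrLeft (β := fun x => Fin (s.j x)) τ).trans
        (s.σ₂.trans (Equiv.sigmaCongrLeft (β := fun y => Fin (s.k y)) ρ).symm))) ?_
      (s.connected.2 (Sum.map τ ρ u) (Sum.map τ ρ v))
    · simpa [Sum.map_map] using this
    · rintro _ _ ⟨x, rfl, rfl⟩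
      obtain ⟨x, rfl⟩ := (Equiv.sigmaCongrLeft (β := fun x => Fin (s.j x)) τ).surjective x
      refine .rel _ _ ⟨x, ?_, ?_⟩
      · simp
      · simp only [Sum.map_inr, Equiv.trans_apply, Sum.inr.injEq]
        generalize s.σ₂ _ = y
        obtain ⟨y, rfl⟩ := (Equiv.sigmaCongrLeft (β := fun y => Fin (s.k y)) ρ).surjective y
        rw [Equiv.symm_apply_apply]
        exact ρ.symm_apply_apply y.1

end Shape

namespace Monomial
variable {S : Sig} {m n : ℕ}

/-- The isomorphism class of a graph. -/
def mk (G : DGraph S m n) : Monomial S m n := Quotient.mk _ G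

/-- The number of vertices. -/
def size (G : Monomial S m n) : ℕ :=
  Quotient.lift DGraph.size (fun _ _ h => by
    obtain ⟨e, -⟩ := h
    simpa using Fintype.card_congr e) G

/-- The isomorphism class of a graph with any finite set of vertices. -/
noncomputable def ofWiring {V : Type} [Fintype V] (G : Wiring S V (Fin n) (Fin m))
    (hc : G.Connected) (ha : G.Acyclic) : Monomial S m n :=
  mk ⟨Fintype.card V, G.reindex (Fintype.equivFin V).symm,
    (G.reindex_iso _).symm.connected hc, (G.reindex_iso _).acyclic ha⟩

theorem ofWiring_eq {V W : Type} [Fintype V] [Fintype W] {G : Wiring S V (Fin n) (Fin m)}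
    {H : Wiring S W (Fin n) (Fin m)} (h : G.Iso H) (hc ha hc' ha') :
    ofWiring G hc ha = ofWiring H hc' ha' :=
  Quotient.sound (((G.reindex_iso _).trans h).trans (H.reindex_iso _).symm)

/-- `σ · G · τ`: the input `x` of the new graph is the input `τ x` of `G`, and the output `y` of
`G` is the output `σ y` of the new graph. -/
noncomputable instance : MulAction (BiPerm m n) (Monomial S m n) where
  smul g := Quotient.map
    (fun G => ⟨G.size, G.graph.bdry g.2.unop g.1, Wiring.bdry_connected _ _ G.connected,
      Wiring.bdry_acyclic _ _ G.acyclic⟩)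
    (fun _ _ h => h.bdry _ _)
  one_smul G := by
    induction G using Quotient.inductionOn with
    | h G =>
      refine Quotient.sound (Wiring.Iso.of_wire (fun _ => rfl) fun s => ?_)
      rcases s with i | y <;> simp <;> exact (congrFun Sum.map_id_id _).symm
  mul_smul g h G := by
    induction G using Quotient.inductionOn with
    | h G =>
      refine Quotient.sound (Wiring.Iso.of_wire (fun _ => rfl) fun s => ?_)
      rcases s with i | y <;> simp <;> rfl

theorem smul_mk (g : BiPerm m n) (G : DGraph S m n) :
    (g • mk G : Monomial S m n) =
      mk ⟨G.size, G.graph.bdry g.2.unop g.1, Wiring.bdry_connected _ _ G.connected,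
        Wiring.bdry_acyclic _ _ G.acyclic⟩ := rfl

/-- The two-level composition of graphs: the graphs `P x`, followed by the graphs `Q y`. -/
noncomputable def compRep (s : Shape m n) (Q : ∀ y, DGraph S (s.l y) (s.k y))
    (P : ∀ x, DGraph S (s.j x) (s.i x)) : Monomial S m n :=
  ofWiring ((Wiring.twoLevel (fun x => (P x).graph) (fun y => (Q y).graph) s.σ₂).bdry s.σ₁ s.σ₃)
    (Wiring.bdry_connected _ _ (Wiring.twoLevel_connected s.connected
      (fun x => (P x).connected) (fun y => (Q y).connected)))
    (Wiring.bdry_acyclic _ _ (Wiring.twoLevel_acyclic s.σ₂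
      (fun x => (P x).acyclic) (fun y => (Q y).acyclic)))

/-- The two-level composition of monomials; see `comp_mk`. -/
noncomputable def comp (s : Shape m n) (q : ∀ y, Monomial S (s.l y) (s.k y))
    (p : ∀ x, Monomial S (s.j x) (s.i x)) : Monomial S m n :=
  compRep s (fun y => (q y).out) (fun x => (p x).out)

theorem compRep_congr (s : Shape m n) {Q Q' : ∀ y, DGraph S (s.l y) (s.k y)}
    {P P' : ∀ x, DGraph S (s.j x) (s.i x)} (hQ : ∀ y, (Q y).graph.Iso (Q' y).graph)
    (hP : ∀ x, (P x).graph.Iso (P' x).graph) : compRep s Q P = compRep s Q' P' :=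
  ofWiring_eq (((Wiring.Iso.par hP).seq ((Wiring.Iso.par hQ).bdry _ _)).bdry _ _) _ _ _ _

theorem comp_mk (s : Shape m n) (Q : ∀ y, DGraph S (s.l y) (s.k y))
    (P : ∀ x, DGraph S (s.j x) (s.i x)) :
    comp s (fun y => mk (Q y)) (fun x => mk (P x)) = compRep s Q P :=
  compRep_congr s (fun y => Quotient.mk_out (Q y)) (fun x => Quotient.mk_out (P x))

theorem exists_rep {ι : Type} {l k : ι → ℕ} (q : ∀ y, Monomial S (l y) (k y)) :
    ∃ Q : ∀ y, DGraph S (l y) (k y), q = fun y => mk (Q y) :=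
  ⟨fun y => (q y).out, funext fun y => (Quotient.out_eq (q y)).symm⟩

theorem comp_outer (s : Shape m n) (g : BiPerm m n) (q : ∀ y, Monomial S (s.l y) (s.k y))
    (p : ∀ x, Monomial S (s.j x) (s.i x)) : comp (s.outer g) q p = g • comp s q p := by
  refine Quotient.sound ((Wiring.reindex_iso _ _).trans (.trans ?_
    ((Wiring.reindex_iso ((Wiring.twoLevel (fun x => (p x).out.graph) (fun y => (q y).out.graph)
      s.σ₂).bdry s.σ₁ s.σ₃) _).symm.bdry _ _)))
  rw [Wiring.bdry_bdry]
  exact Wiring.Iso.refl _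

theorem comp_absorbSnd (s : Shape m n) (g : ∀ y, BiPerm (s.l y) (s.k y))
    (q : ∀ y, Monomial S (s.l y) (s.k y)) (p : ∀ x, Monomial S (s.j x) (s.i x)) :
    comp s (fun y => g y • q y) p = comp (s.absorbSnd g) q p := by
  obtain ⟨Q, rfl⟩ := exists_rep q
  obtain ⟨P, rfl⟩ := exists_rep p
  refine (comp_mk s (fun y => ⟨(Q y).size, (Q y).graph.bdry (g y).2.unop (g y).1,
    Wiring.bdry_connected _ _ (Q y).connected, Wiring.bdry_acyclic _ _ (Q y).acyclic⟩) _).trans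
    (.trans ?_ (comp_mk (s.absorbSnd g) _ _).symm)
  refine ofWiring_eq ?_ _ _ _ _
  simp only [Wiring.twoLevel]
  rw [Wiring.par_bdry (fun y => (Q y).graph), Wiring.bdry_bdry, Wiring.seq_bdry_right,
    Wiring.bdry_bdry]
  exact Wiring.Iso.refl _

theorem comp_absorbFst (s : Shape m n) (g : ∀ x, BiPerm (s.j x) (s.i x))
    (q : ∀ y, Monomial S (s.l y) (s.k y)) (p : ∀ x, Monomial S (s.j x) (s.i x)) :
    comp s q (fun x => g x • p x) = comp (s.absorbFst g) q p := by
  obtain ⟨Q, rfl⟩ := exists_rep q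
  obtain ⟨P, rfl⟩ := exists_rep p
  refine (comp_mk s _ (fun x => ⟨(P x).size, (P x).graph.bdry (g x).2.unop (g x).1,
    Wiring.bdry_connected _ _ (P x).connected, Wiring.bdry_acyclic _ _ (P x).acyclic⟩)).trans
    (.trans ?_ (comp_mk (s.absorbFst g) _ _).symm)
  refine ofWiring_eq ?_ _ _ _ _
  simp only [Wiring.twoLevel]
  rw [Wiring.par_bdry (fun x => (P x).graph), Wiring.seq_bdry, Wiring.bdry_bdry]
  exact Wiring.Iso.refl _

theorem comp_block (s : Shape m n) (ρ : Equiv.Perm (Fin s.b)) (τ : Equiv.Perm (Fin s.a))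
    (q : ∀ y, Monomial S (s.l y) (s.k y)) (p : ∀ x, Monomial S (s.j x) (s.i x)) :
    comp (s.block ρ τ) (fun y => q (ρ y)) (fun x => p (τ x)) = comp s q p := by
  obtain ⟨Q, rfl⟩ := exists_rep q
  obtain ⟨P, rfl⟩ := exists_rep p
  refine (comp_mk (s.block ρ τ) (fun y => Q (ρ y)) (fun x => P (τ x))).trans
    (.trans ?_ (comp_mk s _ _).symm)
  refine ofWiring_eq ?_ _ _ _ _
  refine .trans ((Wiring.Iso.seq (Wiring.par_comp_iso (fun x => (P x).graph) τ)
    ((Wiring.par_comp_iso (fun y => (Q y).graph) ρ).bdry _ _)).bdry _ _) ?_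
  rw [Wiring.bdry_bdry, Wiring.seq_bdry, Wiring.bdry_bdry]
  have h1 : (s.block ρ τ).σ₁.trans (Equiv.sigmaCongrLeft (β := fun x => Fin (s.i x)) τ) = s.σ₁ := by
    ext1 x
    simp [Shape.block]
  have h2 : (Equiv.sigmaCongrLeft (β := fun x => Fin (s.j x)) τ).symm.trans ((s.block ρ τ).σ₂.trans
      (Equiv.sigmaCongrLeft (β := fun y => Fin (s.k y)) ρ)) = s.σ₂ := by
    ext1 x
    simp [Shape.block]
  have h3 : ((Equiv.sigmaCongrLeft (β := fun y => Fin (s.l y)) ρ).symm.trans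
      (Equiv.refl _)).trans (s.block ρ τ).σ₃ = s.σ₃ := by
    ext1 x
    simp [Shape.block]
  have key : ∀ a b c, a = s.σ₁ → b = s.σ₂ → c = s.σ₃ →
    (((Wiring.par fun x => (P x).graph).seq ((Wiring.par fun y => (Q y).graph).bdry b
      (Equiv.refl _))).bdry a c).Iso (((Wiring.par fun x => (P x).graph).seq
      ((Wiring.par fun y => (Q y).graph).bdry s.σ₂ (Equiv.refl _))).bdry s.σ₁ s.σ₃) := by
    rintro _ _ _ rfl rfl rfl
    exact Wiring.Iso.refl _
  exact key _ _ _ h1 h2 h3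

/-- Changing the labels along `f`. -/
def relabel {T : Type} (f : T → S.Op) : Monomial (S.restrict f) m n → Monomial S m n :=
  Quotient.map (fun G => ⟨G.size, G.graph.relabel f, Wiring.relabel_connected f G.connected,
    G.acyclic⟩) (fun _ _ h => h.relabel f)

theorem relabel_smul {T : Type} (f : T → S.Op) (g : BiPerm m n)
    (G : Monomial (S.restrict f) m n) : relabel f (g • G) = g • relabel f G := by
  induction G using Quotient.inductionOn with
  | h G => rfl

theorem relabel_comp {T : Type} (f : T → S.Op) (s : Shape m n)
    (q : ∀ y, Monomial (S.restrict f) (s.l y) (s.k y))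
    (p : ∀ x, Monomial (S.restrict f) (s.j x) (s.i x)) :
    relabel f (comp s q p) = comp s (fun y => relabel f (q y)) (fun x => relabel f (p x)) := by
  obtain ⟨Q, rfl⟩ := exists_rep q
  obtain ⟨P, rfl⟩ := exists_rep p
  rw [comp_mk]
  refine Eq.trans ?_ (comp_mk s (fun y => ⟨(Q y).size, (Q y).graph.relabel f,
    Wiring.relabel_connected f (Q y).connected, (Q y).acyclic⟩) (fun x => ⟨(P x).size,
    (P x).graph.relabel f, Wiring.relabel_connected f (P x).connected, (P x).acyclic⟩)).symm
  refine Quotient.sound (((Wiring.reindex_iso _ _).relabel f).trans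
    (.trans ?_ (Wiring.reindex_iso _ _).symm))
  have h := (Wiring.seq_relabel f (Wiring.par fun x => (P x).graph)
    ((Wiring.par fun y => (Q y).graph).bdry s.σ₂ (Equiv.refl _))).bdry s.σ₁ s.σ₃
  rw [Wiring.bdry_relabel, Wiring.par_relabel, Wiring.par_relabel] at h
  exact h

end Monomial

/-! ### `𝕊`-bimodules -/

/-- An `𝕊`-bimodule over `ℂ`: a family of representations of `𝕊_m × 𝕊_n^op`. -/
structure SBimodule where
  carrier : ℕ → ℕ → Type
  [addCommGroup : ∀ m n, AddCommGroup (carrier m n)]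
  [module : ∀ m n, Module ℂ (carrier m n)]
  rho : ∀ m n, Representation ℂ (BiPerm m n) (carrier m n)

attribute [instance] SBimodule.addCommGroup SBimodule.module

/-- Morphisms of `𝕊`-bimodules. -/
structure SBimodule.Hom (M N : SBimodule) where
  toLin : ∀ m n, M.carrier m n →ₗ[ℂ] N.carrier m n
  equivariant : ∀ m n g x, toLin m n (M.rho m n g x) = N.rho m n g (toLin m n x)

/-- The representation of `G` on the vector space with basis a `G`-set. -/
noncomputable def permRep (G X : Type) [Group G] [MulAction G X] :
    Representation ℂ G (X →₀ ℂ) where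
  toFun g := Finsupp.lmapDomain ℂ ℂ (g • ·)
  map_one' := by ext; simp
  map_mul' g h := by ext; simp [mul_smul]

@[simp]
theorem permRep_single {G X : Type} [Group G] [MulAction G X] (g : G) (x : X) (c : ℂ) :
    permRep G X g (Finsupp.single x c) = Finsupp.single (g • x) c := by
  simp [permRep]

/-- The quotient of an `𝕊`-bimodule by a sub-`𝕊`-bimodule. -/
noncomputable abbrev SBimodule.quotient (M : SBimodule) (J : ∀ m n, Submodule ℂ (M.carrier m n))
    (hJ : ∀ m n g x, x ∈ J m n → M.rho m n g x ∈ J m n) : SBimodule where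
  carrier m n := M.carrier m n ⧸ J m n
  rho m n := (M.rho m n).quotient (J m n) (fun g x hx => hJ m n g x hx)

/-! ### The connected composition product -/

namespace SBimodule
variable (Q P : SBimodule)

/-- The symbols `σ₃ ⊗ (q_1, …, q_b) ⊗ σ₂ ⊗ (p_1, …, p_a) ⊗ σ₁`. -/
structure BoxGen (m n : ℕ) where
  shape : Shape m n
  snd : ∀ y, Q.carrier (shape.l y) (shape.k y)
  fst : ∀ x, P.carrier (shape.j x) (shape.i x)

instance (m n : ℕ) : MulAction (BiPerm m n) (BoxGen Q P m n) where
  smul g t := ⟨t.shape.outer g, t.snd, t.fst⟩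
  one_smul _ := rfl
  mul_smul _ _ _ := rfl

variable {Q P} in
/-- The symbol, as a vector. -/
noncomputable abbrev BoxGen.vec {m n : ℕ} (s : Shape m n) (q : ∀ y, Q.carrier (s.l y) (s.k y))
    (p : ∀ x, P.carrier (s.j x) (s.i x)) : BoxGen Q P m n →₀ ℂ :=
  Finsupp.single ⟨s, q, p⟩ 1

open Function BoxGen in
/-- The relations between the symbols: multilinearity in the `q_y` and in the `p_x`, passage of
the permutations of each block from one side of the tensor signs to the other, and
renumbering of the blocks. -/
inductive BoxRel {m n : ℕ} : (BoxGen Q P m n →₀ ℂ) → Prop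
  | add_snd (s : Shape m n) (q : ∀ y, Q.carrier (s.l y) (s.k y))
      (p : ∀ x, P.carrier (s.j x) (s.i x)) (y u v) :
      BoxRel (vec s (update q y (u + v)) p - (vec s (update q y u) p + vec s (update q y v) p))
  | smul_snd (s : Shape m n) (q : ∀ y, Q.carrier (s.l y) (s.k y))
      (p : ∀ x, P.carrier (s.j x) (s.i x)) (y u) (c : ℂ) :
      BoxRel (vec s (update q y (c • u)) p - c • vec s (update q y u) p)
  | add_fst (s : Shape m n) (q : ∀ y, Q.carrier (s.l y) (s.k y))
      (p : ∀ x, P.carrier (s.j x) (s.i x)) (x u v) :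
      BoxRel (vec s q (update p x (u + v)) - (vec s q (update p x u) + vec s q (update p x v)))
  | smul_fst (s : Shape m n) (q : ∀ y, Q.carrier (s.l y) (s.k y))
      (p : ∀ x, P.carrier (s.j x) (s.i x)) (x u) (c : ℂ) :
      BoxRel (vec s q (update p x (c • u)) - c • vec s q (update p x u))
  | act_snd (s : Shape m n) (q : ∀ y, Q.carrier (s.l y) (s.k y))
      (p : ∀ x, P.carrier (s.j x) (s.i x)) (g : ∀ y, BiPerm (s.l y) (s.k y)) :
      BoxRel (vec s (fun y => Q.rho _ _ (g y) (q y)) p - vec (s.absorbSnd g) q p)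
  | act_fst (s : Shape m n) (q : ∀ y, Q.carrier (s.l y) (s.k y))
      (p : ∀ x, P.carrier (s.j x) (s.i x)) (g : ∀ x, BiPerm (s.j x) (s.i x)) :
      BoxRel (vec s q (fun x => P.rho _ _ (g x) (p x)) - vec (s.absorbFst g) q p)
  | block (s : Shape m n) (q : ∀ y, Q.carrier (s.l y) (s.k y))
      (p : ∀ x, P.carrier (s.j x) (s.i x)) (ρ : Equiv.Perm (Fin s.b)) (τ : Equiv.Perm (Fin s.a)) :
      BoxRel (vec (s.block ρ τ) (fun y => q (ρ y)) (fun x => p (τ x)) - vec s q p)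

theorem BoxRel.smul {m n : ℕ} (g : BiPerm m n) {x : BoxGen Q P m n →₀ ℂ} (h : BoxRel Q P x) :
    BoxRel Q P (permRep _ _ g x) := by
  rcases h with ⟨s, q, p, y, u, v⟩ | ⟨s, q, p, y, u, c⟩ | ⟨s, q, p, y, u, v⟩ | ⟨s, q, p, y, u, c⟩ |
    ⟨s, q, p, g'⟩ | ⟨s, q, p, g'⟩ | ⟨s, q, p, ρ, τ⟩ <;>
    simp only [map_add, map_sub, map_smul, BoxGen.vec, permRep_single]
  · exact .add_snd (s.outer g) q p y u v
  · exact .smul_snd (s.outer g) q p y u c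
  · exact .add_fst (s.outer g) q p y u v
  · exact .smul_fst (s.outer g) q p y u c
  · exact .act_snd (s.outer g) q p g'
  · exact .act_fst (s.outer g) q p g'
  · exact .block (s.outer g) q p ρ τ

/-- The connected composition product `Q ⊠ P`. -/
noncomputable abbrev box : SBimodule :=
  quotient { carrier := fun m n => BoxGen Q P m n →₀ ℂ, rho := fun _ _ => permRep _ _ }
    (fun _ _ => Submodule.span ℂ {x | BoxRel Q P x}) (by
      intro m n g x hx
      induction hx using Submodule.span_induction with
      | mem x h => exact Submodule.subset_span (BoxRel.smul Q P g h)
      | zero => rw [map_zero]; exact zero_mem _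
      | add x y _ _ ih ih' => rw [map_add]; exact add_mem ih ih'
      | smul c x _ ih => rw [map_smul]; exact Submodule.smul_mem _ _ ih)

variable {Q P} in
/-- The class of a symbol in `Q ⊠ P`. -/
noncomputable def box.mk {m n : ℕ} (s : Shape m n) (q : ∀ y, Q.carrier (s.l y) (s.k y))
    (p : ∀ x, P.carrier (s.j x) (s.i x)) : (box Q P).carrier m n :=
  Submodule.Quotient.mk (BoxGen.vec s q p)

/-- The weight `w` part of `Q ⊠ P`, for weight-graded `Q` and `P`: it is spanned by the symbols
whose entries are homogeneous of total weight `w`. -/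
noncomputable def boxWeight (wQ : ℕ → ∀ m n, Submodule ℂ (Q.carrier m n))
    (wP : ℕ → ∀ m n, Submodule ℂ (P.carrier m n)) (w m n : ℕ) :
    Submodule ℂ ((box Q P).carrier m n) :=
  Submodule.span ℂ {t | ∃ (s : Shape m n) (q : ∀ y, Q.carrier (s.l y) (s.k y))
    (p : ∀ x, P.carrier (s.j x) (s.i x)) (u : Fin s.b → ℕ) (v : Fin s.a → ℕ),
    (∀ y, q y ∈ wQ (u y) _ _) ∧ (∀ x, p x ∈ wP (v x) _ _) ∧
    ∑ y, u y + ∑ x, v x = w ∧ t = box.mk s q p}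

end SBimodule

/-! ### Free properads, ideals, quotients -/

/-- The multilinear extension of a function of basis vectors. -/
noncomputable def multiExtend {ι W : Type} [Finite ι] {B : ι → Type} [AddCommGroup W] [Module ℂ W]
    (f : (∀ i, B i) → W) : MultilinearMap ℂ (fun i => B i →₀ ℂ) W :=
  ((Basis.piTensorProduct fun _ => Finsupp.basisSingleOne).constr ℂ f).compMultilinearMap
    (PiTensorProduct.tprod ℂ)

theorem multiExtend_single {ι W : Type} [Finite ι] {B : ι → Type} [AddCommGroup W] [Module ℂ W]
    (f : (∀ i, B i) → W) (g : ∀ i, B i) :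
    multiExtend f (fun i => Finsupp.single (g i) 1) = f g := by
  have : PiTensorProduct.tprod ℂ (fun i => Finsupp.single (g i) (1 : ℂ)) =
      (Basis.piTensorProduct fun _ => Finsupp.basisSingleOne) g := by
    simp only [Basis.piTensorProduct_apply, Finsupp.coe_basisSingleOne]
  rw [multiExtend, LinearMap.compMultilinearMap_apply, this, Module.Basis.constr_basis]

/-- The free properad on the `𝕊`-bimodule freely generated by the operations of `S`: it has a
basis formed by the isomorphism classes of connected directed acyclic graphs with vertices
labelled by operations. -/
noncomputable abbrev free (S : Sig) : SBimodule where
  carrier := fun m n => Monomial S m n →₀ ℂ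
  rho := fun _ _ => permRep _ _

theorem multilinear_ext₂ {ι κ W : Type} [Finite ι] [Finite κ] {B : ι → Type} {D : κ → Type}
    [AddCommGroup W] [Module ℂ W]
    {f f' : MultilinearMap ℂ (fun i => B i →₀ ℂ) (MultilinearMap ℂ (fun i => D i →₀ ℂ) W)}
    (h : ∀ (G : ∀ i, B i) (H : ∀ i, D i), f (fun i => Finsupp.single (G i) 1) (fun i => Finsupp.single (H i) 1) =
      f' (fun i => Finsupp.single (G i) 1) (fun i => Finsupp.single (H i) 1)) : f = f' := by
  refine Module.Basis.ext_multilinear (fun _ => Finsupp.basisSingleOne) fun G => ?_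
  refine Module.Basis.ext_multilinear (fun _ => Finsupp.basisSingleOne) fun H => ?_
  simpa only [Finsupp.coe_basisSingleOne] using h G H

/-- Renumbering of the variables of a multilinear map. -/
def multiPrecomp {ι W : Type} {M : ι → Type} [∀ i, AddCommGroup (M i)] [∀ i, Module ℂ (M i)]
    [AddCommGroup W] [Module ℂ W] (ρ : Equiv.Perm ι) :
    MultilinearMap ℂ (fun i => M (ρ i)) W →ₗ[ℂ] MultilinearMap ℂ M W where
  toFun f :=
    { toFun := fun x => f fun i => x (ρ i)
      map_update_add' := fun x i u v => by
        classical
        obtain ⟨i, rfl⟩ := ρ.surjective i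
        simp only [Function.update_comp_eq_of_injective' _ ρ.injective]
        exact f.map_update_add _ _ _ _
      map_update_smul' := fun x i c u => by
        classical
        obtain ⟨i, rfl⟩ := ρ.surjective i
        simp only [Function.update_comp_eq_of_injective' _ ρ.injective]
        exact f.map_update_smul _ _ _ _ }
  map_add' _ _ := rfl
  map_smul' _ _ := rfl

namespace free
variable {S : Sig} {m n : ℕ}

/-- The two-level composition of the free properad: the multilinear extension of the composition
of monomials. -/
noncomputable def comp (s : Shape m n) :
    MultilinearMap ℂ (fun y => Monomial S (s.l y) (s.k y) →₀ ℂ)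
      (MultilinearMap ℂ (fun x => Monomial S (s.j x) (s.i x) →₀ ℂ) (Monomial S m n →₀ ℂ)) :=
  multiExtend fun G => multiExtend fun H => Finsupp.single (Monomial.comp s G H) 1

theorem comp_single (s : Shape m n) (G : ∀ y, Monomial S (s.l y) (s.k y))
    (H : ∀ x, Monomial S (s.j x) (s.i x)) :
    comp s (fun y => Finsupp.single (G y) 1) (fun x => Finsupp.single (H x) 1) =
      Finsupp.single (Monomial.comp s G H) 1 := by
  rw [comp, multiExtend_single, multiExtend_single]

theorem comp_outer (s : Shape m n) (g : BiPerm m n)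
    (q : ∀ y, (free S).carrier (s.l y) (s.k y)) (p : ∀ x, (free S).carrier (s.j x) (s.i x)) :
    comp (s.outer g) q p = (free S).rho m n g (comp s q p) := by
  have : comp (S := S) (s.outer g) =
      (LinearMap.compMultilinearMapₗ ℂ ((free S).rho m n g)).compMultilinearMap (comp s) := by
    refine multilinear_ext₂ fun G H => ?_
    simp only [LinearMap.compMultilinearMap_apply, LinearMap.compMultilinearMapₗ_apply]
    rw [comp_single (s.outer g), comp_single s, permRep_single, Monomial.comp_outer]
  rw [this]
  rfl

theorem comp_absorbSnd (s : Shape m n) (g : ∀ y, BiPerm (s.l y) (s.k y))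
    (q : ∀ y, (free S).carrier (s.l y) (s.k y)) (p : ∀ x, (free S).carrier (s.j x) (s.i x)) :
    comp s (fun y => (free S).rho _ _ (g y) (q y)) p = comp (s.absorbSnd g) q p := by
  have : comp (S := S) (s.absorbSnd g) =
      (comp s).compLinearMap (fun y => (free S).rho _ _ (g y)) := by
    refine multilinear_ext₂ fun G H => ?_
    rw [MultilinearMap.compLinearMap_apply]
    simp only [permRep_single]
    rw [comp_single (s.absorbSnd g), comp_single s, Monomial.comp_absorbSnd]
  rw [this]
  rfl

theorem comp_absorbFst (s : Shape m n) (g : ∀ x, BiPerm (s.j x) (s.i x))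
    (q : ∀ y, (free S).carrier (s.l y) (s.k y)) (p : ∀ x, (free S).carrier (s.j x) (s.i x)) :
    comp s q (fun x => (free S).rho _ _ (g x) (p x)) = comp (s.absorbFst g) q p := by
  have : comp (S := S) (s.absorbFst g) =
      (MultilinearMap.compLinearMapₗ (fun x => (free S).rho _ _ (g x))).compMultilinearMap
        (comp s) := by
    refine multilinear_ext₂ fun G H => ?_
    simp only [LinearMap.compMultilinearMap_apply, MultilinearMap.compLinearMapₗ_apply]
    rw [MultilinearMap.compLinearMap_apply]
    simp only [permRep_single]
    rw [comp_single (s.absorbFst g), comp_single s, Monomial.comp_absorbFst]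
  rw [this]
  rfl

theorem comp_block (s : Shape m n) (ρ : Equiv.Perm (Fin s.b)) (τ : Equiv.Perm (Fin s.a))
    (q : ∀ y, (free S).carrier (s.l y) (s.k y)) (p : ∀ x, (free S).carrier (s.j x) (s.i x)) :
    comp (s.block ρ τ) (fun y => q (ρ y)) (fun x => p (τ x)) = comp s q p := by
  have : comp (S := S) s = multiPrecomp (M := fun y => Monomial S (s.l y) (s.k y) →₀ ℂ) ρ
      ((multiPrecomp (M := fun x => Monomial S (s.j x) (s.i x) →₀ ℂ) τ).compMultilinearMap
        (comp (s.block ρ τ))) := by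
    refine multilinear_ext₂ fun G H => ?_
    rw [comp_single s, ← Monomial.comp_block s ρ τ]
    exact (comp_single (s.block ρ τ) (fun y => G (ρ y)) (fun x => H (τ x))).symm
  rw [this]
  rfl

end free

/-- The ideal of the free properad generated by `R`: the smallest family of subspaces containing
`R`, stable under the actions of the symmetric groups, and containing all two-level compositions
with at least one entry in it. -/
inductive IdealMem {S : Sig} (R : ∀ m n, Set ((free S).carrier m n)) :
    ∀ m n, (free S).carrier m n → Prop
  | of {m n : ℕ} {x : (free S).carrier m n} (h : x ∈ R m n) : IdealMem R m n x
  | zero (m n : ℕ) : IdealMem R m n 0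
  | add {m n : ℕ} {x y : (free S).carrier m n} (hx : IdealMem R m n x) (hy : IdealMem R m n y) :
      IdealMem R m n (x + y)
  | smul {m n : ℕ} {x : (free S).carrier m n} (c : ℂ) (h : IdealMem R m n x) :
      IdealMem R m n (c • x)
  | act {m n : ℕ} {x : (free S).carrier m n} (g : BiPerm m n) (h : IdealMem R m n x) :
      IdealMem R m n ((free S).rho m n g x)
  | snd {m n : ℕ} (s : Shape m n) (q : ∀ y, (free S).carrier (s.l y) (s.k y))
      (p : ∀ x, (free S).carrier (s.j x) (s.i x)) (y : Fin s.b) (h : IdealMem R _ _ (q y)) :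
      IdealMem R m n (free.comp s q p)
  | fst {m n : ℕ} (s : Shape m n) (q : ∀ y, (free S).carrier (s.l y) (s.k y))
      (p : ∀ x, (free S).carrier (s.j x) (s.i x)) (x : Fin s.a) (h : IdealMem R _ _ (p x)) :
      IdealMem R m n (free.comp s q p)

/-- The ideal generated by `R`. -/
def ideal {S : Sig} (R : ∀ m n, Set ((free S).carrier m n)) (m n : ℕ) :
    Submodule ℂ ((free S).carrier m n) where
  carrier := {x | IdealMem R m n x}
  zero_mem' := .zero m n
  add_mem' := .add
  smul_mem' c _ h := .smul c h

theorem ideal_rho {S : Sig} (R : ∀ m n, Set ((free S).carrier m n)) {m n : ℕ} (g : BiPerm m n)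
    {x : (free S).carrier m n} (h : x ∈ ideal R m n) : (free S).rho m n g x ∈ ideal R m n :=
  IdealMem.act g h

/-- The properad with generators `S` and relations `R`, that is, the quotient of the free properad
by the ideal generated by `R`. -/
noncomputable abbrev presented (S : Sig) (R : ∀ m n, Set ((free S).carrier m n)) : SBimodule :=
  (free S).quotient (ideal R) (fun _ _ g _ h => ideal_rho R g h)

/-- The subspace of weight `w` of the free properad, spanned by the graphs with `w` vertices. -/
noncomputable def freeWeight (S : Sig) (w m n : ℕ) : Submodule ℂ ((free S).carrier m n) :=
  Finsupp.supported ℂ ℂ {G | G.size = w}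

/-- The subspace of weight `w` of a presented properad. -/
noncomputable def presentedWeight (S : Sig) (R : ∀ m n, Set ((free S).carrier m n)) (w m n : ℕ) :
    Submodule ℂ ((presented S R).carrier m n) :=
  (freeWeight S w m n).map (ideal R m n).mkQ

theorem multilinear_congr {ι W : Type} [Finite ι] {M : ι → Type} [∀ i, AddCommGroup (M i)]
    [∀ i, Module ℂ (M i)] [AddCommGroup W] [Module ℂ W] (f : MultilinearMap ℂ M W)
    (I : ∀ i, Submodule ℂ (M i)) (J : Submodule ℂ W) (h : ∀ x i, x i ∈ I i → f x ∈ J)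
    (x y : ∀ i, M i) (hxy : ∀ i, x i - y i ∈ I i) : f x - f y ∈ J := by
  classical
  cases nonempty_fintype ι
  have key : ∀ T : Finset ι, f x - f (T.piecewise y x) ∈ J := by
    intro T
    induction T using Finset.induction_on with
    | empty => simp
    | insert i T hi ih =>
      rw [← sub_add_sub_cancel _ (f (T.piecewise y x))]
      refine J.add_mem ih ?_
      have hx : T.piecewise y x = Function.update (T.piecewise y x) i (x i) := by
        rw [← Finset.piecewise_eq_of_notMem T y x hi, Function.update_eq_self]
      rw [Finset.piecewise_insert]
      nth_rw 1 [hx]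
      rw [← f.map_update_sub]
      exact h _ i (by simpa using hxy i)
  simpa using key Finset.univ

/-- Evaluation of multilinear maps. -/
def multiEval {ι W : Type} {M : ι → Type} [∀ i, AddCommGroup (M i)] [∀ i, Module ℂ (M i)]
    [AddCommGroup W] [Module ℂ W] (x : ∀ i, M i) : MultilinearMap ℂ M W →ₗ[ℂ] W where
  toFun f := f x
  map_add' _ _ := rfl
  map_smul' _ _ := rfl

namespace presented
variable {S : Sig} {R : ∀ m n, Set ((free S).carrier m n)} {m n : ℕ}

/-- The projection of the free properad. -/
noncomputable def mk (x : (free S).carrier m n) : (presented S R).carrier m n :=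
  Submodule.Quotient.mk x

/-- The two-level composition of a presented properad, computed on representatives;
see `comp_mk`. -/
noncomputable def comp (s : Shape m n) (q : ∀ y, (presented S R).carrier (s.l y) (s.k y))
    (p : ∀ x, (presented S R).carrier (s.j x) (s.i x)) : (presented S R).carrier m n :=
  mk (free.comp s (fun y => Quotient.out (q y)) (fun x => Quotient.out (p x)))

theorem mk_comp_congr (s : Shape m n) {q q' : ∀ y, (free S).carrier (s.l y) (s.k y)}
    {p p' : ∀ x, (free S).carrier (s.j x) (s.i x)}
    (hq : ∀ y, (mk (q y) : (presented S R).carrier _ _) = mk (q' y))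
    (hp : ∀ x, (mk (p x) : (presented S R).carrier _ _) = mk (p' x)) :
    (mk (free.comp s q p) : (presented S R).carrier m n) = mk (free.comp s q' p') := by
  have h1 : (mk (free.comp s q p) : (presented S R).carrier m n) = mk (free.comp s q p') :=
    (Submodule.Quotient.eq _).2 (multilinear_congr (free.comp s q) (fun x => ideal R _ _)
      (ideal R m n) (fun p x h => .fst s q p x h) p p'
      (fun x => (Submodule.Quotient.eq _).1 (hp x)))
  have h2 : (mk (free.comp s q p') : (presented S R).carrier m n) = mk (free.comp s q' p') := by
    refine (Submodule.Quotient.eq _).2 ?_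
    have := multilinear_congr (free.comp (S := S) s) (fun y => ideal R _ _)
      ((ideal R m n).comap (multiEval p'))
      (fun q y h => .snd s q p' y h) q q' (fun y => (Submodule.Quotient.eq _).1 (hq y))
    exact this
  exact h1.trans h2

theorem comp_mk (s : Shape m n) (q : ∀ y, (free S).carrier (s.l y) (s.k y))
    (p : ∀ x, (free S).carrier (s.j x) (s.i x)) :
    (comp s (fun y => mk (q y)) (fun x => mk (p x)) : (presented S R).carrier m n) =
      mk (free.comp s q p) :=
  mk_comp_congr s (fun y => Quotient.out_eq (mk (q y) : (presented S R).carrier _ _))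
    (fun x => Quotient.out_eq (mk (p x) : (presented S R).carrier _ _))

theorem exists_rep {ι : Type} {l k : ι → ℕ} (q : ∀ y, (presented S R).carrier (l y) (k y)) :
    ∃ Q : ∀ y, (free S).carrier (l y) (k y), q = fun y => mk (Q y) :=
  ⟨fun y => Quotient.out (q y), funext fun y => (Quotient.out_eq (q y)).symm⟩

end presented

namespace presented
variable {S : Sig} {R : ∀ m n, Set ((free S).carrier m n)} {m n : ℕ}

theorem rho_mk (g : BiPerm m n) (x : (free S).carrier m n) :
    (presented S R).rho m n g (mk x) = mk ((free S).rho m n g x) := rfl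

theorem update_mk {ι : Type} [DecidableEq ι] {l k : ι → ℕ} (Q : ∀ y, (free S).carrier (l y) (k y))
    (y : ι) (u : (free S).carrier (l y) (k y)) :
    Function.update (fun y => (mk (Q y) : (presented S R).carrier (l y) (k y))) y (mk u) =
      fun z => mk (Function.update Q y u z) := by
  ext z
  exact (Function.apply_update (fun i => (mk : _ → (presented S R).carrier (l i) (k i))) Q y u z).symm

/-- The composition of a presented properad, on the vector space with basis the symbols. -/
noncomputable def compLin (S : Sig) (R : ∀ m n, Set ((free S).carrier m n)) (m n : ℕ) :
    (SBimodule.BoxGen (presented S R) (presented S R) m n →₀ ℂ) →ₗ[ℂ] (presented S R).carrier m n :=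
  Finsupp.linearCombination ℂ fun t => comp t.shape t.snd t.fst

theorem compLin_vec (s : Shape m n) (q : ∀ y, (presented S R).carrier (s.l y) (s.k y))
    (p : ∀ x, (presented S R).carrier (s.j x) (s.i x)) :
    compLin S R m n (SBimodule.BoxGen.vec s q p) = comp s q p := by
  simp [compLin]

theorem comp_add_snd (s : Shape m n) (q : ∀ y, (presented S R).carrier (s.l y) (s.k y))
    (p : ∀ x, (presented S R).carrier (s.j x) (s.i x)) (y : Fin s.b)
    (u v : (presented S R).carrier (s.l y) (s.k y)) :
    comp s (Function.update q y (u + v)) p =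
      comp s (Function.update q y u) p + comp s (Function.update q y v) p := by
  obtain ⟨q, rfl⟩ := exists_rep q
  obtain ⟨p, rfl⟩ := exists_rep p
  obtain ⟨u, rfl⟩ := Submodule.Quotient.mk_surjective _ u
  obtain ⟨v, rfl⟩ := Submodule.Quotient.mk_surjective _ v
  change comp s (Function.update _ y (mk (u + v))) _ = comp s (Function.update _ y (mk u)) _ +
    comp s (Function.update _ y (mk v)) _
  rw [update_mk, update_mk, update_mk, comp_mk s, comp_mk s, comp_mk s,
    MultilinearMap.map_update_add]
  rfl

theorem comp_smul_snd (s : Shape m n) (q : ∀ y, (presented S R).carrier (s.l y) (s.k y))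
    (p : ∀ x, (presented S R).carrier (s.j x) (s.i x)) (y : Fin s.b)
    (u : (presented S R).carrier (s.l y) (s.k y)) (c : ℂ) :
    comp s (Function.update q y (c • u)) p = c • comp s (Function.update q y u) p := by
  obtain ⟨q, rfl⟩ := exists_rep q
  obtain ⟨p, rfl⟩ := exists_rep p
  obtain ⟨u, rfl⟩ := Submodule.Quotient.mk_surjective _ u
  change comp s (Function.update _ y (mk (c • u))) _ = c • comp s (Function.update _ y (mk u)) _
  rw [update_mk, update_mk, comp_mk s, comp_mk s, MultilinearMap.map_update_smul]
  rfl

theorem comp_add_fst (s : Shape m n) (q : ∀ y, (presented S R).carrier (s.l y) (s.k y))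
    (p : ∀ x, (presented S R).carrier (s.j x) (s.i x)) (x : Fin s.a)
    (u v : (presented S R).carrier (s.j x) (s.i x)) :
    comp s q (Function.update p x (u + v)) =
      comp s q (Function.update p x u) + comp s q (Function.update p x v) := by
  obtain ⟨q, rfl⟩ := exists_rep q
  obtain ⟨p, rfl⟩ := exists_rep p
  obtain ⟨u, rfl⟩ := Submodule.Quotient.mk_surjective _ u
  obtain ⟨v, rfl⟩ := Submodule.Quotient.mk_surjective _ v
  change comp s _ (Function.update _ x (mk (u + v))) = comp s _ (Function.update _ x (mk u)) +
    comp s _ (Function.update _ x (mk v))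
  rw [update_mk, update_mk, update_mk, comp_mk s, comp_mk s, comp_mk s,
    MultilinearMap.map_update_add]
  rfl

theorem comp_smul_fst (s : Shape m n) (q : ∀ y, (presented S R).carrier (s.l y) (s.k y))
    (p : ∀ x, (presented S R).carrier (s.j x) (s.i x)) (x : Fin s.a)
    (u : (presented S R).carrier (s.j x) (s.i x)) (c : ℂ) :
    comp s q (Function.update p x (c • u)) = c • comp s q (Function.update p x u) := by
  obtain ⟨q, rfl⟩ := exists_rep q
  obtain ⟨p, rfl⟩ := exists_rep p
  obtain ⟨u, rfl⟩ := Submodule.Quotient.mk_surjective _ u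
  change comp s _ (Function.update _ x (mk (c • u))) = c • comp s _ (Function.update _ x (mk u))
  rw [update_mk, update_mk, comp_mk s, comp_mk s, MultilinearMap.map_update_smul]
  rfl

theorem comp_act_snd (s : Shape m n) (q : ∀ y, (presented S R).carrier (s.l y) (s.k y))
    (p : ∀ x, (presented S R).carrier (s.j x) (s.i x)) (g : ∀ y, BiPerm (s.l y) (s.k y)) :
    comp s (fun y => (presented S R).rho _ _ (g y) (q y)) p = comp (s.absorbSnd g) q p := by
  obtain ⟨q, rfl⟩ := exists_rep q
  obtain ⟨p, rfl⟩ := exists_rep p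
  exact (comp_mk s (fun y => (free S).rho _ _ (g y) (q y)) p).trans
    ((congrArg mk (free.comp_absorbSnd s g q p)).trans (comp_mk (s.absorbSnd g) q p).symm)

theorem comp_act_fst (s : Shape m n) (q : ∀ y, (presented S R).carrier (s.l y) (s.k y))
    (p : ∀ x, (presented S R).carrier (s.j x) (s.i x)) (g : ∀ x, BiPerm (s.j x) (s.i x)) :
    comp s q (fun x => (presented S R).rho _ _ (g x) (p x)) = comp (s.absorbFst g) q p := by
  obtain ⟨q, rfl⟩ := exists_rep q
  obtain ⟨p, rfl⟩ := exists_rep p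
  exact (comp_mk s q (fun x => (free S).rho _ _ (g x) (p x))).trans
    ((congrArg mk (free.comp_absorbFst s g q p)).trans (comp_mk (s.absorbFst g) q p).symm)

theorem comp_block (s : Shape m n) (q : ∀ y, (presented S R).carrier (s.l y) (s.k y))
    (p : ∀ x, (presented S R).carrier (s.j x) (s.i x)) (ρ : Equiv.Perm (Fin s.b))
    (τ : Equiv.Perm (Fin s.a)) :
    comp (s.block ρ τ) (fun y => q (ρ y)) (fun x => p (τ x)) = comp s q p := by
  obtain ⟨q, rfl⟩ := exists_rep q
  obtain ⟨p, rfl⟩ := exists_rep p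
  exact (comp_mk (s.block ρ τ) (fun y => q (ρ y)) (fun x => p (τ x))).trans
    ((congrArg mk (free.comp_block s ρ τ q p)).trans (comp_mk s q p).symm)

theorem compLin_rel {x : SBimodule.BoxGen (presented S R) (presented S R) m n →₀ ℂ}
    (h : SBimodule.BoxRel _ _ x) : compLin S R m n x = 0 := by
  have key : ∀ {t t' : SBimodule.BoxGen (presented S R) (presented S R) m n →₀ ℂ},
      compLin S R m n t = compLin S R m n t' → compLin S R m n (t - t') = 0 := fun h => by
    rw [map_sub, h, sub_self]
  have vec := @compLin_vec S R m n
  rcases h with ⟨s, q, p, y, u, v⟩ | ⟨s, q, p, y, u, c⟩ | ⟨s, q, p, y, u, v⟩ | ⟨s, q, p, y, u, c⟩ |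
    ⟨s, q, p, g⟩ | ⟨s, q, p, g⟩ | ⟨s, q, p, ρ, τ⟩ <;> apply key
  · rw [map_add]
    exact (vec _ _ _).trans ((comp_add_snd s q p y u v).trans
      (congrArg₂ (· + ·) (vec _ _ _).symm (vec _ _ _).symm))
  · rw [map_smul]
    exact (vec _ _ _).trans ((comp_smul_snd s q p y u c).trans
      (congrArg (c • ·) (vec _ _ _).symm))
  · rw [map_add]
    exact (vec _ _ _).trans ((comp_add_fst s q p y u v).trans
      (congrArg₂ (· + ·) (vec _ _ _).symm (vec _ _ _).symm))
  · rw [map_smul]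
    exact (vec _ _ _).trans ((comp_smul_fst s q p y u c).trans
      (congrArg (c • ·) (vec _ _ _).symm))
  · exact (vec _ _ _).trans ((comp_act_snd s q p g).trans (vec _ _ _).symm)
  · exact (vec _ _ _).trans ((comp_act_fst s q p g).trans (vec _ _ _).symm)
  · exact (vec _ _ _).trans ((comp_block s q p ρ τ).trans (vec _ _ _).symm)

/-- The composition `P ⊠ P → P` of a presented properad `P`. -/
noncomputable def mul (S : Sig) (R : ∀ m n, Set ((free S).carrier m n)) :
    SBimodule.Hom ((presented S R).box (presented S R)) (presented S R) where
  toLin m n := Submodule.liftQ _ (compLin S R m n) (Submodule.span_le.2 fun _ h => compLin_rel h)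
  equivariant m n g x := by
    obtain ⟨x, rfl⟩ := Submodule.Quotient.mk_surjective _ x
    change compLin S R m n (permRep _ _ g x) = (presented S R).rho m n g (compLin S R m n x)
    induction x using Finsupp.induction_linear with
    | zero => simp only [map_zero]
    | add x y hx hy => simp only [map_add, hx, hy]
    | single t c =>
      obtain ⟨s, q, p⟩ := t
      obtain ⟨q, rfl⟩ := exists_rep q
      obtain ⟨p, rfl⟩ := exists_rep p
      simp only [permRep_single, compLin, Finsupp.linearCombination_single, map_smul]
      congr 1
      exact (comp_mk (s.outer g) q p).trans ((congrArg mk (free.comp_outer s g q p)).trans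
        (congrArg ((presented S R).rho m n g) (comp_mk s q p).symm))

end presented

/-! ### Functoriality -/

namespace SBimodule
variable {Q P Q' P' : SBimodule}

/-- The map induced on symbols. -/
def BoxGen.map (f : Hom Q Q') (g : Hom P P') {m n : ℕ} (t : BoxGen Q P m n) : BoxGen Q' P' m n :=
  ⟨t.shape, fun y => f.toLin _ _ (t.snd y), fun x => g.toLin _ _ (t.fst x)⟩

theorem BoxGen.lmapDomain_permRep (f : Hom Q Q') (g : Hom P P') {m n : ℕ} (σ : BiPerm m n)
    (t : BoxGen Q P m n) (c : ℂ) :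
    Finsupp.lmapDomain ℂ ℂ (BoxGen.map f g) (permRep _ _ σ (Finsupp.single t c)) =
      permRep _ _ σ (Finsupp.lmapDomain ℂ ℂ (BoxGen.map f g) (Finsupp.single t c)) := by
  rw [permRep_single, Finsupp.lmapDomain_apply, Finsupp.lmapDomain_apply, Finsupp.mapDomain_single,
    Finsupp.mapDomain_single, permRep_single]
  rfl

theorem BoxRel.map (f : Hom Q Q') (g : Hom P P') {m n : ℕ} {x : BoxGen Q P m n →₀ ℂ}
    (h : BoxRel Q P x) : BoxRel Q' P' (Finsupp.lmapDomain ℂ ℂ (BoxGen.map f g) x) := by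
  rcases h with ⟨s, q, p, y, u, v⟩ | ⟨s, q, p, y, u, c⟩ | ⟨s, q, p, y, u, v⟩ | ⟨s, q, p, y, u, c⟩ |
    ⟨s, q, p, g'⟩ | ⟨s, q, p, g'⟩ | ⟨s, q, p, ρ, τ⟩ <;>
    simp only [map_add, map_sub, map_smul, BoxGen.vec, Finsupp.lmapDomain_apply,
      Finsupp.mapDomain_single, BoxGen.map, Function.apply_update (fun y => (f.toLin (s.l y) (s.k y))),
      Function.apply_update (fun x => (g.toLin (s.j x) (s.i x))), Hom.equivariant]
  · exact .add_snd s _ _ y _ _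
  · exact .smul_snd s _ _ y _ c
  · exact .add_fst s _ _ y _ _
  · exact .smul_fst s _ _ y _ c
  · exact .act_snd s _ _ g'
  · exact .act_fst s _ _ g'
  · exact .block s (fun y => f.toLin _ _ (q y)) (fun x => g.toLin _ _ (p x)) ρ τ

/-- The morphism `f ⊠ g`. -/
noncomputable def box.map (f : Hom Q Q') (g : Hom P P') : Hom (Q.box P) (Q'.box P') where
  toLin m n := Submodule.mapQ _ _ (Finsupp.lmapDomain ℂ ℂ (BoxGen.map f g))
    (Submodule.span_le.2 fun _ h => Submodule.subset_span (BoxRel.map f g h))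
  equivariant m n σ x := by
    obtain ⟨x, rfl⟩ := Submodule.Quotient.mk_surjective _ x
    refine congrArg Submodule.Quotient.mk ?_
    change Finsupp.lmapDomain ℂ ℂ (BoxGen.map f g) (permRep _ _ σ x) =
      permRep _ _ σ (Finsupp.lmapDomain ℂ ℂ (BoxGen.map f g) x)
    induction x using Finsupp.induction_linear with
    | zero => simp only [map_zero]
    | add x y hx hy => simp only [map_add, hx, hy]
    | single t c => exact BoxGen.lmapDomain_permRep f g σ t c

/-- Composition of morphisms. -/
def Hom.comp {M N L : SBimodule} (g : Hom N L) (f : Hom M N) : Hom M L where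
  toLin m n := (g.toLin m n).comp (f.toLin m n)
  equivariant m n σ x := by
    change g.toLin m n (f.toLin m n (M.rho m n σ x)) = _
    rw [f.equivariant, g.equivariant]
    rfl

end SBimodule

namespace free
variable {S : Sig} {T : Type} (f : T → S.Op) {m n : ℕ}

/-- The inclusion of the free properad on part of the operations. -/
noncomputable def incl (m n : ℕ) :
    (Monomial (S.restrict f) m n →₀ ℂ) →ₗ[ℂ] (Monomial S m n →₀ ℂ) :=
  Finsupp.lmapDomain ℂ ℂ (Monomial.relabel f)

theorem incl_single (G : Monomial (S.restrict f) m n) (c : ℂ) :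
    incl f m n (Finsupp.single G c) = Finsupp.single (Monomial.relabel f G) c := by
  simp [incl]

theorem incl_rho (g : BiPerm m n) (x : (free (S.restrict f)).carrier m n) :
    incl f m n ((free (S.restrict f)).rho m n g x) = (free S).rho m n g (incl f m n x) := by
  induction x using Finsupp.induction_linear with
  | zero => simp only [map_zero]
  | add x y hx hy => simp only [map_add, hx, hy]
  | single t c => rw [permRep_single, incl_single, incl_single, permRep_single,
      Monomial.relabel_smul]

theorem incl_comp (s : Shape m n) (q : ∀ y, (free (S.restrict f)).carrier (s.l y) (s.k y))
    (p : ∀ x, (free (S.restrict f)).carrier (s.j x) (s.i x)) :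
    incl f m n (comp s q p) = comp s (fun y => incl f _ _ (q y)) (fun x => incl f _ _ (p x)) := by
  have : (LinearMap.compMultilinearMapₗ ℂ (incl f m n)).compMultilinearMap (comp s) =
      (MultilinearMap.compLinearMapₗ (fun x => incl f (s.j x) (s.i x))).compMultilinearMap
        ((comp s).compLinearMap fun y => incl f (s.l y) (s.k y)) := by
    refine multilinear_ext₂ fun G H => ?_
    have h1 : incl f m n (comp s (fun y => Finsupp.single (G y) 1)
        (fun x => Finsupp.single (H x) 1)) =
        comp s (fun y => incl f _ _ (Finsupp.single (G y) 1))
          (fun x => incl f _ _ (Finsupp.single (H x) 1)) := by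
      simp only [incl_single]
      rw [comp_single s, comp_single s, incl_single, Monomial.relabel_comp]
    exact h1
  exact congrArg (fun F => F q p) this

theorem incl_ideal {R : ∀ m n, Set ((free (S.restrict f)).carrier m n)}
    {R' : ∀ m n, Set ((free S).carrier m n)} (h : ∀ m n, Set.MapsTo (incl f m n) (R m n) (R' m n))
    {x : (free (S.restrict f)).carrier m n} (hx : IdealMem R m n x) :
    IdealMem R' m n (incl f m n x) := by
  induction hx with
  | of hx => exact .of (h _ _ hx)
  | zero => rw [map_zero]; exact .zero _ _
  | add _ _ ih ih' => rw [map_add]; exact .add ih ih'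
  | smul c _ ih => rw [map_smul]; exact .smul c ih
  | act g _ ih => rw [incl_rho]; exact .act g ih
  | snd s q p y _ ih => rw [incl_comp]; exact .snd s _ _ y ih
  | fst s q p y _ ih => rw [incl_comp]; exact .fst s _ _ y ih

end free

/-- The morphism between presented properads induced by the inclusion of the generators. -/
noncomputable def presented.incl {S : Sig} {T : Type} (f : T → S.Op)
    {R : ∀ m n, Set ((free (S.restrict f)).carrier m n)} {R' : ∀ m n, Set ((free S).carrier m n)}
    (h : ∀ m n, Set.MapsTo (free.incl f m n) (R m n) (R' m n)) :
    SBimodule.Hom (presented (S.restrict f) R) (presented S R') where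
  toLin m n := Submodule.mapQ _ _ (free.incl f m n) (fun _ hx => free.incl_ideal f h hx)
  equivariant m n g x := by
    obtain ⟨x, rfl⟩ := Submodule.Quotient.mk_surjective _ x
    exact congrArg Submodule.Quotient.mk (free.incl_rho f g x)

/-! ### The properads `P_a` -/

/-- A graph given by names for its wires: `ins` and `outs` list the names of the inputs and of the
outputs of the graph, and `vin v` and `vout v` those of the inputs and of the outputs of the
vertex `v`. -/
noncomputable def Wiring.ofNames {S : Sig} {m n k N : ℕ} (label : Fin k → S.Op)
    (ins : Fin n → Fin N) (vin : ∀ v, Fin (S.inp (label v)) → Fin N)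
    (vout : ∀ v, Fin (S.out (label v)) → Fin N) (outs : Fin m → Fin N)
    (starts : Function.Bijective
      (Sum.elim ins (fun x : Σ v, Fin (S.out (label v)) => vout x.1 x.2)))
    (ends : Function.Bijective
      (Sum.elim outs (fun x : Σ v, Fin (S.inp (label v)) => vin x.1 x.2))) :
    Wiring S (Fin k) (Fin n) (Fin m) where
  label := label
  wire := (Equiv.ofBijective _ starts).trans (Equiv.ofBijective _ ends).symm

theorem Wiring.ofNames_wire {S : Sig} {m n k N : ℕ} {label : Fin k → S.Op}
    {ins : Fin n → Fin N} {vin : ∀ v, Fin (S.inp (label v)) → Fin N}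
    {vout : ∀ v, Fin (S.out (label v)) → Fin N} {outs : Fin m → Fin N} {starts ends}
    (s : Fin n ⊕ Σ v, Fin (S.out (label v))) (t : Fin m ⊕ Σ v, Fin (S.inp (label v))) :
    (Wiring.ofNames label ins vin vout outs starts ends).wire s = t ↔
      Sum.elim ins (fun x : Σ v, Fin (S.out (label v)) => vout x.1 x.2) s =
        Sum.elim outs (fun x : Σ v, Fin (S.inp (label v)) => vin x.1 x.2) t :=
  Equiv.symm_apply_eq (Equiv.ofBijective _ ends) (x := Equiv.ofBijective _ starts s) (y := t)

/-- A monomial of weight two: the two vertices are linked, every wire is attached to one of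
them, and the internal wires go from the vertex `0` to the vertex `1`. -/
noncomputable def twoVertex {S : Sig} {m n : ℕ} (N : ℕ) (label : Fin 2 → S.Op)
    (ins : Fin n → Fin N) (vin : ∀ v, Fin (S.inp (label v)) → Fin N)
    (vout : ∀ v, Fin (S.out (label v)) → Fin N) (outs : Fin m → Fin N)
    (starts : Function.Bijective
      (Sum.elim ins (fun x : Σ v, Fin (S.out (label v)) => vout x.1 x.2)))
    (ends : Function.Bijective
      (Sum.elim outs (fun x : Σ v, Fin (S.inp (label v)) => vin x.1 x.2)))
    (touch : ∀ x, ∃ v, (∃ p, vin v p = x) ∨ ∃ p, vout v p = x)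
    (link : ∃ p q, vout 0 p = vin 1 q)
    (order : ∀ v p w q, vout v p = vin w q → v < w) : Monomial S m n :=
  Monomial.mk
    { size := 2
      graph := .ofNames label ins vin vout outs starts ends
      connected := by
        refine ⟨⟨.inl 0⟩, ?_⟩
        let G := Wiring.ofNames label ins vin vout outs starts ends
        have hw : ∀ s v p, Sum.elim ins (fun x : Σ v, Fin (S.out (label v)) => vout x.1 x.2) s =
            vin v p → G.wire s = .inr ⟨v, p⟩ := fun s v p h =>
          (Wiring.ofNames_wire s (.inr ⟨v, p⟩)).2 h
        have h01 : Relation.EqvGen G.Adj (.inl 0) (.inl 1) := by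
          obtain ⟨p, q, h⟩ := link
          exact .trans _ (.inr (.inr ⟨0, p⟩)) _ (.rel _ _ (.leave (G := G) 0 p))
            (.rel _ _ (.enter (G := G) (.inr ⟨0, p⟩) 1 q (hw (.inr ⟨0, p⟩) 1 q h)))
        have h0 : ∀ v : Fin 2, Relation.EqvGen G.Adj (.inl v) (.inl 0) := fun v => by
          fin_cases v
          · exact .refl _
          · exact .symm _ _ h01
        have key : ∀ x, Relation.EqvGen G.Adj x (.inl 0) := by
          rintro (v | s)
          · exact h0 v
          · obtain ⟨v, ⟨p, h⟩ | ⟨p, h⟩⟩ := touch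
              (Sum.elim ins (fun x : Σ v, Fin (S.out (label v)) => vout x.1 x.2) s)
            · exact .trans _ _ _ (.rel _ _ (.enter (G := G) s v p (hw s v p h.symm)))
                (h0 v)
            · obtain rfl : s = .inr ⟨v, p⟩ := starts.1 h.symm
              exact .trans _ (.inl v) _ (.symm _ _ (.rel _ _ (.leave (G := G) v p))) (h0 v)
        exact fun x y => .trans _ _ _ (key x) (.symm _ _ (key y))
      acyclic := ⟨fun v => v, fun v p w q h => order v p w q ((Wiring.ofNames_wire (.inr ⟨v, p⟩) (.inr ⟨w, q⟩)).1 h)⟩ }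

/-- The generating operations: a product and a coproduct. -/
inductive BialgOp
  | mul
  | comul

/-- The signature with a product of biarity `(1, 2)` and a coproduct of biarity `(2, 1)`. It
stands for the `𝕊`-bimodule `E`. -/
abbrev bialgSig : Sig where
  Op := BialgOp
  out | .mul => 1 | .comul => 2
  inp | .mul => 2 | .comul => 1

/-- The product alone. -/
abbrev mulSig : Sig := bialgSig.restrict fun _ : Unit => BialgOp.mul

/-- The coproduct alone. -/
abbrev comulSig : Sig := bialgSig.restrict fun _ : Unit => BialgOp.comul

/-- `(x₀ x₁) x₂`. -/
noncomputable def leftComb : Monomial mulSig 1 3 :=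
  twoVertex 5 ![(), ()] (ins := ![0, 1, 2])
    (vin := fun | 0 => ![0, 1] | 1 => ![3, 2]) (vout := fun | 0 => ![3] | 1 => ![4])
    (outs := ![4]) (by decide) (by decide) (by decide) (by decide) (by decide)

/-- `x₀ (x₁ x₂)`. -/
noncomputable def rightComb : Monomial mulSig 1 3 :=
  twoVertex 5 ![(), ()] (ins := ![0, 1, 2])
    (vin := fun | 0 => ![1, 2] | 1 => ![0, 3]) (vout := fun | 0 => ![3] | 1 => ![4])
    (outs := ![4]) (by decide) (by decide) (by decide) (by decide) (by decide)

/-- `(Δ ⊗ id) Δ`. -/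
noncomputable def leftCocomb : Monomial comulSig 3 1 :=
  twoVertex 5 ![(), ()] (ins := ![0])
    (vin := fun | 0 => ![0] | 1 => ![1]) (vout := fun | 0 => ![1, 2] | 1 => ![3, 4])
    (outs := ![3, 4, 2]) (by decide) (by decide) (by decide) (by decide) (by decide)

/-- `(id ⊗ Δ) Δ`. -/
noncomputable def rightCocomb : Monomial comulSig 3 1 :=
  twoVertex 5 ![(), ()] (ins := ![0])
    (vin := fun | 0 => ![0] | 1 => ![2]) (vout := fun | 0 => ![1, 2] | 1 => ![3, 4])
    (outs := ![1, 3, 4]) (by decide) (by decide) (by decide) (by decide) (by decide)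

/-- `Δ(x₀ x₁)`. -/
noncomputable def comulMul : Monomial bialgSig 2 2 :=
  twoVertex 5 ![.mul, .comul] (ins := ![0, 1])
    (vin := fun | 0 => ![0, 1] | 1 => ![2]) (vout := fun | 0 => ![2] | 1 => ![3, 4])
    (outs := ![3, 4]) (by decide) (by decide) (by decide) (by decide) (by decide)

/-- The four composites of a coproduct followed by a product. In Sweedler's notation, they send
`x ⊗ y` to `x₍₁₎ ⊗ x₍₂₎ y`, `x y₍₁₎ ⊗ y₍₂₎`, `x₍₁₎ y ⊗ x₍₂₎` and `y₍₁₎ ⊗ x y₍₂₎`. -/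
noncomputable def mulComul : Fin 4 → Monomial bialgSig 2 2
  | 0 => twoVertex 5 ![.comul, .mul] (ins := ![0, 1])
      (vin := fun | 0 => ![0] | 1 => ![3, 1]) (vout := fun | 0 => ![2, 3] | 1 => ![4])
      (outs := ![2, 4]) (by decide) (by decide) (by decide) (by decide) (by decide)
  | 1 => twoVertex 5 ![.comul, .mul] (ins := ![0, 1])
      (vin := fun | 0 => ![1] | 1 => ![0, 2]) (vout := fun | 0 => ![2, 3] | 1 => ![4])
      (outs := ![4, 3]) (by decide) (by decide) (by decide) (by decide) (by decide)
  | 2 => twoVertex 5 ![.comul, .mul] (ins := ![0, 1])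
      (vin := fun | 0 => ![0] | 1 => ![2, 1]) (vout := fun | 0 => ![2, 3] | 1 => ![4])
      (outs := ![4, 3]) (by decide) (by decide) (by decide) (by decide) (by decide)
  | 3 => twoVertex 5 ![.comul, .mul] (ins := ![0, 1])
      (vin := fun | 0 => ![1] | 1 => ![0, 3]) (vout := fun | 0 => ![2, 3] | 1 => ![4])
      (outs := ![2, 4]) (by decide) (by decide) (by decide) (by decide) (by decide)

/-- The relation of associative algebras. -/
inductive AssocRel : ∀ m n, (free mulSig).carrier m n → Prop
  | mk : AssocRel 1 3 (Finsupp.single leftComb 1 - Finsupp.single rightComb 1)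

/-- The relation of coassociative coalgebras. -/
inductive CoassocRel : ∀ m n, (free comulSig).carrier m n → Prop
  | mk : CoassocRel 3 1 (Finsupp.single leftCocomb 1 - Finsupp.single rightCocomb 1)

/-- The right-hand side `a₁ x₍₁₎ ⊗ x₍₂₎ y + a₂ x y₍₁₎ ⊗ y₍₂₎ + a₃ x₍₁₎ y ⊗ x₍₂₎ + a₄ y₍₁₎ ⊗ x y₍₂₎`,
where `aᵢ` is `a (i - 1)`. -/
noncomputable def comulMulRhs (a : Fin 4 → ℂ) : (free bialgSig).carrier 2 2 :=
  ∑ i, a i • Finsupp.single (mulComul i) 1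

/-- The relations of `P_a`: associativity, coassociativity, and the relation between the product
and the coproduct. -/
inductive BialgRel (a : Fin 4 → ℂ) : ∀ m n, (free bialgSig).carrier m n → Prop
  | assoc {m n : ℕ} {x : (free mulSig).carrier m n} (h : AssocRel m n x) :
      BialgRel a m n (free.incl (S := bialgSig) (fun _ : Unit => BialgOp.mul) m n x)
  | coassoc {m n : ℕ} {x : (free comulSig).carrier m n} (h : CoassocRel m n x) :
      BialgRel a m n (free.incl (S := bialgSig) (fun _ : Unit => BialgOp.comul) m n x)
  | comulMul : BialgRel a 2 2 (Finsupp.single comulMul 1 - comulMulRhs a)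

/-- The properad `A` of associative algebras. -/
noncomputable abbrev assocProperad : SBimodule := presented mulSig fun m n => {x | AssocRel m n x}

/-- The properad `C` of coassociative coalgebras. -/
noncomputable abbrev coassocProperad : SBimodule :=
  presented comulSig fun m n => {x | CoassocRel m n x}

/-- The properad `P_a`. -/
noncomputable abbrev bialgProperad (a : Fin 4 → ℂ) : SBimodule :=
  presented bialgSig fun m n => {x | BialgRel a m n x}

/-- The morphism `φ_a : A ⊠ C → P_a`: the elements of `A` and of `C` are sent to `P_a`, and
composed there. -/
noncomputable def phi (a : Fin 4 → ℂ) :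
    SBimodule.Hom (assocProperad.box coassocProperad) (bialgProperad a) :=
  (presented.mul bialgSig fun m n => {x | BialgRel a m n x}).comp
    (SBimodule.box.map
      (presented.incl (S := bialgSig) (fun _ : Unit => BialgOp.mul) fun _ _ _ h => .assoc h)
      (presented.incl (S := bialgSig) (fun _ : Unit => BialgOp.comul) fun _ _ _ h => .coassoc h))

/-- The morphism `φ_a` is an isomorphism of `𝕊`-bimodules in weight `w`: being equivariant, it
suffices that it maps the weight `w` part of `A ⊠ C` bijectively onto that of `P_a`, in every
biarity. -/
def PhiIsIsoInWeight (a : Fin 4 → ℂ) (w : ℕ) : Prop :=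
  ∀ m n, Set.BijOn ((phi a).toLin m n)
    (SBimodule.boxWeight assocProperad coassocProperad (presentedWeight mulSig _)
      (presentedWeight comulSig _) w m n)
    (presentedWeight bialgSig (fun m n => {x | BialgRel a m n x}) w m n)

/-! ### Rewriting -/

/-- Any two elements obtained from the same element by finite sequences of rewriting steps can
be rewritten, by finite sequences of steps, to a common element. -/
def IsConfluent {X : Type} (r : X → X → Prop) : Prop :=
  ∀ x y z, Relation.ReflTransGen r x y → Relation.ReflTransGen r x z →
    ∃ t, Relation.ReflTransGen r y t ∧ Relation.ReflTransGen r z t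

/-- The rewriting rules in weight two. -/
inductive Rule (a : Fin 4 → ℂ) : ∀ m n, Monomial bialgSig m n → (free bialgSig).carrier m n → Prop
  | assoc : Rule a 1 3 (leftComb.relabel (S := bialgSig) fun _ : Unit => BialgOp.mul)
      (Finsupp.single (rightComb.relabel (S := bialgSig) fun _ : Unit => BialgOp.mul) 1)
  | coassoc : Rule a 3 1 (leftCocomb.relabel (S := bialgSig) fun _ : Unit => BialgOp.comul)
      (Finsupp.single (rightCocomb.relabel (S := bialgSig) fun _ : Unit => BialgOp.comul) 1)
  | comulMul : Rule a 2 2 comulMul (comulMulRhs a)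

open Function in
/-- The induced rules: inside a two-level composition of monomials, one entry is replaced
according to a rule. In weight three, this describes all the replacements inside a monomial of a
subgraph with two vertices, because the remaining vertex is then above or below this subgraph. -/
inductive InducedRule (a : Fin 4 → ℂ) :
    ∀ m n, Monomial bialgSig m n → (free bialgSig).carrier m n → Prop
  | snd {m n : ℕ} (s : Shape m n) (G : ∀ y, Monomial bialgSig (s.l y) (s.k y))
      (H : ∀ x, Monomial bialgSig (s.j x) (s.i x)) (y : Fin s.b)
      (h : (free bialgSig).carrier (s.l y) (s.k y)) (hr : Rule a _ _ (G y) h) :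
      InducedRule a m n (Monomial.comp s G H)
        (free.comp s (update (fun z => Finsupp.single (G z) 1) y h)
          (fun x => Finsupp.single (H x) 1))
  | fst {m n : ℕ} (s : Shape m n) (G : ∀ y, Monomial bialgSig (s.l y) (s.k y))
      (H : ∀ x, Monomial bialgSig (s.j x) (s.i x)) (x : Fin s.a)
      (h : (free bialgSig).carrier (s.j x) (s.i x)) (hr : Rule a _ _ (H x) h) :
      InducedRule a m n (Monomial.comp s G H)
        (free.comp s (fun y => Finsupp.single (G y) 1)
          (update (fun z => Finsupp.single (H z) 1) x h))

/-- The rewriting steps: a monomial that occurs in `f` with a nonzero coefficient is replaced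
according to an induced rule. -/
inductive Step (a : Fin 4 → ℂ) {m n : ℕ} :
    (free bialgSig).carrier m n → (free bialgSig).carrier m n → Prop
  | mk (f : (free bialgSig).carrier m n) (G : Monomial bialgSig m n)
      (h : (free bialgSig).carrier m n) (hr : InducedRule a m n G h) (hG : f G ≠ 0) :
      Step a f (f - f G • Finsupp.single G 1 + f G • h)

/-- `P_a` induces a confluent system: the rewriting system on the weight three part of the free
properad is confluent. -/
def InducesConfluentSystem (a : Fin 4 → ℂ) : Prop :=
  ∀ m n, IsConfluent fun f g : freeWeight bialgSig 3 m n => Step a f.1 g.1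

/-! The rewriting system terminates, so that confluence can be read off from normal forms. Interpret
the product as `(x, y) ↦ 2x + y + 2` and the coproduct as `x ↦ (2x + 1, x)` on natural numbers. Both
are strictly increasing, and every monomial on the right of a rule evaluates to less than the
left-hand side, also inside a larger graph (`Rule.eval_lt`, `Monomial.IsCtx.eval_lt`). Hence every
element of weight three rewrites to a combination of irreducible monomials
(`exists_steps_normalForms`), and confluence means that these monomials are linearly independent
modulo the span of the differences `G - h` of the induced rules (`inducesConfluentSystem_iff`). As
the relations are homogeneous of weight two, this span is the weight three part of the ideal
(`mem_rewriteSpan_iff`).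

Irreducibility does not depend on `a`. In weight three it means that no product feeds a coproduct,
no product feeds the left input of a product, and no left output of a coproduct feeds a coproduct.
Then all coproducts come before all products, the connected pieces of both levels are right combs,
and the monomial is a composite of one comb of coproducts for every input and one comb of products
for every output (`exists_eq_mono`, `CombShape.not_reducible_mono`). The same composites, formed in
`A ⊠ C`, span its weight three part (`boxWeight_le_span`), and `φ_a` sends each of them to the class
of the corresponding irreducible monomial (`CombShape.phi_toBox`). By termination, `φ_a` is
therefore always surjective in weight three. If the composites of combs are independent in `A ⊠ C`,
then injectivity of `φ_a` says that the irreducible monomials are independent modulo the ideal,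
which is confluence.

The independence in `A ⊠ C` is obtained from the coefficients `a = 0`. Since `A ⊠ C` does not
involve `a`, it can be tested after applying `φ_0`, so it suffices that the irreducible monomials
are independent modulo the relations of `P_0` (`eq_zero_of_mem_rewriteSpan_zero`). For this, the
product is interpreted as concatenation of nonempty lists of words, and the coproduct as the
relation that splits a single word into two nonempty ones. Associativity and coassociativity hold,
and a coproduct after a product is never satisfied, in accordance with `Δ(xy) = 0`. Every composite
of combs has a reading on words of pairwise distinct letters that no other composite of combs admits
(`CombShape.eq_of_sat_mono`). Satisfaction of this reading is a linear form that vanishes on the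
relations and extracts one coefficient of a normal form. -/

/-! ### Relational semantics of graphs -/

/-- An interpretation of the operations of `S` as relations on a set `X`. -/
abbrev Sig.Model (S : Sig) (X : Type) : Type :=
  ∀ o : S.Op, (Fin (S.inp o) → X) → (Fin (S.out o) → X) → Prop

namespace Wiring
variable {S : Sig} {X : Type}

/-- The relation between the values at the inputs and the values at the outputs of a graph: there
are values on the wires that satisfy the interpretation of every vertex. -/
def Sat (R : S.Model X) {V I O : Type} (G : Wiring S V I O) (x : I → X) (y : O → X) : Prop :=
  ∃ (ν : (Σ v, Fin (S.out (G.label v))) → X) (κ : (Σ v, Fin (S.inp (G.label v))) → X),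
    (∀ s, Sum.elim y κ (G.wire s) = Sum.elim x ν s) ∧
      ∀ v, R (G.label v) (fun q => κ ⟨v, q⟩) (fun p => ν ⟨v, p⟩)

theorem Iso.sat_of_sat (R : S.Model X) {V W I O : Type} {G : Wiring S V I O} {H : Wiring S W I O}
    (h : G.Iso H) {x : I → X} {y : O → X} (hs : H.Sat R x y) : G.Sat R x y := by
  obtain ⟨e, he, h⟩ := h
  obtain ⟨lab, wire⟩ := G
  obtain rfl : lab = fun v => H.label (e v) := funext he
  obtain ⟨ν, κ, h1, h2⟩ := hs
  refine ⟨fun z => ν ⟨e z.1, z.2⟩, fun z => κ ⟨e z.1, z.2⟩, fun s => ?_, fun v => h2 (e v)⟩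
  have h3 := h1 (Sum.map id (fun z => ⟨e z.1, z.2⟩) s)
  have h4 := h s
  simp only [Fin.cast_eq_self] at h4
  rw [h4] at h3
  rcases s with i | z
  · rcases hw : wire (.inl i) with o | u <;> simpa [hw] using h3
  · rcases hw : wire (.inr z) with o | u <;> simpa [hw] using h3

theorem Iso.sat_iff (R : S.Model X) {V W I O : Type} {G : Wiring S V I O} {H : Wiring S W I O}
    (h : G.Iso H) {x : I → X} {y : O → X} : G.Sat R x y ↔ H.Sat R x y :=
  ⟨h.symm.sat_of_sat R, h.sat_of_sat R⟩

theorem sat_bdry (R : S.Model X) {V I O I' O' : Type} (G : Wiring S V I O) (e : I' ≃ I)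
    (f : O ≃ O') {x : I' → X} {y : O' → X} :
    (G.bdry e f).Sat R x y ↔ G.Sat R (fun i => x (e.symm i)) (fun o => y (f o)) := by
  refine exists_congr fun ν => exists_congr fun κ => and_congr_left fun _ => ?_
  constructor
  · rintro h (i | z)
    · have := h (.inl (e.symm i))
      rcases hw : G.wire (.inl i) with o | u <;> simpa [hw] using this
    · have := h (.inr z)
      rcases hw : G.wire (.inr z) with o | u <;> simpa [hw] using this
  · rintro h (i | z)
    · have := h (.inl (e i))
      rcases hw : G.wire (.inl (e i)) with o | u <;> simpa [hw] using this
    · have := h (.inr z)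
      rcases hw : G.wire (.inr z) with o | u <;> simpa [hw] using this

theorem sat_par (R : S.Model X) {ι : Type} {V I O : ι → Type}
    (G : ∀ i, Wiring S (V i) (I i) (O i)) {x : (Σ i, I i) → X} {y : (Σ i, O i) → X} :
    (par G).Sat R x y ↔ ∀ i, (G i).Sat R (fun t => x ⟨i, t⟩) (fun t => y ⟨i, t⟩) := by
  constructor
  · rintro ⟨ν, κ, h1, h2⟩ i
    refine ⟨fun z => ν ⟨⟨i, z.1⟩, z.2⟩, fun z => κ ⟨⟨i, z.1⟩, z.2⟩, ?_, fun v => h2 ⟨i, v⟩⟩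
    rintro (t | z)
    · have := h1 (.inl ⟨i, t⟩)
      rcases hw : (G i).wire (.inl t) with o | u <;> simpa [hw] using this
    · have := h1 (.inr ⟨⟨i, z.1⟩, z.2⟩)
      rcases hw : (G i).wire (.inr z) with o | u <;> simpa [hw] using this
  · intro h
    choose ν κ h1 h2 using h
    refine ⟨fun z => ν z.1.1 ⟨z.1.2, z.2⟩, fun z => κ z.1.1 ⟨z.1.2, z.2⟩, ?_,
      fun v => h2 v.1 v.2⟩
    rintro (⟨i, t⟩ | ⟨⟨i, v⟩, p⟩)
    · have := h1 i (.inl t)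
      rcases hw : (G i).wire (.inl t) with o | u <;> simpa [hw] using this
    · have := h1 i (.inr ⟨v, p⟩)
      rcases hw : (G i).wire (.inr ⟨v, p⟩) with o | u <;> simpa [hw] using this

theorem sat_seq (R : S.Model X) {V W I M O : Type} (G : Wiring S V I M) (H : Wiring S W M O)
    {x : I → X} {z : O → X} :
    (G.seq H).Sat R x z ↔ ∃ y, G.Sat R x y ∧ H.Sat R y z := by
  constructor
  · rintro ⟨ν, κ, h1, h2⟩
    -- The composite has no data on the intermediate boundary: the value at `m` is read at the place
    -- of `G` where the wire ending at `m` starts.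
    refine ⟨fun m => Sum.elim x (fun u => ν ⟨.inl u.1, u.2⟩) (G.wire.symm (.inl m)),
      ⟨fun u => ν ⟨.inl u.1, u.2⟩, fun u => κ ⟨.inl u.1, u.2⟩, ?_, fun v => h2 (.inl v)⟩,
      ⟨fun u => ν ⟨.inr u.1, u.2⟩, fun u => κ ⟨.inr u.1, u.2⟩, ?_, fun v => h2 (.inr v)⟩⟩
    · rintro (t | u)
      · have := h1 (.inl t)
        rcases hw : G.wire (.inl t) with o | u
        · simp [(Equiv.symm_apply_eq _).2 hw.symm]
        · simpa [hw] using this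
      · have := h1 (.inr ⟨.inl u.1, u.2⟩)
        rcases hw : G.wire (.inr u) with o | u
        · simp [(Equiv.symm_apply_eq _).2 hw.symm]
        · simpa [hw] using this
    · rintro (m | u)
      · rcases hm : G.wire.symm (.inl m) with i | u
        · have hm' := (Equiv.symm_apply_eq _).1 hm
          have := h1 (.inl i)
          rcases hw : H.wire (.inl m) with o | u <;> simpa [← hm', hw, hm] using this
        · have hm' := (Equiv.symm_apply_eq _).1 hm
          have := h1 (.inr ⟨.inl u.1, u.2⟩)
          rcases hw : H.wire (.inl m) with o | u <;> simpa [← hm', hw, hm] using this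
      · have := h1 (.inr ⟨.inr u.1, u.2⟩)
        rcases hw : H.wire (.inr u) with o | u <;> simpa [hw] using this
  · rintro ⟨y, ⟨ν, κ, h1, h2⟩, ⟨ν', κ', h1', h2'⟩⟩
    refine ⟨fun u => match u with | ⟨.inl v, p⟩ => ν ⟨v, p⟩ | ⟨.inr v, p⟩ => ν' ⟨v, p⟩,
      fun u => match u with | ⟨.inl v, p⟩ => κ ⟨v, p⟩ | ⟨.inr v, p⟩ => κ' ⟨v, p⟩, ?_, ?_⟩
    · rintro (i | ⟨v | v, p⟩)
      · have := h1 (.inl i)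
        rcases hw : G.wire (.inl i) with m | u
        · have h := h1' (.inl m)
          rcases hm : H.wire (.inl m) with o | u <;>
            simp [hw, hm] at this h ⊢ <;> rw [← this, ← h]
        · simpa [hw] using this
      · have := h1 (.inr ⟨v, p⟩)
        rcases hw : G.wire (.inr ⟨v, p⟩) with m | u
        · have h := h1' (.inl m)
          rcases hm : H.wire (.inl m) with o | u <;>
            simp [hw, hm] at this h ⊢ <;> rw [← this, ← h]
        · simpa [hw] using this
      · have := h1' (.inr ⟨v, p⟩)
        rcases hw : H.wire (.inr ⟨v, p⟩) with o | u <;> simpa [hw] using this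
    · rintro (v | v)
      · exact h2 v
      · exact h2' v

/-- The starting places and the end places of the wires are both in bijection with the names, so
that values on the wires amount to one value per name. -/
theorem sat_ofNames {m n k N : ℕ} (R : S.Model X) {label : Fin k → S.Op}
    {ins : Fin n → Fin N} {vin : ∀ v, Fin (S.inp (label v)) → Fin N}
    {vout : ∀ v, Fin (S.out (label v)) → Fin N} {outs : Fin m → Fin N} {starts ends}
    {x : Fin n → X} {y : Fin m → X} :
    (Wiring.ofNames label ins vin vout outs starts ends).Sat R x y ↔
      ∃ ν : Fin N → X, (∀ i, x i = ν (ins i)) ∧ (∀ o, y o = ν (outs o)) ∧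
        ∀ v, R (label v) (fun q => ν (vin v q)) (fun p => ν (vout v p)) := by
  set G := Wiring.ofNames label ins vin vout outs starts ends with hG
  constructor
  · rintro ⟨ν, κ, h1, h2⟩
    let st := Equiv.ofBijective _ starts
    have key : ∀ t, Sum.elim x ν (st.symm (Sum.elim outs
        (fun x : Σ v, Fin (S.inp (label v)) => vin x.1 x.2) t)) = Sum.elim y κ t := fun t => by
      refine (h1 _).symm.trans (congrArg (Sum.elim y κ) ?_)
      exact (ofNames_wire _ _).2 (st.apply_symm_apply _)
    refine ⟨fun e => Sum.elim x ν (st.symm e), fun i => ?_, fun o => (key (.inl o)).symm,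
      fun v => ?_⟩
    · exact (congrArg (Sum.elim x ν) (st.symm_apply_apply (.inl i))).symm
    · have h3 : ∀ q, Sum.elim x ν (st.symm (vin v q)) = κ ⟨v, q⟩ := fun q => key (.inr ⟨v, q⟩)
      have h4 : ∀ p, Sum.elim x ν (st.symm (vout v p)) = ν ⟨v, p⟩ := fun p =>
        congrArg (Sum.elim x ν) (st.symm_apply_apply (.inr ⟨v, p⟩))
      simp only [h3, h4]
      exact h2 v
  · rintro ⟨ν, h1, h2, h3⟩
    refine ⟨fun u => ν (vout u.1 u.2), fun u => ν (vin u.1 u.2), fun s => ?_, h3⟩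
    have h4 := (ofNames_wire (starts := starts) (ends := ends) s (G.wire s)).1 rfl
    have h5 : Sum.elim y (fun u : Σ v, Fin (S.inp (label v)) => ν (vin u.1 u.2)) (G.wire s) =
        ν (Sum.elim outs (fun x : Σ v, Fin (S.inp (label v)) => vin x.1 x.2) (G.wire s)) := by
      rcases G.wire s with o | u
      · exact h2 o
      · rfl
    refine h5.trans ((congrArg ν h4.symm).trans ?_)
    rcases s with i | u
    · exact (h1 i).symm
    · rfl

end Wiring

namespace Monomial
variable {S : Sig} {X : Type} {m n : ℕ}

/-- The relation defined by a monomial. -/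
def Sat (R : S.Model X) (G : Monomial S m n) (x : Fin n → X) (y : Fin m → X) : Prop :=
  Quotient.lift (fun G : DGraph S m n => G.graph.Sat R x y)
    (fun _ _ h => propext (Wiring.Iso.sat_iff R h)) G

theorem sat_ofWiring (R : S.Model X) {V : Type} [Fintype V] (G : Wiring S V (Fin n) (Fin m))
    (hc : G.Connected) (ha : G.Acyclic) {x : Fin n → X} {y : Fin m → X} :
    (ofWiring G hc ha).Sat R x y ↔ G.Sat R x y :=
  (G.reindex_iso _).sat_iff R

/-- The entries of a composite only interact through the values `z` on the wires between the two
levels. The arguments on contexts and on words use graphs through this statement. -/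
theorem sat_comp (R : S.Model X) (s : Shape m n) (Q : ∀ y, Monomial S (s.l y) (s.k y))
    (P : ∀ x, Monomial S (s.j x) (s.i x)) {x : Fin n → X} {y : Fin m → X} :
    (comp s Q P).Sat R x y ↔ ∃ z : (Σ b, Fin (s.j b)) → X,
      (∀ b, (P b).Sat R (fun t => x (s.σ₁.symm ⟨b, t⟩)) (fun t => z ⟨b, t⟩)) ∧
      ∀ b, (Q b).Sat R (fun t => z (s.σ₂.symm ⟨b, t⟩)) (fun t => y (s.σ₃ ⟨b, t⟩)) := by
  obtain ⟨Q, rfl⟩ := exists_rep Q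
  obtain ⟨P, rfl⟩ := exists_rep P
  rw [comp_mk]
  refine (sat_ofWiring R _ _ _).trans ((Wiring.sat_bdry R _ _ _).trans
    ((Wiring.sat_seq R _ _).trans (exists_congr fun z => and_congr ?_ ?_)))
  · exact Wiring.sat_par R _
  · exact (Wiring.sat_bdry R _ _ _).trans (Wiring.sat_par R _)

theorem sat_relabel {T : Type} (f : T → S.Op) (R : S.Model X) (G : Monomial (S.restrict f) m n)
    {x : Fin n → X} {y : Fin m → X} :
    (relabel f G).Sat R x y ↔ G.Sat (S := S.restrict f) (fun t => R (f t)) x y := by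
  induction G using Quotient.inductionOn with
  | h G => exact Iff.rfl

end Monomial

/-! ### Functional interpretations -/

/-- An interpretation of the operations as functions. -/
abbrev Sig.FunModel (S : Sig) (X : Type) : Type :=
  ∀ o : S.Op, (Fin (S.inp o) → X) → Fin (S.out o) → X

/-- A function, seen as a relation. -/
abbrev Sig.FunModel.rel {S : Sig} {X : Type} (F : S.FunModel X) : S.Model X :=
  fun o x y => y = F o x

namespace Wiring
variable {S : Sig} {X : Type}

theorem Acyclic.exists_sat [Nonempty X] (F : S.FunModel X) {V I O : Type} [Finite V]
    {G : Wiring S V I O} (hG : G.Acyclic) (x : I → X) : ∃ y, G.Sat F.rel x y := by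
  obtain ⟨level, hl⟩ := hG
  -- The values are computed level by level: recomputing every vertex from values that are right
  -- below level `N` makes them right below level `N + 1`, since all internal wires go up.
  have key : ∀ N, ∃ ν : (Σ v, Fin (S.out (G.label v))) → X, ∀ v, level v < N →
      (fun p => ν ⟨v, p⟩) = F (G.label v) (fun q => Sum.elim x ν (G.wire.symm (.inr ⟨v, q⟩))) := by
    intro N
    induction N with
    | zero => exact ⟨fun _ => Classical.arbitrary X, fun v hv => absurd hv (by omega)⟩
    | succ N ih =>
      obtain ⟨ν, hν⟩ := ih
      refine ⟨fun u => F (G.label u.1) (fun q => Sum.elim x ν (G.wire.symm (.inr ⟨u.1, q⟩))) u.2,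
        fun v hv => funext fun p => ?_⟩
      change F _ _ p = F _ _ p
      congr 1
      funext q
      rcases hw : G.wire.symm (.inr ⟨v, q⟩) with i | w
      · rfl
      · have := hl w.1 w.2 v q ((Equiv.symm_apply_eq _).1 hw).symm
        exact congrFun (hν w.1 (by omega)) w.2
  obtain ⟨B, hB⟩ := (Set.finite_range level).bddAbove
  obtain ⟨ν, hν⟩ := key (B + 1)
  refine ⟨fun o => Sum.elim x ν (G.wire.symm (.inl o)), ν,
    fun u => Sum.elim x ν (G.wire.symm (.inr u)), fun s => ?_,
    fun v => hν v (Nat.lt_succ_of_le (hB ⟨v, rfl⟩))⟩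
  rcases hw : G.wire s with o | u <;> simp [(Equiv.symm_apply_eq _).2 hw.symm]

theorem sat_le {F : S.FunModel X} [Preorder X] (hF : ∀ o, Monotone (F o)) {V I O : Type}
    {G : Wiring S V I O} (hG : G.Acyclic) {x x' : I → X} (hx : x ≤ x') 
    {ν ν' : (Σ v, Fin (S.out (G.label v))) → X} {κ κ' : (Σ v, Fin (S.inp (G.label v))) → X}
    {y y' : O → X}
    (h : ∀ s, Sum.elim y κ (G.wire s) = Sum.elim x ν s)
    (h' : ∀ s, Sum.elim y' κ' (G.wire s) = Sum.elim x' ν' s)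
    (hv : ∀ v, F.rel (G.label v) (fun q => κ ⟨v, q⟩) (fun p => ν ⟨v, p⟩))
    (hv' : ∀ v, F.rel (G.label v) (fun q => κ' ⟨v, q⟩) (fun p => ν' ⟨v, p⟩)) :
    Sum.elim x ν ≤ Sum.elim x' ν' := by
  obtain ⟨level, hl⟩ := hG
  have key : ∀ N v, level v < N → ∀ p, ν ⟨v, p⟩ ≤ ν' ⟨v, p⟩ := by
    intro N
    induction N with
    | zero => intro v hv; omega
    | succ N ih =>
      intro v hvN
      have : (fun p => ν ⟨v, p⟩) ≤ fun p => ν' ⟨v, p⟩ := by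
        rw [hv v, hv' v]
        refine hF _ fun q => ?_
        have h1 := h (G.wire.symm (.inr ⟨v, q⟩))
        have h1' := h' (G.wire.symm (.inr ⟨v, q⟩))
        simp only [Equiv.apply_symm_apply, Sum.elim_inr] at h1 h1'
        rw [h1, h1']
        rcases hw : G.wire.symm (.inr ⟨v, q⟩) with i | w
        · exact hx i
        · have := hl w.1 w.2 v q ((Equiv.symm_apply_eq _).1 hw).symm
          exact ih w.1 (by omega) w.2
      exact this
  rintro (i | u)
  · exact hx i
  · exact key _ u.1 (Nat.lt_succ_self _) u.2

/-- The inequality propagates upwards through the levels. For equal inputs, antisymmetry then gives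
uniqueness of the outputs. -/
theorem Acyclic.sat_mono {F : S.FunModel X} [Preorder X] (hF : ∀ o, Monotone (F o)) {V I O : Type}
    {G : Wiring S V I O} (hG : G.Acyclic) {x x' : I → X} (hx : x ≤ x') {y y' : O → X}
    (h : G.Sat F.rel x y) (h' : G.Sat F.rel x' y') : y ≤ y' := by
  obtain ⟨ν, κ, h1, h2⟩ := h
  obtain ⟨ν', κ', h1', h2'⟩ := h'
  intro o
  have h3 := h1 (G.wire.symm (.inl o))
  have h3' := h1' (G.wire.symm (.inl o))
  simp only [Equiv.apply_symm_apply, Sum.elim_inl] at h3 h3'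
  rw [h3, h3']
  exact sat_le hF hG hx h1 h1' h2 h2' _

/-- If the outputs agreed, then strictness would force the inputs of every vertex with equal outputs
to agree. As every wire ends at an output of the graph or at a vertex, going down from the top level
would show that the inputs of the graph agree. -/
theorem Acyclic.sat_strictMono {F : S.FunModel X} [PartialOrder X] (hF : ∀ o, StrictMono (F o))
    {V I O : Type} [Finite V] {G : Wiring S V I O} (hG : G.Acyclic) {x x' : I → X} (hx : x < x')
    {y y' : O → X} (h : G.Sat F.rel x y) (h' : G.Sat F.rel x' y') : y < y' := by
  have hy := hG.sat_mono (fun o => (hF o).monotone) hx.le h h'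
  refine lt_of_le_of_ne hy fun hyy => ?_
  obtain ⟨ν, κ, h1, h2⟩ := h
  obtain ⟨ν', κ', h1', h2'⟩ := h'
  have hle := sat_le (fun o => (hF o).monotone) hG hx.le h1 h1' h2 h2'
  obtain ⟨level, hl⟩ := hG
  obtain ⟨B, hB⟩ := (Set.finite_range level).bddAbove
  have hB : ∀ v, level v ≤ B := fun v => hB ⟨v, rfl⟩
  have back : ∀ s, Sum.elim y κ (G.wire s) = Sum.elim y' κ' (G.wire s) →
      Sum.elim x ν s = Sum.elim x' ν' s := fun s hs => (h1 s).symm.trans (hs.trans (h1' s))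
  have hin : ∀ v, (fun p => ν ⟨v, p⟩) = (fun p => ν' ⟨v, p⟩) →
      (fun q => κ ⟨v, q⟩) = fun q => κ' ⟨v, q⟩ := by
    intro v hv
    have hk : (fun q => κ ⟨v, q⟩) ≤ fun q => κ' ⟨v, q⟩ := fun q => by
      have h3 := h1 (G.wire.symm (.inr ⟨v, q⟩))
      have h3' := h1' (G.wire.symm (.inr ⟨v, q⟩))
      simp only [Equiv.apply_symm_apply, Sum.elim_inr] at h3 h3'
      change κ _ ≤ κ' _
      rw [h3, h3']
      exact hle _
    by_contra hne
    have := hF _ (lt_of_le_of_ne hk hne)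
    rw [← h2 v, ← h2' v, hv] at this
    exact lt_irrefl _ this
  -- Descending induction: `N` measures how far below the top level `B` the vertex may be.
  have key : ∀ N v, B < level v + N → (fun p => ν ⟨v, p⟩) = (fun p => ν' ⟨v, p⟩) := by
    intro N
    induction N with
    | zero => intro v hv; have := hB v; omega
    | succ N ih =>
      intro v hv
      funext p
      refine back (.inr ⟨v, p⟩) ?_
      rcases hw : G.wire (.inr ⟨v, p⟩) with o | w
      · exact congrFun hyy o
      · have := hl v p w.1 w.2 hw
        exact congrFun (hin w.1 (ih w.1 (by omega))) w.2
  refine hx.ne (funext fun i => back (.inl i) ?_)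
  rcases hw : G.wire (.inl i) with o | w
  · exact congrFun hyy o
  · exact congrFun (hin w.1 (key (B + 1) w.1 (by omega))) w.2

end Wiring

namespace Monomial
variable {S : Sig} {X : Type} {m n : ℕ}

/-- The function defined by a monomial. -/
noncomputable def eval [Nonempty X] (F : S.FunModel X) (G : Monomial S m n) (x : Fin n → X) :
    Fin m → X :=
  Classical.epsilon (G.Sat F.rel x)

theorem sat_eval [Nonempty X] (F : S.FunModel X) (G : Monomial S m n) (x : Fin n → X) :
    G.Sat F.rel x (G.eval F x) := by
  induction G using Quotient.inductionOn with
  | h G => exact Classical.epsilon_spec (G.acyclic.exists_sat F x)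

theorem eval_strictMono [Nonempty X] [PartialOrder X] {F : S.FunModel X}
    (hF : ∀ o, StrictMono (F o)) (G : Monomial S m n) : StrictMono (G.eval F) := by
  intro x x' hx
  have h := sat_eval F G x
  have h' := sat_eval F G x'
  induction G using Quotient.inductionOn with
  | h G => exact G.acyclic.sat_strictMono hF hx h h'

/-- Values in an acyclic graph are unique: this is `sat_mono` for equal inputs, applied in both
directions. -/
theorem eval_unique [Nonempty X] [PartialOrder X] {F : S.FunModel X}
    (hF : ∀ o, StrictMono (F o)) {G : Monomial S m n} {x : Fin n → X} {y : Fin m → X}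
    (h : G.Sat F.rel x y) : G.eval F x = y := by
  have h' := sat_eval F G x
  induction G using Quotient.inductionOn with
  | h G =>
    exact le_antisymm (G.acyclic.sat_mono (fun o => (hF o).monotone) le_rfl h' h)
      (G.acyclic.sat_mono (fun o => (hF o).monotone) le_rfl h h')

end Monomial

/-! ### Cutting a graph in two levels -/

namespace Wiring
variable {S : Sig}

/-- A graph given by a set `E` of wires, with the places where they start and end. -/
noncomputable def ofEnds {V I O E : Type} (label : V → S.Op)
    (st : I ⊕ (Σ v, Fin (S.out (label v))) → E) (en : O ⊕ (Σ v, Fin (S.inp (label v))) → E)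
    (hst : Function.Bijective st) (hen : Function.Bijective en) : Wiring S V I O where
  label := label
  wire := (Equiv.ofBijective st hst).trans (Equiv.ofBijective en hen).symm

theorem ofEnds_wire {V I O E : Type} {label : V → S.Op}
    {st : I ⊕ (Σ v, Fin (S.out (label v))) → E} {en : O ⊕ (Σ v, Fin (S.inp (label v))) → E}
    {hst : Function.Bijective st} {hen : Function.Bijective en} {s t} :
    (ofEnds label st en hst hen).wire s = t ↔ st s = en t :=
  Equiv.symm_apply_eq (Equiv.ofBijective en hen)

/-- The set `U` is closed under predecessors, so every wire between `U` and its complement leaves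
`U`. The intermediate boundary consists of the wires that cross the cut, including those that go
from an input to an output or that only touch one side. -/
theorem exists_seq {V I O : Type} [Finite V] [Finite I] (G : Wiring S V I O) (U : V → Prop)
    (hU : ∀ v p w q, G.wire (.inr ⟨v, p⟩) = .inr ⟨w, q⟩ → U w → U v) :
    ∃ (M : Type) (_ : Finite M) (G₁ : Wiring S {v // U v} I M) (G₂ : Wiring S {v // ¬ U v} M O),
      (∀ v, G₁.label v = G.label v.1) ∧ (∀ v, G₂.label v = G.label v.1) ∧
        (G₁.seq G₂).Iso G := by
  classical
  let A := I ⊕ (Σ v, Fin (S.out (G.label v)))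
  -- A wire, named by its start, belongs to the first part if it starts at an input or in `U`, and
  -- to the second part if it ends at an output or outside `U`. By `hU` every wire satisfies one of
  -- the two; those that satisfy both are cut.
  let s1 : A → Prop := fun s => ∀ u, s = .inr u → U u.1
  let s2 : A → Prop := fun s => ∀ u, G.wire s = .inr u → ¬ U u.1
  have hs2 : ∀ v p, ¬ U v → s2 (.inr ⟨v, p⟩) := fun v p hv u hu hu' => hv (hU _ _ _ _ hu hu')
  have hs1 : ∀ v p, U v → s1 (G.wire.symm (.inr ⟨v, p⟩)) := fun v p hv u hu =>
    hU u.1 u.2 v p ((Equiv.symm_apply_eq _).1 hu).symm hv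
  let M := {s : A // s1 s ∧ s2 s}
  let st1 : I ⊕ (Σ v : {v // U v}, Fin (S.out (G.label v.1))) → {s : A // s1 s} :=
    Sum.elim (fun i => ⟨.inl i, fun u hu => by simp at hu⟩)
      (fun u => ⟨.inr ⟨u.1.1, u.2⟩, fun u' hu => by
        obtain rfl := Sum.inr_injective hu
        exact u.1.2⟩)
  let en1 : M ⊕ (Σ v : {v // U v}, Fin (S.inp (G.label v.1))) → {s : A // s1 s} :=
    Sum.elim (fun m => ⟨m.1, m.2.1⟩)
      (fun u => ⟨G.wire.symm (.inr ⟨u.1.1, u.2⟩), hs1 _ _ u.1.2⟩)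
  let st2 : M ⊕ (Σ v : {v // ¬ U v}, Fin (S.out (G.label v.1))) → {s : A // s2 s} :=
    Sum.elim (fun m => ⟨m.1, m.2.2⟩) (fun u => ⟨.inr ⟨u.1.1, u.2⟩, hs2 _ _ u.1.2⟩)
  let en2 : O ⊕ (Σ v : {v // ¬ U v}, Fin (S.inp (G.label v.1))) → {s : A // s2 s} :=
    Sum.elim (fun o => ⟨G.wire.symm (.inl o), fun u hu => by simp at hu⟩)
      (fun u => ⟨G.wire.symm (.inr ⟨u.1.1, u.2⟩), fun u' hu => by
        simp only [Equiv.apply_symm_apply] at hu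
        obtain rfl := Sum.inr_injective hu
        exact u.1.2⟩)
  have hst1 : Function.Bijective st1 := by
    constructor
    · rintro (i | ⟨⟨v, hv⟩, p⟩) (i' | ⟨⟨v', hv'⟩, p'⟩) h <;> simp [st1] at h
      · exact congrArg _ (Sum.inl_injective h)
      · obtain ⟨rfl, h⟩ := h
        rfl
    · rintro ⟨i | ⟨v, p⟩, h⟩
      · exact ⟨.inl i, rfl⟩
      · exact ⟨.inr ⟨⟨v, h _ rfl⟩, p⟩, rfl⟩
  have hen1 : Function.Bijective en1 := by
    constructor
    · rintro (⟨m, h1, h2⟩ | ⟨⟨v, hv⟩, p⟩) (⟨m', h1', h2'⟩ | ⟨⟨v', hv'⟩, p'⟩) h <;>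
        simp [en1] at h
      · subst h; rfl
      · subst h
        exact absurd hv' (h2 ⟨v', p'⟩ (by simp))
      · subst h
        exact absurd hv (h2' ⟨v, p⟩ (by simp))
      · obtain ⟨rfl, h⟩ := h
        obtain rfl := eq_of_heq h
        rfl
    · rintro ⟨s, h⟩
      by_cases h2 : s2 s
      · exact ⟨.inl ⟨s, h, h2⟩, rfl⟩
      · simp only [s2, not_forall, not_not] at h2
        obtain ⟨⟨v, q⟩, hw, hv⟩ := h2
        refine ⟨.inr ⟨⟨v, hv⟩, q⟩, Subtype.ext ?_⟩
        exact (Equiv.symm_apply_eq _).2 hw.symm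
  have hst2 : Function.Bijective st2 := by
    constructor
    · rintro (⟨m, h1, h2⟩ | ⟨⟨v, hv⟩, p⟩) (⟨m', h1', h2'⟩ | ⟨⟨v', hv'⟩, p'⟩) h <;>
        simp [st2] at h
      · subst h; rfl
      · subst h
        exact absurd (h1 ⟨v', p'⟩ rfl) hv'
      · subst h
        exact absurd (h1' ⟨v, p⟩ rfl) hv
      · obtain ⟨rfl, h⟩ := h
        rfl
    · rintro ⟨s, h⟩
      by_cases h1 : s1 s
      · exact ⟨.inl ⟨s, h1, h⟩, rfl⟩
      · simp only [s1, not_forall] at h1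
        obtain ⟨⟨v, q⟩, rfl, hv⟩ := h1
        exact ⟨.inr ⟨⟨v, hv⟩, q⟩, rfl⟩
  have hen2 : Function.Bijective en2 := by
    constructor
    · rintro (o | ⟨⟨v, hv⟩, p⟩) (o' | ⟨⟨v', hv'⟩, p'⟩) h <;> simp [en2] at h
      · exact congrArg _ h
      · obtain ⟨rfl, h⟩ := h
        obtain rfl := eq_of_heq h
        rfl
    · rintro ⟨s, h⟩
      rcases hw : G.wire s with o | ⟨v, q⟩
      · exact ⟨.inl o, Subtype.ext ((Equiv.symm_apply_eq _).2 hw.symm)⟩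
      · exact ⟨.inr ⟨⟨v, h _ hw⟩, q⟩, Subtype.ext ((Equiv.symm_apply_eq _).2 hw.symm)⟩
  let G₁ : Wiring S {v // U v} I M := ofEnds _ st1 en1 hst1 hen1
  let G₂ : Wiring S {v // ¬ U v} M O := ofEnds _ st2 en2 hst2 hen2
  have w1 : ∀ s m, G₁.wire s = .inl m → m.1 = (st1 s).1 := fun s m h =>
    (congrArg Subtype.val (ofEnds_wire.1 h)).symm
  have w1' : ∀ s u, G₁.wire s = .inr u → G.wire (st1 s).1 = .inr ⟨u.1.1, u.2⟩ := fun s u h =>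
    (Equiv.eq_symm_apply _).1 (congrArg Subtype.val (ofEnds_wire.1 h))
  have w2 : ∀ s o, G₂.wire s = .inl o → G.wire (st2 s).1 = .inl o := fun s u h =>
    (Equiv.eq_symm_apply _).1 (congrArg Subtype.val (ofEnds_wire.1 h))
  have w2' : ∀ s u, G₂.wire s = .inr u → G.wire (st2 s).1 = .inr ⟨u.1.1, u.2⟩ := fun s u h =>
    (Equiv.eq_symm_apply _).1 (congrArg Subtype.val (ofEnds_wire.1 h))
  refine ⟨M, inferInstanceAs (Finite {s : A // s1 s ∧ s2 s}), G₁, G₂, fun _ => rfl,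
    fun _ => rfl, Equiv.sumCompl U, ?_, ?_⟩
  · rintro (v | v) <;> rfl
  · rintro (i | ⟨v | v, p⟩)
    · change G.wire (.inl i) = _
      rcases h : G₁.wire (.inl i) with m | u
      · have hm := w1 _ _ h
        rcases h' : G₂.wire (.inl m) with o | u <;> simp [h, h']
        · have := w2 _ _ h'
          exact (congrArg G.wire hm.symm).trans this
        · have := w2' _ _ h'
          exact (congrArg G.wire hm.symm).trans this
      · simp [h]
        exact w1' _ _ h
    · change G.wire (.inr ⟨v.1, p⟩) = _
      rcases h : G₁.wire (.inr ⟨v, p⟩) with m | u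
      · have hm := w1 _ _ h
        rcases h' : G₂.wire (.inl m) with o | u <;> simp [h, h']
        · have := w2 _ _ h'
          exact (congrArg G.wire hm.symm).trans this
        · have := w2' _ _ h'
          exact (congrArg G.wire hm.symm).trans this
      · simp [h]
        exact w1' _ _ h
    · change G.wire (.inr ⟨v.1, p⟩) = _
      rcases h : G₂.wire (.inr ⟨v, p⟩) with o | u <;> simp [h]
      · exact w2 _ _ h
      · exact w2' _ _ h

end Wiring

/-! ### Connected components and two-level decompositions -/

namespace Wiring
variable {S : Sig}

/-- The graph is the disjoint union of the fibres of a function on vertices and wires that is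
constant on connected components. -/
theorem exists_par_of_adj {V I O κ : Type} (G : Wiring S V I O)
    (c : V ⊕ (I ⊕ (Σ v, Fin (S.out (G.label v)))) → κ) (hc : ∀ x y, G.Adj x y → c x = c y) :
    ∃ (P : ∀ i : κ, Wiring S {v // c (.inl v) = i} {x // c (.inr (.inl x)) = i}
        {o // c (.inr (G.wire.symm (.inl o))) = i}),
      ((par P).bdry (Equiv.sigmaFiberEquiv fun x => c (.inr (.inl x))).symm
        (Equiv.sigmaFiberEquiv fun o => c (.inr (G.wire.symm (.inl o))))).Iso G ∧
      ∀ i, (∀ x y, c x = i → c y = i → Relation.EqvGen G.Adj x y) → (∃ x, c x = i) →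
        (P i).Connected := by
  have hout : ∀ v p, c (.inr (.inr ⟨v, p⟩)) = c (.inl v) := fun v p => (hc _ _ (.leave v p)).symm
  have hin : ∀ v p, c (.inr (G.wire.symm (.inr ⟨v, p⟩))) = c (.inl v) := fun v p =>
    hc _ _ (.enter _ v p (by simp))
  let E : κ → Type := fun i => {s // c (.inr s) = i}
  let st : ∀ i, {x // c (.inr (.inl x)) = i} ⊕
      (Σ v : {v // c (.inl v) = i}, Fin (S.out (G.label v.1))) → E i := fun i =>
    Sum.elim (fun x => ⟨.inl x.1, x.2⟩) (fun u => ⟨.inr ⟨u.1.1, u.2⟩, (hout _ _).trans u.1.2⟩)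
  let en : ∀ i, {o // c (.inr (G.wire.symm (.inl o))) = i} ⊕
      (Σ v : {v // c (.inl v) = i}, Fin (S.inp (G.label v.1))) → E i := fun i =>
    Sum.elim (fun o => ⟨G.wire.symm (.inl o.1), o.2⟩)
      (fun u => ⟨G.wire.symm (.inr ⟨u.1.1, u.2⟩), (hin _ _).trans u.1.2⟩)
  have hst : ∀ i, Function.Bijective (st i) := by
    intro i
    constructor
    · rintro (⟨x, hx⟩ | ⟨⟨v, hv⟩, p⟩) (⟨x', hx'⟩ | ⟨⟨v', hv'⟩, p'⟩) h <;>
        replace h := congrArg Subtype.val h <;> simp [st] at h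
      · subst h; rfl
      · obtain ⟨rfl, h⟩ := h
        obtain rfl := eq_of_heq h
        rfl
    · rintro ⟨x | ⟨v, p⟩, h⟩
      · exact ⟨.inl ⟨x, h⟩, rfl⟩
      · exact ⟨.inr ⟨⟨v, (hout v p).symm.trans h⟩, p⟩, rfl⟩
  have hen : ∀ i, Function.Bijective (en i) := by
    intro i
    constructor
    · rintro (⟨x, hx⟩ | ⟨⟨v, hv⟩, p⟩) (⟨x', hx'⟩ | ⟨⟨v', hv'⟩, p'⟩) h <;>
        replace h := congrArg Subtype.val h <;> simp [en] at h
      · subst h; rfl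
      · obtain ⟨rfl, h⟩ := h
        obtain rfl := eq_of_heq h
        rfl
    · rintro ⟨s, h⟩
      rcases hw : G.wire s with o | ⟨v, q⟩
      · obtain rfl := (Equiv.eq_symm_apply _).2 hw
        exact ⟨.inl ⟨o, h⟩, rfl⟩
      · obtain rfl := (Equiv.eq_symm_apply _).2 hw
        exact ⟨.inr ⟨⟨v, (hin v q).symm.trans h⟩, q⟩, rfl⟩
  let P : ∀ i : κ, Wiring S {v // c (.inl v) = i} {x // c (.inr (.inl x)) = i}
        {o // c (.inr (G.wire.symm (.inl o))) = i} := fun i =>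
    ofEnds _ (st i) (en i) (hst i) (hen i)
  have w1 : ∀ i s o, (P i).wire s = .inl o → G.wire (st i s).1 = .inl o.1 := fun i s o h =>
    (Equiv.eq_symm_apply _).1 (congrArg Subtype.val (ofEnds_wire.1 h))
  have w2 : ∀ i s u, (P i).wire s = .inr u → G.wire (st i s).1 = .inr ⟨u.1.1, u.2⟩ :=
    fun i s o h => (Equiv.eq_symm_apply _).1 (congrArg Subtype.val (ofEnds_wire.1 h))
  refine ⟨P, ⟨Equiv.sigmaFiberEquiv fun v => c (.inl v), fun v => rfl, ?_⟩, ?_⟩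
  · rintro (x | ⟨⟨i, v⟩, p⟩)
    · change G.wire (.inl x) = _
      rcases h : (P (c (.inr (.inl x)))).wire (.inl ⟨x, rfl⟩) with o | u <;>
        simp [h, Equiv.sigmaFiberEquiv]
      · exact w1 _ _ _ h
      · exact w2 _ _ _ h
    · change G.wire (.inr ⟨v.1, p⟩) = _
      rcases h : (P i).wire (.inr ⟨v, p⟩) with o | u <;> simp [h, Equiv.sigmaFiberEquiv]
      · exact w1 _ _ _ h
      · exact w2 _ _ _ h
  · rintro i hi ⟨x0, hx0⟩
    have hc' : ∀ x y, Relation.EqvGen G.Adj x y → c x = c y := fun x y h => by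
      induction h with
      | rel x y h => exact hc x y h
      | refl => rfl
      | symm _ _ _ ih => exact ih.symm
      | trans _ _ _ _ _ ih ih' => exact ih.trans ih'
    let f : ∀ x, c x = i → {v // c (.inl v) = i} ⊕ ({x // c (.inr (.inl x)) = i} ⊕
        (Σ v : {v // c (.inl v) = i}, Fin (S.out (G.label v.1)))) := fun x => match x with
      | .inl v => fun h => .inl ⟨v, h⟩
      | .inr (.inl x) => fun h => .inr (.inl ⟨x, h⟩)
      | .inr (.inr u) => fun h => .inr (.inr ⟨⟨u.1, (hout _ _).symm.trans h⟩, u.2⟩)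
    have hf : ∀ z, ∃ x h, f x h = z := by
      rintro (v | x | u)
      · exact ⟨.inl v.1, v.2, rfl⟩
      · exact ⟨.inr (.inl x.1), x.2, rfl⟩
      · exact ⟨.inr (.inr ⟨u.1.1, u.2⟩), (hout _ _).trans u.1.2, rfl⟩
    -- A path of `G` between two points of the fibre stays in the fibre, because `c` is constant
    -- along it.
    have key : ∀ x y, Relation.EqvGen G.Adj x y → ∀ hx hy,
        Relation.EqvGen (P i).Adj (f x hx) (f y hy) := by
      intro x y h
      induction h with
      | rel x y h =>
        intro hx hy
        rcases h with ⟨v, p⟩ | ⟨s, v, p, hs⟩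
        · exact .rel _ _ (.leave (G := P i) ⟨v, hx⟩ p)
        · have : ∀ t, (st i t).1 = s → Relation.EqvGen (P i).Adj (.inr t) (.inl ⟨v, hy⟩) :=
            fun t ht => by
            refine .rel _ _ (.enter (G := P i) t ⟨v, hy⟩ p ?_)
            refine ofEnds_wire.2 (Subtype.ext ?_)
            rw [ht]
            exact (Equiv.eq_symm_apply _).2 hs
          rcases s with x | u
          · exact this (.inl ⟨x, hx⟩) rfl
          · exact this (.inr ⟨⟨u.1, (hout _ _).symm.trans hx⟩, u.2⟩) rfl
      | refl x => exact fun _ _ => .refl _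
      | symm _ _ _ ih => exact fun hx hy => .symm _ _ (ih hy hx)
      | trans x y z h _ ih ih' =>
        exact fun hx hz => .trans _ _ _ (ih hx ((hc' _ _ h).symm.trans hx)) (ih' _ hz)
    refine ⟨⟨f x0 hx0⟩, fun x y => ?_⟩
    obtain ⟨x, hx, rfl⟩ := hf x
    obtain ⟨y, hy, rfl⟩ := hf y
    exact key _ _ (hi x y hx hy) _ _

theorem acyclic_of_par {ι : Type} {V I O : ι → Type} {G : ∀ i, Wiring S (V i) (I i) (O i)}
    (h : (par G).Acyclic) (i : ι) : (G i).Acyclic := by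
  obtain ⟨l, hl⟩ := h
  refine ⟨fun v => l ⟨i, v⟩, fun v p w q h => hl ⟨i, v⟩ p ⟨i, w⟩ q ?_⟩
  simp [h]

theorem seq_acyclic_left {V W I M O : Type} {G : Wiring S V I M} {H : Wiring S W M O}
    (h : (G.seq H).Acyclic) : G.Acyclic := by
  obtain ⟨l, hl⟩ := h
  refine ⟨fun v => l (.inl v), fun v p w q h => hl (.inl v) p (.inl w) q ?_⟩
  simp [h]

theorem seq_acyclic_right {V W I M O : Type} {G : Wiring S V I M} {H : Wiring S W M O}
    (h : (G.seq H).Acyclic) : H.Acyclic := by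
  obtain ⟨l, hl⟩ := h
  refine ⟨fun v => l (.inr v), fun v p w q h => hl (.inr v) p (.inr w) q ?_⟩
  simp [h]

theorem bdry_refl {V I O : Type} (G : Wiring S V I O) :
    G.bdry (Equiv.refl I) (Equiv.refl O) = G := by
  refine congrArg (Wiring.mk _) (Equiv.ext fun s => ?_)
  rcases s with i | u
  · exact congrFun Sum.map_id_id _
  · exact congrFun Sum.map_id_id _

theorem iso_bdry_symm {V W I O I' O' : Type} {G : Wiring S V I O} {H : Wiring S W I' O'}
    {e : I' ≃ I} {f : O ≃ O'} (h : (G.bdry e f).Iso H) : G.Iso (H.bdry e.symm f.symm) := by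
  have := h.bdry e.symm f.symm
  rwa [bdry_bdry, Equiv.symm_trans_self, Equiv.self_trans_symm, bdry_refl] at this

/-- A finite acyclic graph is a disjoint union of connected graphs. -/
theorem exists_par {V I O : Type} [Finite V] [Finite I] (G : Wiring S V I O)
    (ha : G.Acyclic) : ∃ (a : ℕ) (i j : Fin a → ℕ) (P : ∀ x, DGraph S (j x) (i x))
      (e : I ≃ Σ x, Fin (i x)) (f : (Σ x, Fin (j x)) ≃ O),
      ((par fun x => (P x).graph).bdry e f).Iso G := by
  classical
  have hO : Finite O := by
    have : Finite (O ⊕ (Σ v, Fin (S.inp (G.label v)))) := Finite.of_equiv _ G.wire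
    exact Finite.of_injective (Sum.inl : O → O ⊕ (Σ v, Fin (S.inp (G.label v))))
      Sum.inl_injective
  let N := V ⊕ (I ⊕ (Σ v, Fin (S.out (G.label v))))
  -- The connected components, so that each fibre of `c` is exactly one of them.
  let κ := Quot G.Adj
  have hκ : Finite κ := Quot.finite _
  obtain ⟨a, ⟨r⟩⟩ := Finite.exists_equiv_fin κ
  let c : N → Fin a := fun x => r (Quot.mk _ x)
  obtain ⟨P, hP, hcon⟩ := exists_par_of_adj G c (fun x y h => congrArg r (Quot.sound h))
  have hcon : ∀ i, (P i).Connected := fun i => by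
    refine hcon i (fun x y hx hy => Quot.eqvGen_exact (r.injective (hx.trans hy.symm))) ?_
    obtain ⟨x, hx⟩ := Quot.exists_rep (r.symm i)
    exact ⟨x, by simp [c, hx]⟩
  have hac : ∀ i, (P i).Acyclic := fun i =>
    acyclic_of_par ((iso_bdry_symm hP).acyclic (bdry_acyclic _ _ ha)) i
  choose nv ev using fun i : Fin a => Finite.exists_equiv_fin {v // c (.inl v) = i}
  choose ni ei using fun i : Fin a => Finite.exists_equiv_fin {x // c (.inr (.inl x)) = i}
  choose no eo using fun i : Fin a =>
    Finite.exists_equiv_fin {o // c (.inr (G.wire.symm (.inl o))) = i}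
  let ev := fun i => (ev i).some
  let ei := fun i => (ei i).some
  let eo := fun i => (eo i).some
  let P' : ∀ x, DGraph S (no x) (ni x) := fun x =>
    { size := nv x
      graph := ((P x).reindex (ev x).symm).bdry (ei x).symm (eo x)
      connected := bdry_connected _ _ ((reindex_iso _ _).symm.connected (hcon x))
      acyclic := bdry_acyclic _ _ ((reindex_iso _ _).acyclic (hac x)) }
  refine ⟨a, ni, no, P', (Equiv.sigmaFiberEquiv _).symm.trans (Equiv.sigmaCongrRight ei),
    (Equiv.sigmaCongrRight fun x => (eo x).symm).trans (Equiv.sigmaFiberEquiv _), ?_⟩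
  refine Iso.trans ?_ hP
  have h1 : (par fun x => (P' x).graph).Iso ((par P).bdry
      (Equiv.sigmaCongrRight fun x => (ei x).symm) (Equiv.sigmaCongrRight eo)) := by
    rw [← par_bdry]
    exact Iso.par fun x => (reindex_iso _ _).bdry _ _
  refine (h1.bdry _ _).trans ?_
  rw [bdry_bdry]
  have h2 : ((Equiv.sigmaFiberEquiv fun x => c (.inr (.inl x))).symm.trans
      (Equiv.sigmaCongrRight ei)).trans (Equiv.sigmaCongrRight fun x => (ei x).symm) =
      (Equiv.sigmaFiberEquiv fun x => c (.inr (.inl x))).symm := by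
    ext1 x; simp
  have h3 : (Equiv.sigmaCongrRight eo).trans ((Equiv.sigmaCongrRight fun x => (eo x).symm).trans
      (Equiv.sigmaFiberEquiv fun o => c (.inr (G.wire.symm (.inl o))))) =
      Equiv.sigmaFiberEquiv fun o => c (.inr (G.wire.symm (.inl o))) := by
    ext1 x; simp
  rw [h2, h3]
  exact Iso.refl _

/-- Contracting every block to a point turns a path of the two-level graph into a path of links: an
incidence either stays in a block or crosses from the first level to the second along `σ`. -/
theorem connectedPerm_of_twoLevel {ι κ : Type} {V I J : ι → Type} {W K L : κ → Type}
    {P : ∀ i, Wiring S (V i) (I i) (J i)} {Q : ∀ r, Wiring S (W r) (K r) (L r)}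
    {σ : (Σ i, J i) ≃ Σ r, K r} (hP : ∀ i, (P i).Connected) (hQ : ∀ r, (Q r).Connected)
    (h : (twoLevel P Q σ).Connected) : ConnectedPerm σ := by
  let T := twoLevel P Q σ
  let f : ((Σ i, V i) ⊕ Σ r, W r) ⊕ ((Σ i, I i) ⊕ (Σ v, Fin (S.out (T.label v)))) → ι ⊕ κ :=
    Sum.elim (Sum.map Sigma.fst Sigma.fst) (Sum.elim (fun x => .inl x.1)
      (fun u => Sum.map Sigma.fst Sigma.fst u.1))
  have key : ∀ x y, T.Adj x y → Relation.EqvGen (Link σ) (f x) (f y) := by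
    rintro _ _ (⟨v, p⟩ | ⟨s, v, p, hs⟩)
    · exact .refl _
    · rcases s with ⟨i, x⟩ | ⟨⟨i, w⟩ | ⟨r, w⟩, p'⟩
      · rcases hw : (P i).wire (.inl x) with o | u
        · simp [T, hw] at hs
          rcases hw' : (Q (σ ⟨i, o⟩).1).wire (.inl (σ ⟨i, o⟩).2) with o' | u' <;>
            simp [hw'] at hs
          obtain ⟨rfl, -⟩ := hs
          exact .rel _ _ ⟨⟨i, o⟩, rfl, rfl⟩
        · simp [T, hw] at hs
          obtain ⟨rfl, -⟩ := hs
          exact .refl _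
      · rcases hw : (P i).wire (.inr ⟨w, p'⟩) with o | u
        · simp [T, hw] at hs
          rcases hw' : (Q (σ ⟨i, o⟩).1).wire (.inl (σ ⟨i, o⟩).2) with o' | u' <;>
            simp [hw'] at hs
          obtain ⟨rfl, -⟩ := hs
          exact .rel _ _ ⟨⟨i, o⟩, rfl, rfl⟩
        · simp [T, hw] at hs
          obtain ⟨rfl, -⟩ := hs
          exact .refl _
      · rcases hw : (Q r).wire (.inr ⟨w, p'⟩) with o | u
        · simp [T, hw] at hs
        · simp [T, hw] at hs
          obtain ⟨rfl, -⟩ := hs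
          exact .refl _
  have hfP : ∀ i, ∃ x, f x = .inl i := by
    intro i
    obtain ⟨v | x | u⟩ := (hP i).1
    · exact ⟨.inl (.inl ⟨i, v⟩), rfl⟩
    · exact ⟨.inr (.inl ⟨i, x⟩), rfl⟩
    · exact ⟨.inl (.inl ⟨i, u.1⟩), rfl⟩
  -- A block of the second level may be a bare wire, which contributes no point of its own to the
  -- composite. It is then reached through the block of the first level that feeds it.
  have hf : ∀ z, ∃ x, Relation.EqvGen (Link σ) (f x) z := by
    rintro (i | r)
    · obtain ⟨x, hx⟩ := hfP i
      exact ⟨x, hx ▸ .refl _⟩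
    · obtain ⟨v | x | u⟩ := (hQ r).1
      · exact ⟨.inl (.inr ⟨r, v⟩), .refl _⟩
      · obtain ⟨z, hz⟩ := hfP (σ.symm ⟨r, x⟩).1
        refine ⟨z, hz ▸ .rel _ _ ⟨σ.symm ⟨r, x⟩, rfl, ?_⟩⟩
        rw [Equiv.apply_symm_apply]
      · exact ⟨.inl (.inr ⟨r, u.1⟩), .refl _⟩
  obtain ⟨⟨x0⟩, h⟩ := h
  refine ⟨⟨f x0⟩, fun u v => ?_⟩
  obtain ⟨x, hx⟩ := hf u
  obtain ⟨y, hy⟩ := hf v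
  exact .trans _ _ _ (.symm _ _ hx) (.trans _ _ _ (eqvGen_map f key (h x y)) hy)

end Wiring

namespace Monomial
variable {S : Sig} {m n : ℕ}

/-- A connected graph, cut along an upper set of vertices described by labels, is a two-level
composite. -/
theorem exists_comp (G : DGraph S m n) (U : S.Op → Prop)
    (hU : ∀ v p w q, G.graph.wire (.inr ⟨v, p⟩) = .inr ⟨w, q⟩ → U (G.graph.label w) →
      U (G.graph.label v)) :
    ∃ (s : Shape m n) (Q : ∀ y, DGraph S (s.l y) (s.k y)) (P : ∀ x, DGraph S (s.j x) (s.i x)),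
      (∀ y v, ¬ U ((Q y).graph.label v)) ∧ (∀ x v, U ((P x).graph.label v)) ∧
      mk G = comp s (fun y => mk (Q y)) (fun x => mk (P x)) ∧
      G.graph.Iso ((Wiring.twoLevel (fun x => (P x).graph) (fun y => (Q y).graph) s.σ₂).bdry
        s.σ₁ s.σ₃) := by
  obtain ⟨M, hM, G₁, G₂, hl1, hl2, hG⟩ :=
    Wiring.exists_seq G.graph (fun v => U (G.graph.label v)) hU
  have hac := hG.acyclic G.acyclic
  obtain ⟨a, i, j, P, e1, f1, h1⟩ := Wiring.exists_par G₁ (Wiring.seq_acyclic_left hac)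
  obtain ⟨b, k, l, Q, e2, f2, h2⟩ := Wiring.exists_par G₂ (Wiring.seq_acyclic_right hac)
  have h3 := ((h1.seq h2).trans hG).symm
  rw [Wiring.seq_bdry] at h3
  have hP : ∀ x v, U ((P x).graph.label v) := fun x v => by
    obtain ⟨u, hu, -⟩ := h1
    have := hu ⟨x, v⟩
    change (P x).graph.label v = _ at this
    rw [this, hl1]
    exact (u ⟨x, v⟩).2
  have hQ : ∀ x v, ¬ U ((Q x).graph.label v) := fun x v => by
    obtain ⟨u, hu, -⟩ := h2
    have := hu ⟨x, v⟩
    change (Q x).graph.label v = _ at this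
    rw [this, hl2]
    exact (u ⟨x, v⟩).2
  have h4 : G.graph.Iso ((Wiring.twoLevel (fun x => (P x).graph) (fun y => (Q y).graph)
      (f1.trans e2)).bdry e1 f2) := by
    rwa [Wiring.seq_bdry_right, Wiring.bdry_bdry] at h3
  have hc := (Wiring.iso_bdry_symm (Wiring.Iso.refl _)).symm.connected
    (Wiring.bdry_connected e1.symm f2.symm (h4.connected G.connected))
  let s : Shape m n :=
    { b := b, a := a, l := l, k := k, j := j, i := i, σ₃ := f2, σ₂ := f1.trans e2, σ₁ := e1
      connected := Wiring.connectedPerm_of_twoLevel (fun x => (P x).connected)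
        (fun y => (Q y).connected) hc }
  refine ⟨s, Q, P, hQ, hP, ?_, h4⟩
  rw [comp_mk s Q P]
  exact Quotient.sound (h4.trans (Wiring.reindex_iso _ _).symm)

end Monomial

/-! ### Graphs up to renaming of their inputs and outputs -/

/-- Here `A` and `B` stand for the outputs and the inputs of the vertices. Without direct wires, the
inputs of the graph correspond to the elements of `B` not reached from `A`, and its outputs to the
elements of `A` not sent to `B`. These subsets are the same for `w` and `w'`. -/
theorem Equiv.exists_sumCongr_of_inr_iff {I I' O O' A B : Type} (w : I ⊕ A ≃ O ⊕ B)
    (w' : I' ⊕ A ≃ O' ⊕ B) (hw : ∀ i o, w (.inl i) ≠ .inl o) (hw' : ∀ i o, w' (.inl i) ≠ .inl o)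
    (h : ∀ a b, w (.inr a) = .inr b ↔ w' (.inr a) = .inr b) :
    ∃ (α : I ≃ I') (β : O' ≃ O), w = (α.sumCongr (Equiv.refl A)).trans
      (w'.trans (β.sumCongr (Equiv.refl B))) := by
  have hI : ∀ {I I' O O' : Type} (w : I ⊕ A ≃ O ⊕ B) (w' : I' ⊕ A ≃ O' ⊕ B),
      (∀ i o, w (.inl i) ≠ .inl o) → (∀ a b, w (.inr a) = .inr b ↔ w' (.inr a) = .inr b) →
      ∀ i, ∃ i', ∃ b, w (.inl i) = .inr b ∧ w' (.inl i') = .inr b := by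
    intro I I' O O' w w' hw h i
    rcases hb : w (.inl i) with o | b
    · exact absurd hb (hw i o)
    · rcases hi : w'.symm (.inr b) with i' | a
      · exact ⟨i', b, rfl, ((Equiv.symm_apply_eq _).1 hi).symm⟩
      · have := (h a b).2 ((Equiv.symm_apply_eq _).1 hi).symm
        exact absurd (w.injective (hb.trans this.symm)) (by simp)
  have hO : ∀ {I I' O O' : Type} (w : I ⊕ A ≃ O ⊕ B) (w' : I' ⊕ A ≃ O' ⊕ B),
      (∀ i o, w (.inl i) ≠ .inl o) → (∀ a b, w (.inr a) = .inr b ↔ w' (.inr a) = .inr b) →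
      ∀ o, ∃ o', ∃ a, w (.inr a) = .inl o ∧ w' (.inr a) = .inl o' := by
    intro I I' O O' w w' hw h o
    rcases ha : w.symm (.inl o) with i | a
    · exact absurd ((Equiv.symm_apply_eq _).1 ha).symm (hw i o)
    · have ha := ((Equiv.symm_apply_eq _).1 ha).symm
      rcases hi : w' (.inr a) with o' | b
      · exact ⟨o', a, ha, hi⟩
      · rw [(h a b).2 hi] at ha
        exact absurd ha (by simp)
  choose α hα using hI w w' hw h
  choose α' hα' using hI w' w hw' (fun a b => (h a b).symm)
  choose β hβ using hO w' w hw' (fun a b => (h a b).symm)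
  choose β' hβ' using hO w w' hw h
  refine ⟨⟨α, α', fun i => ?_, fun i => ?_⟩, ⟨β, β', fun o => ?_, fun o => ?_⟩, Equiv.ext ?_⟩
  · obtain ⟨b, h1, h2⟩ := hα i
    obtain ⟨b', h1', h2'⟩ := hα' (α i)
    obtain rfl := Sum.inr_injective (h2.symm.trans h1')
    exact Sum.inl_injective (w.injective (h2'.trans h1.symm))
  · obtain ⟨b, h1, h2⟩ := hα' i
    obtain ⟨b', h1', h2'⟩ := hα (α' i)
    obtain rfl := Sum.inr_injective (h2.symm.trans h1')
    exact Sum.inl_injective (w'.injective (h2'.trans h1.symm))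
  · obtain ⟨b, h1, h2⟩ := hβ o
    obtain ⟨b', h1', h2'⟩ := hβ' (β o)
    obtain rfl := Sum.inr_injective (w.injective (h2.trans h1'.symm))
    exact Sum.inl_injective (h2'.symm.trans h1)
  · obtain ⟨b, h1, h2⟩ := hβ' o
    obtain ⟨b', h1', h2'⟩ := hβ (β' o)
    obtain rfl := Sum.inr_injective (w'.injective (h2.trans h1'.symm))
    exact Sum.inl_injective (h2'.symm.trans h1)
  · rintro (i | a)
    · obtain ⟨b, h1, h2⟩ := hα i
      simp [h1, h2]
    · rcases ha : w' (.inr a) with o' | b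
      · obtain ⟨a', h1, h2⟩ := hβ o'
        obtain rfl := Sum.inr_injective (w'.injective (h1.trans ha.symm))
        simp [ha, h2]
      · simp [ha, (h a b).2 ha]

namespace Wiring
variable {S : Sig}

/-- A graph without direct wires from an input to an output is determined, up to renaming its inputs
and outputs, by its internal wires. -/
theorem exists_iso_bdry {V W I O I' O' : Type} {G : Wiring S V I O} {H : Wiring S W I' O'}
    (e : V ≃ W) (he : ∀ v, G.label v = H.label (e v)) (hG : ∀ i o, G.wire (.inl i) ≠ .inl o)
    (hH : ∀ i o, H.wire (.inl i) ≠ .inl o)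
    (h : ∀ v p w q, G.wire (.inr ⟨v, p⟩) = .inr ⟨w, q⟩ ↔
      H.wire (.inr ⟨e v, Fin.cast (by rw [he]) p⟩) = .inr ⟨e w, Fin.cast (by rw [he]) q⟩) :
    ∃ (α : I ≃ I') (β : O' ≃ O), G.Iso (H.bdry α β) := by
  obtain ⟨lab, wire⟩ := G
  obtain rfl : lab = fun v => H.label (e v) := funext he
  simp only [Fin.cast_eq_self] at h
  obtain ⟨α, β, hαβ⟩ := Equiv.exists_sumCongr_of_inr_iff wire (H.reindex e).wire hG
    (fun i o hio => by
      refine hH i o ?_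
      rcases hw : H.wire (.inl i) with o' | u
      · simpa [hw] using hio
      · simp [hw] at hio) (fun a b => by
      obtain ⟨v, p⟩ := a
      obtain ⟨w, q⟩ := b
      rw [h]
      change _ ↔ ((Equiv.refl O').sumCongr
        (Equiv.sigmaCongrLeft (β := fun v => Fin (S.inp (H.label v))) e).symm)
          (H.wire (.inr ⟨e v, p⟩)) = _
      exact (Equiv.symm_apply_eq ((Equiv.refl O').sumCongr
        (Equiv.sigmaCongrLeft (β := fun v => Fin (S.inp (H.label v))) e))
        (x := H.wire (.inr ⟨e v, p⟩)) (y := .inr ⟨w, q⟩)).symm)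
  refine ⟨α, β, ?_⟩
  refine Iso.trans (H := (H.reindex e).bdry α β) ?_ ((reindex_iso H e).bdry α β)
  have : (⟨fun v => H.label (e v), wire⟩ : Wiring S V I O) = (H.reindex e).bdry α β :=
    congrArg (Wiring.mk _) hαβ
  rw [this]
  exact Iso.refl _

/-- A wire from an input to an output touches no vertex, so it is a connected component by itself.
-/
theorem Connected.wire_inl_ne {V I O : Type} [Nonempty V] {G : Wiring S V I O} (h : G.Connected)
    (i : I) (o : O) : G.wire (.inl i) ≠ .inl o := by
  intro hio
  have key : ∀ x y, Relation.EqvGen G.Adj x y → (x = .inr (.inl i) ↔ y = .inr (.inl i)) := by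
    intro x y h
    induction h with
    | rel x y h =>
      rcases h with ⟨v, p⟩ | ⟨s, v, p, hs⟩
      · simp
      · simp only [Sum.inr.injEq, reduceCtorEq, iff_false]
        rintro rfl
        rw [hio] at hs
        simp at hs
    | refl => exact Iff.rfl
    | symm _ _ _ ih => exact ih.symm
    | trans _ _ _ _ _ ih ih' => exact ih.trans ih'
  obtain ⟨v⟩ := ‹Nonempty V›
  exact absurd ((key _ (.inl v) (h.2 _ _)).1 rfl) (by simp)

/-- There is a wire from the output number `p` of a vertex labelled `o₁` to the input number `q`
of a vertex labelled `o₂`. -/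
def HasEdge {V I O : Type} (G : Wiring S V I O) (o₁ : S.Op) (p : ℕ) (o₂ : S.Op) (q : ℕ) : Prop :=
  ∃ v p' w q', G.label v = o₁ ∧ p'.val = p ∧ G.label w = o₂ ∧ q'.val = q ∧
    G.wire (.inr ⟨v, p'⟩) = .inr ⟨w, q'⟩

theorem twoLevel_wire_inr {ι κ : Type} {V I J : ι → Type} {W K L : κ → Type}
    {P : ∀ i, Wiring S (V i) (I i) (J i)} {Q : ∀ r, Wiring S (W r) (K r) (L r)}
    {σ : (Σ i, J i) ≃ Σ r, K r} {r : κ} {v : W r} {p : Fin (S.out ((Q r).label v))} {t}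
    (h : (twoLevel P Q σ).wire (.inr ⟨.inr ⟨r, v⟩, p⟩) = .inr t) :
    ∃ w q, t = ⟨.inr ⟨r, w⟩, q⟩ ∧ (Q r).wire (.inr ⟨v, p⟩) = .inr ⟨w, q⟩ := by
  rcases hw : (Q r).wire (.inr ⟨v, p⟩) with o | ⟨w, q⟩
  · simp [hw] at h
  · simp [hw] at h
    exact ⟨w, q, h.symm, rfl⟩

theorem twoLevel_wire_inl {ι κ : Type} {V I J : ι → Type} {W K L : κ → Type}
    {P : ∀ i, Wiring S (V i) (I i) (J i)} {Q : ∀ r, Wiring S (W r) (K r) (L r)}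
    {σ : (Σ i, J i) ≃ Σ r, K r} {i : ι} {v : V i} {p : Fin (S.out ((P i).label v))} {z t}
    (h : (twoLevel P Q σ).wire (.inr ⟨.inl ⟨i, v⟩, p⟩) = .inr t) (ht : t.1 = .inl z) :
    ∃ w q, t = ⟨.inl ⟨i, w⟩, q⟩ ∧ (P i).wire (.inr ⟨v, p⟩) = .inr ⟨w, q⟩ := by
  rcases hw : (P i).wire (.inr ⟨v, p⟩) with o | ⟨w, q⟩
  · rcases hw' : (Q (σ ⟨i, o⟩).1).wire (.inl (σ ⟨i, o⟩).2) with o' | u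
    · simp [hw, hw'] at h
    · simp [hw, hw'] at h
      rw [← h] at ht
      simp at ht
  · simp [hw] at h
    exact ⟨w, q, h.symm, rfl⟩

/-- By acyclicity all internal wires go from `v` to `w`, and `hu` leaves room for only one, since
`v` has a single output or `w` a single input. -/
theorem wire_iff_of_card_two {I O : Type} {n : ℕ} (hn : n ≤ 2) {G : Wiring S (Fin n) I O}
    (hG : G.Acyclic) {v w : Fin n} {p q} (h : G.wire (.inr ⟨v, p⟩) = .inr ⟨w, q⟩)
    (hu : S.out (G.label v) = 1 ∨ S.inp (G.label w) = 1) (x p' y q') :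
    G.wire (.inr ⟨x, p'⟩) = .inr ⟨y, q'⟩ ↔ x = v ∧ p'.val = p.val ∧ y = w ∧ q'.val = q.val := by
  obtain ⟨l, hl⟩ := hG
  have hvw := hl _ _ _ _ h
  have hall : ∀ x : Fin n, x = v ∨ x = w := by
    intro x
    have h1 : v.val ≠ w.val := fun h => by rw [Fin.ext h] at hvw; omega
    have := v.isLt
    have := w.isLt
    have := x.isLt
    rcases (by omega : x.val = v.val ∨ x.val = w.val) with h | h
    · exact .inl (Fin.ext h)
    · exact .inr (Fin.ext h)
  constructor
  · intro h'
    have hxy := hl _ _ _ _ h'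
    rcases hall x with rfl | rfl <;> rcases hall y with rfl | rfl
    · omega
    · refine ⟨rfl, ?_, rfl, ?_⟩
      · rcases hu with hu | hu
        · have := p.isLt; have := p'.isLt; omega
        · obtain rfl : q = q' := Fin.ext (by have := q.isLt; have := q'.isLt; omega)
          have := G.wire.injective (h.trans h'.symm)
          simp at this
          rw [this]
      · rcases hu with hu | hu
        · obtain rfl : p = p' := Fin.ext (by have := p.isLt; have := p'.isLt; omega)
          have := h.symm.trans h'
          simp at this
          rw [this]
        · have := q.isLt; have := q'.isLt; omega
    · omega
    · omega
  · rintro ⟨rfl, hp, rfl, hq⟩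
    rw [Fin.ext hp, Fin.ext hq, h]

end Wiring

namespace DGraph
variable {S : Sig} {l k l' k' : ℕ}

/-- Two graphs with two vertices and the same edge agree up to renaming of the inputs and outputs,
if this edge has to be the only one. -/
theorem exists_iso_bdry_of_hasEdge {o₁ o₂ : S.Op} {p q : ℕ} (hu : S.out o₁ = 1 ∨ S.inp o₂ = 1)
    {H : DGraph S l k} {K : DGraph S l' k'} (hH : H.size = 2) (hK : K.size = 2)
    (h : H.graph.HasEdge o₁ p o₂ q) (h' : K.graph.HasEdge o₁ p o₂ q) :
    ∃ (α : Fin k ≃ Fin k') (β : Fin l' ≃ Fin l), H.graph.Iso (K.graph.bdry α β) := by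
  obtain ⟨v, p1, w, q1, rfl, rfl, rfl, rfl, h⟩ := h
  obtain ⟨v', p2, w', q2, hv, hp, hw, hq, h'⟩ := h'
  have key := Wiring.wire_iff_of_card_two hH.le H.acyclic h hu
  have key' := Wiring.wire_iff_of_card_two hK.le K.acyclic h' (by rwa [hv, hw])
  have hvw : v ≠ w := by
    rintro rfl
    obtain ⟨l, hl⟩ := H.acyclic
    exact lt_irrefl _ (hl _ _ _ _ h)
  have hvw' : v' ≠ w' := by
    rintro rfl
    obtain ⟨l, hl⟩ := K.acyclic
    exact lt_irrefl _ (hl _ _ _ _ h')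
  have hall : ∀ {n : ℕ} {v w : Fin n}, n = 2 → v ≠ w → ∀ x, x = v ∨ x = w := by
    intro n v w hn hvw x
    have h1 : v.val ≠ w.val := fun h => hvw (Fin.ext h)
    have := v.isLt
    have := w.isLt
    have := x.isLt
    rcases (by omega : x.val = v.val ∨ x.val = w.val) with h | h
    · exact .inl (Fin.ext h)
    · exact .inr (Fin.ext h)
  -- An arbitrary bijection is corrected by a transposition to send `v` to `v'`. With two vertices,
  -- `w` is then sent to `w'`.
  let e0 : Fin H.size ≃ Fin K.size := finCongr (hH.trans hK.symm)
  let e := e0.trans (Equiv.swap (e0 v) v')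
  have hev : e v = v' := by simp [e]
  have hew : e w = w' := by
    rcases hall hK hvw' (e w) with h | h
    · exact absurd (e.injective (hev.trans h.symm)) hvw
    · exact h
  have : Nonempty (Fin H.size) := ⟨v⟩
  have : Nonempty (Fin K.size) := ⟨v'⟩
  have he : ∀ x, H.graph.label x = K.graph.label (e x) := fun x => by
    rcases hall hH hvw x with rfl | rfl
    · rw [hev, hv]
    · rw [hew, hw]
  refine Wiring.exists_iso_bdry e he H.connected.wire_inl_ne K.connected.wire_inl_ne
    fun x p y q => ?_
  have hx : x = v ↔ e x = v' := by rw [← hev, e.apply_eq_iff_eq]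
  have hy : y = w ↔ e y = w' := by rw [← hew, e.apply_eq_iff_eq]
  rw [key, key', hx, hy, hp, hq]
  rfl

/-- The biarities of `H` and `K` are only equal by counting, so that `H = g • K` is not well typed.
It is expressed by transporting a property `C` of monomials of all biarities. -/
theorem eq_smul_of_iso_bdry {H : DGraph S l k} {K : DGraph S l' k'} (α : Fin k ≃ Fin k')
    (β : Fin l' ≃ Fin l) (h : H.graph.Iso (K.graph.bdry α β))
    {C : ∀ l k, Monomial S l k → Prop} (hC : ∀ g : BiPerm l' k', C l' k' (g • Monomial.mk K)) :
    C l k (Monomial.mk H) := by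
  obtain rfl : k = k' := by simpa using Fintype.card_congr α
  obtain rfl : l' = l := by simpa using Fintype.card_congr β
  have : Monomial.mk H = (β, MulOpposite.op α) • Monomial.mk K := Quotient.sound h
  rw [this]
  exact hC _

end DGraph

namespace Wiring
variable {S : Sig}

theorem connected_of_relabel {T V I O : Type} (f : T → S.Op) {G : Wiring (S.restrict f) V I O}
    (h : (G.relabel f).Connected) : G.Connected := by
  refine ⟨h.1, fun x y => eqvGen_map id ?_ (h.2 x y)⟩
  rintro _ _ (⟨v, p⟩ | ⟨s, v, p, hs⟩)
  · exact .rel _ _ (.leave (G := G) v p)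
  · exact .rel _ _ (.enter (G := G) s v p hs)

theorem Iso.exists_wire {V W I O : Type} {G : Wiring S V I O} {H : Wiring S W I O}
    (h : G.Iso H) : ∃ e : V ≃ W, (∀ v, G.label v = H.label (e v)) ∧
      ∀ v p w q v' w', G.wire (.inr ⟨v, p⟩) = .inr ⟨w, q⟩ → e v = v' → e w = w' →
        ∃ p' q', p'.val = p.val ∧ q'.val = q.val ∧ H.wire (.inr ⟨v', p'⟩) = .inr ⟨w', q'⟩ := by
  obtain ⟨e, he, h⟩ := h
  refine ⟨e, he, fun v p w q v' w' hw hv hw' => ?_⟩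
  subst hv hw'
  have := h (.inr ⟨v, p⟩)
  rw [hw] at this
  exact ⟨_, _, rfl, rfl, this⟩

theorem wire_of_bdry {V I O I' O' : Type} {G : Wiring S V I O} {e : I' ≃ I} {f : O ≃ O'} {u t}
    (h : (G.bdry e f).wire (.inr u) = .inr t) : G.wire (.inr u) = .inr t := by
  rcases hw : G.wire (.inr u) with o | t'
  · simp [hw] at h
  · simpa [hw] using h

end Wiring

/-! ### Contexts, and isolating an edge inside a graph -/

namespace Monomial
variable {S : Sig}

open Function in
/-- The contexts: functions that plug a monomial in one entry of a two-level composite. -/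
inductive IsCtx {m n : ℕ} : ∀ {l k : ℕ}, (Monomial S l k → Monomial S m n) → Prop
  | snd (s : Shape m n) (Q : ∀ y, Monomial S (s.l y) (s.k y))
      (P : ∀ x, Monomial S (s.j x) (s.i x)) (y : Fin s.b) :
      IsCtx (fun X => comp s (update Q y X) P)
  | fst (s : Shape m n) (Q : ∀ y, Monomial S (s.l y) (s.k y))
      (P : ∀ x, Monomial S (s.j x) (s.i x)) (x : Fin s.a) :
      IsCtx (fun X => comp s Q (update P x X))

open Function in
-- The permutations of the plugged entry are absorbed by the permutations of the shape, with the
-- identity on the other blocks.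
theorem IsCtx.comp_smul {m n l k : ℕ} {c : Monomial S l k → Monomial S m n} (hc : IsCtx c)
    (g : BiPerm l k) : IsCtx (fun X => c (g • X)) := by
  classical
  rcases hc with ⟨s, Q, P, y⟩ | ⟨s, Q, P, x⟩
  · have : (fun X => comp s (update Q y (g • X)) P) = fun X =>
        comp (s.absorbSnd (update (fun _ => 1) y g)) (update Q y X) P := by
      funext X
      rw [← comp_absorbSnd]
      congr 1
      funext z
      by_cases hz : z = y
      · subst hz; simp
      · simp [hz]
    rw [this]
    exact .snd (s.absorbSnd (update (fun _ => 1) y g)) Q P y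
  · have : (fun X => comp s Q (update P x (g • X))) = fun X =>
        comp (s.absorbFst (update (fun _ => 1) x g)) Q (update P x X) := by
      funext X
      rw [← comp_absorbFst]
      congr 1
      funext z
      by_cases hz : z = x
      · subst hz; simp
      · simp [hz]
    rw [this]
    exact .fst (s.absorbFst (update (fun _ => 1) x g)) Q P x

/-- In a graph with at most three vertices, an edge that has to be unique is contained in an entry
of weight two of a two-level composite. -/
theorem exists_ctx_of_hasEdge {m n : ℕ} (G : DGraph S m n) (hG : G.size ≤ 3) {o₁ o₂ : S.Op}
    {p q : ℕ} (h : G.graph.HasEdge o₁ p o₂ q) (hu : S.out o₁ = 1 ∨ S.inp o₂ = 1) :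
    ∃ (l k : ℕ) (H : DGraph S l k) (c : Monomial S l k → Monomial S m n), IsCtx c ∧
      H.size = 2 ∧ H.graph.HasEdge o₁ p o₂ q ∧ mk G = c (mk H) := by
  classical
  obtain ⟨v, p1, w, q1, rfl, rfl, rfl, rfl, h⟩ := h
  obtain ⟨l, hl⟩ := G.acyclic
  have hvw : l v < l w := hl _ _ _ _ h
  have hne : v ≠ w := by rintro rfl; exact lt_irrefl _ hvw
  -- The two ends of the edge are marked, and the mark is added to the labels, because `exists_comp`
  -- cuts along sets of labels. The map `f` forgets the mark.
  let b : Fin G.size → Bool := fun x => decide (x = v ∨ x = w)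
  let f : S.Op × Bool → S.Op := Prod.fst
  let G' : DGraph (S.restrict f) m n :=
    { size := G.size
      graph := { label := fun x => (G.graph.label x, b x), wire := G.graph.wire }
      connected := Wiring.connected_of_relabel (S := S) f G.connected
      acyclic := G.acyclic }
  have hGG' : mk G = relabel f (mk G') := rfl
  -- the entry that contains the edge
  have size2 : ∀ {N : ℕ} (g : Fin N → Fin G.size) (hg : Function.Injective g)
      (hb : ∀ x, b (g x) = true) (x y : Fin N), x ≠ y → N = 2 := by
    intro N g hg hb x y hxy
    apply le_antisymm
    · have h1 : Finset.univ.map ⟨g, hg⟩ ⊆ {v, w} := by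
        intro x hx
        simp only [Finset.mem_map, Finset.mem_univ, true_and, Function.Embedding.coeFn_mk] at hx
        obtain ⟨x, rfl⟩ := hx
        simpa [b] using hb x
      have h2 := Finset.card_le_card h1
      rw [Finset.card_map, Finset.card_univ, Fintype.card_fin, Finset.card_pair hne] at h2
      exact h2
    · have := x.isLt
      have := y.isLt
      have : x.val ≠ y.val := fun h => hxy (Fin.ext h)
      omega
  -- There is at most one further vertex. If it is fed by the edge, then the edge is put on the
  -- first level; otherwise it can be put on the second. In both cases the wire from `v` to `w`
  -- keeps its ends in one block.
  by_cases hex : ∃ x p u q, b x = true ∧ b u = false ∧ G.graph.wire (.inr ⟨x, p⟩) = .inr ⟨u, q⟩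
  · obtain ⟨x, p2, u, q2, hx, hu', hxu⟩ := hex
    have hx : x = v ∨ x = w := by simpa [b] using hx
    have hu' : u ≠ v ∧ u ≠ w := by simpa [b] using hu'
    have hall : ∀ z, z = v ∨ z = w ∨ z = u := by
      intro z
      have h1 : v.val ≠ w.val := fun h => hne (Fin.ext h)
      have h2 : u.val ≠ v.val := fun h => hu'.1 (Fin.ext h)
      have h3 : u.val ≠ w.val := fun h => hu'.2 (Fin.ext h)
      have := v.isLt
      have := w.isLt
      have := u.isLt
      have := z.isLt
      rcases (by omega : z.val = v.val ∨ z.val = w.val ∨ z.val = u.val) with h | h | h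
      · exact .inl (Fin.ext h)
      · exact .inr (.inl (Fin.ext h))
      · exact .inr (.inr (Fin.ext h))
    have hlu := hl _ _ _ _ hxu
    obtain ⟨s, Q, P, hQ, hP, hc, hiso⟩ := exists_comp G' (fun o => o.2 = true) (by
      intro z p3 y q3 hzy hy
      change b z = true
      have hzy : G.graph.wire (.inr ⟨z, p3⟩) = .inr ⟨y, q3⟩ := hzy
      have hy : b y = true := hy
      have hy : y = v ∨ y = w := by simpa [b] using hy
      have hly := hl _ _ _ _ hzy
      rcases hall z with hz | hz | hz
      · simp [b, hz]
      · simp [b, hz]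
      · exfalso
        subst z
        rcases hx with hx | hx <;> rcases hy with hy | hy <;> subst x <;> subst y
        · omega
        -- The path `v → u → w` is the only configuration not excluded by the levels. It would
        -- require a second output of `v` and a second input of `w`, contrary to `hu`.
        · rcases hu with hu | hu
          · obtain rfl : p1 = p2 := Fin.ext (by have := p1.isLt; have := p2.isLt; omega)
            have := h.symm.trans hxu
            simp at this
            exact hu'.2 this.1.symm
          · have h3 : q3.val < S.inp (G.graph.label w) := q3.isLt
            obtain rfl : q1 = q3 := Fin.ext (by have := q1.isLt; omega)
            have := G.graph.wire.injective (h.trans hzy.symm)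
            simp at this
            exact hu'.1 this.1.symm
        · omega
        · omega)
    obtain ⟨e, he, hw⟩ := hiso.exists_wire
    have hside : ∀ z, b z = true → ∃ x z', e z = .inl ⟨x, z'⟩ := by
      intro z hz
      rcases hez : e z with ⟨x, z'⟩ | ⟨y, z'⟩
      · exact ⟨x, z', rfl⟩
      · have := he z
        rw [hez] at this
        exact absurd (by rw [← show _ = (Q y).graph.label z' from this]; exact hz) (hQ y z')
    obtain ⟨x, v', hv'⟩ := hside v (by simp [b])
    obtain ⟨x', w', hw'⟩ := hside w (by simp [b])
    obtain ⟨p', q', hp', hq', hwire⟩ := hw v p1 w q1 _ _ h hv' hw'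
    obtain ⟨w'', q'', ht, hwire'⟩ := Wiring.twoLevel_wire_inl (Wiring.wire_of_bdry hwire) rfl
    simp at ht
    obtain ⟨⟨rfl, ht⟩, hq3⟩ := ht
    obtain rfl := eq_of_heq ht
    obtain rfl := eq_of_heq hq3
    have hlv := he v
    have hlw := he w
    rw [hv'] at hlv
    rw [hw'] at hlw
    refine ⟨_, _, ⟨(P x').size, (P x').graph.relabel f, Wiring.relabel_connected f (P x').connected,
      (P x').acyclic⟩, _, .fst s (fun y => relabel f (mk (Q y))) (fun x => relabel f (mk (P x))) x',
      ?_, ⟨v', p', w', q', ?_, hp', ?_, hq', hwire'⟩, ?_⟩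
    · refine size2 (fun z => e.symm (.inl ⟨x', z⟩)) (fun z z' hz => by simpa using hz)
        (fun z => ?_) v' w' ?_
      · have := he (e.symm (.inl ⟨x', z⟩))
        rw [e.apply_symm_apply] at this
        exact (congrArg Prod.snd this).trans (hP x' z)
      · rintro rfl
        exact hne (e.injective (hv'.trans hw'.symm))
    · exact congrArg Prod.fst hlv.symm
    · exact congrArg Prod.fst hlw.symm
    · rw [hGG', hc, relabel_comp]
      congr 1
      exact (Function.update_eq_self _ _).symm
  -- No wire leaves the pair, so the unmarked vertices are closed under predecessors.
  · obtain ⟨s, Q, P, hQ, hP, hc, hiso⟩ := exists_comp G' (fun o => o.2 = false) (by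
      intro z p3 y q3 hzy hy
      by_contra hz
      exact hex ⟨z, p3, y, q3, by simpa using hz, hy, hzy⟩)
    obtain ⟨e, he, hw⟩ := hiso.exists_wire
    have hside : ∀ z, b z = true → ∃ x z', e z = .inr ⟨x, z'⟩ := by
      intro z hz
      rcases hez : e z with ⟨x, z'⟩ | ⟨y, z'⟩
      · have := he z
        rw [hez] at this
        have h1 : b z = false := (congrArg Prod.snd this).trans (hP x z')
        rw [hz] at h1
        exact absurd h1 (by simp)
      · exact ⟨y, z', rfl⟩
    obtain ⟨x, v', hv'⟩ := hside v (by simp [b])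
    obtain ⟨x', w', hw'⟩ := hside w (by simp [b])
    obtain ⟨p', q', hp', hq', hwire⟩ := hw v p1 w q1 _ _ h hv' hw'
    obtain ⟨w'', q'', ht, hwire'⟩ := Wiring.twoLevel_wire_inr (Wiring.wire_of_bdry hwire)
    simp at ht
    obtain ⟨⟨rfl, ht⟩, hq3⟩ := ht
    obtain rfl := eq_of_heq ht
    obtain rfl := eq_of_heq hq3
    have hlv := he v
    have hlw := he w
    rw [hv'] at hlv
    rw [hw'] at hlw
    refine ⟨_, _, ⟨(Q x').size, (Q x').graph.relabel f, Wiring.relabel_connected f (Q x').connected,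
      (Q x').acyclic⟩, _, .snd s (fun y => relabel f (mk (Q y))) (fun x => relabel f (mk (P x))) x',
      ?_, ⟨v', p', w', q', ?_, hp', ?_, hq', hwire'⟩, ?_⟩
    · refine size2 (fun z => e.symm (.inr ⟨x', z⟩)) (fun z z' hz => by simpa using hz)
        (fun z => ?_) v' w' ?_
      · have := he (e.symm (.inr ⟨x', z⟩))
        rw [e.apply_symm_apply] at this
        refine (congrArg Prod.snd this).trans ?_
        exact Bool.eq_true_of_not_eq_false (hQ x' z)
      · rintro rfl
        exact hne (e.injective (hv'.trans hw'.symm))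
    · exact congrArg Prod.fst hlv.symm
    · exact congrArg Prod.fst hlw.symm
    · rw [hGG', hc, relabel_comp]
      congr 1
      exact (Function.update_eq_self _ _).symm

end Monomial

/-! ### Chains, and graphs whose internal wires use fixed ports -/

/-- A finite connected acyclic relation in which every element has at most one successor and at most
one predecessor is a chain. -/
theorem exists_equiv_fin_of_chain {V : Type} [Fintype V] {N : V → V → Prop}
    (hr : ∀ u v w, N u v → N u w → v = w) (hl : ∀ u v w, N u w → N v w → u = v)
    (hc : ∀ u v, Relation.EqvGen N u v) (level : V → ℕ) (hlev : ∀ u v, N u v → level u < level v) :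
    ∃ e : V ≃ Fin (Fintype.card V), ∀ u v, N u v ↔ (e v).val = (e u).val + 1 := by
  classical
  -- Along a connecting path, two elements with a common ancestor are comparable by uniqueness of
  -- successors, and two with a common descendant by uniqueness of predecessors.
  have htot : ∀ u v, Relation.ReflTransGen N u v ∨ Relation.ReflTransGen N v u := by
    intro u v
    induction hc u v with
    | rel _ _ h => exact .inl (.single h)
    | refl => exact .inl .refl
    | symm _ _ _ ih => exact ih.symm
    | trans x y z _ _ ih ih' =>
      rcases ih with h | h <;> rcases ih' with h' | h'
      · exact .inl (h.trans h')
      · have : ∀ a b, Relation.ReflTransGen N a y → Relation.ReflTransGen N b y →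
            Relation.ReflTransGen N a b ∨ Relation.ReflTransGen N b a := by
          intro a b ha hb
          have := Relation.ReflTransGen.total_of_right_unique (r := Function.swap N)
            (fun a b c h h' => hl _ _ _ h h') (Relation.reflTransGen_swap.2 ha)
            (Relation.reflTransGen_swap.2 hb)
          rcases this with h | h
          · exact .inr (Relation.reflTransGen_swap.1 h)
          · exact .inl (Relation.reflTransGen_swap.1 h)
        exact this _ _ h h'
      · exact Relation.ReflTransGen.total_of_right_unique (fun a b c h h' => hr _ _ _ h h') h h'
      · exact .inr (h'.trans h)
  have hle : ∀ u v, Relation.ReflTransGen N u v → level u ≤ level v := by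
    intro u v h
    induction h with
    | refl => exact le_rfl
    | tail _ h ih => exact ih.trans (hlev _ _ h).le
  let _ : LinearOrder V :=
    { le := Relation.ReflTransGen N
      le_refl := fun _ => .refl
      le_trans := fun _ _ _ h h' => h.trans h'
      le_antisymm := fun u v h h' => by
        rcases h.cases_head with h1 | ⟨w, h1, h2⟩
        · exact h1
        · have := hlev _ _ h1
          have := hle _ _ (h2.trans h')
          omega
      le_total := htot
      toDecidableLE := Classical.decRel _ }
  have hlt : ∀ u v, u < v → ∃ w, N u w ∧ w ≤ v := by
    intro u v h
    rcases Relation.ReflTransGen.cases_head (show Relation.ReflTransGen N u v from h.le) with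
      h1 | ⟨w, h1, h2⟩
    · exact absurd h1 h.ne
    · exact ⟨w, h1, h2⟩
  have hN : ∀ u v, N u v → u < v := fun u v h =>
    lt_of_le_of_ne (.single h) (by rintro rfl; exact lt_irrefl _ (hlev _ _ h))
  let e := (Fintype.orderIsoFinOfCardEq V rfl).symm
  refine ⟨e.toEquiv, fun u v => ⟨fun h => ?_, fun h => ?_⟩⟩
  · have h1 : (e u).val < (e v).val := e.strictMono (hN _ _ h)
    by_contra hne
    change ¬ (e v).val = (e u).val + 1 at hne
    -- The place just after `u`. The successor of `u` on the way to it is `v` by uniqueness, so that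
    -- `v` cannot be further away.
    let x : Fin (Fintype.card V) := ⟨(e u).val + 1, by have := (e v).isLt; omega⟩
    have h2 : u < e.symm x := by
      rw [← e.lt_iff_lt, e.apply_symm_apply, Fin.lt_def]
      exact Nat.lt_succ_self _
    obtain ⟨w, hw, hwx⟩ := hlt _ _ h2
    obtain rfl := hr _ _ _ h hw
    rw [← e.le_iff_le, e.apply_symm_apply, Fin.le_def] at hwx
    have : x.val = (e u).val + 1 := rfl
    omega
  · change (e v).val = (e u).val + 1 at h
    have h1 : u < v := by
      rw [← e.lt_iff_lt, Fin.lt_def]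
      omega
    obtain ⟨w, hw, hwv⟩ := hlt _ _ h1
    have h2 := hN _ _ hw
    rw [← e.lt_iff_lt, Fin.lt_def] at h2
    have h3 := e.le_iff_le.2 hwv
    rw [Fin.le_def] at h3
    obtain rfl : w = v := e.injective (Fin.ext (by omega))
    exact hw

namespace Wiring
variable {S : Sig}

theorem Connected.eqvGen_internal {V I O : Type} {G : Wiring S V I O} (hG : G.Connected) (v w : V) :
    Relation.EqvGen (fun v w => ∃ p q, G.wire (.inr ⟨v, p⟩) = .inr ⟨w, q⟩) v w := by
  -- A wire is contracted to the vertex where it starts, and an input wire to the vertex that it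
  -- enters. An input wired to an output is incident to no vertex, and the value `v` taken there is
  -- arbitrary.
  let f : V ⊕ (I ⊕ (Σ v, Fin (S.out (G.label v)))) → V := Sum.elim id (Sum.elim
    (fun i => Sum.elim (fun _ => v) Sigma.fst (G.wire (.inl i))) Sigma.fst)
  refine eqvGen_map (y := .inl w) (x := .inl v) f ?_ (hG.2 _ _)
  rintro _ _ (⟨v, p⟩ | ⟨s | ⟨u, p⟩, v, q, hs⟩)
  · exact .refl _
  · simp [f, hs]
    exact .refl _
  · exact .rel _ _ ⟨p, q, hs⟩

end Wiring

namespace DGraph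
variable {S : Sig} {l k l' k' : ℕ}

/-- Each vertex has at most one output `p₀` and one input `q₀`, hence at most one successor and one
predecessor, and the graph is a chain. Its numbering along the chain determines all the internal
wires. -/
theorem exists_equiv_of_ports [Subsingleton S.Op] {p₀ q₀ : ℕ} (G : DGraph S l k)
    (hG : ∀ v p w q, G.graph.wire (.inr ⟨v, p⟩) = .inr ⟨w, q⟩ → p.val = p₀ ∧ q.val = q₀) :
    ∃ e : Fin G.size ≃ Fin G.size, ∀ v p w q, G.graph.wire (.inr ⟨v, p⟩) = .inr ⟨w, q⟩ ↔
      (p.val = p₀ ∧ q.val = q₀ ∧ (e w).val = (e v).val + 1) := by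
  obtain ⟨level, hl⟩ := G.acyclic
  obtain ⟨e, he⟩ := exists_equiv_fin_of_chain
    (N := fun v w => ∃ p q, G.graph.wire (.inr ⟨v, p⟩) = .inr ⟨w, q⟩) (by
      rintro u v w ⟨p, q, h⟩ ⟨p', q', h'⟩
      obtain rfl : p = p' := Fin.ext ((hG _ _ _ _ h).1.trans (hG _ _ _ _ h').1.symm)
      have := h.symm.trans h'
      simp at this
      exact this.1) (by
      rintro u v w ⟨p, q, h⟩ ⟨p', q', h'⟩
      obtain rfl : q = q' := Fin.ext ((hG _ _ _ _ h).2.trans (hG _ _ _ _ h').2.symm)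
      have := G.graph.wire.injective (h.trans h'.symm)
      simp at this
      exact this.1) G.connected.eqvGen_internal level (by
      rintro u v ⟨p, q, h⟩
      exact hl _ _ _ _ h)
  refine ⟨e.trans (finCongr (by simp)), fun v p w q => ⟨fun h => ?_, ?_⟩⟩
  · exact ⟨(hG _ _ _ _ h).1, (hG _ _ _ _ h).2, (he v w).1 ⟨p, q, h⟩⟩
  · rintro ⟨hp, hq, h⟩
    obtain ⟨p', q', h'⟩ := (he v w).2 h
    have := hG _ _ _ _ h'
    obtain rfl : p = p' := Fin.ext (hp.trans this.1.symm)
    obtain rfl : q = q' := Fin.ext (hq.trans this.2.symm)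
    exact h'

/-- A connected graph without vertices is a single wire. -/
theorem exists_iso_bdry_of_size_zero {G : DGraph S l k} {H : DGraph S l' k'} (hG : G.size = 0)
    (hH : H.size = 0) : ∃ (α : Fin k ≃ Fin k') (β : Fin l' ≃ Fin l),
      G.graph.Iso (H.graph.bdry α β) := by
  have key : ∀ {l k : ℕ} (G : DGraph S l k), G.size = 0 → k = 1 ∧ l = 1 := by
    intro l k G hG
    have : IsEmpty (Fin G.size) := by rw [hG]; infer_instance
    obtain ⟨⟨x⟩, h⟩ := G.connected
    have hs : ∀ x y, x = y := fun x y => by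
      induction h x y with
      | rel x y h =>
        rcases h with ⟨v, p⟩ | ⟨s, v, p, hs⟩
        · exact (IsEmpty.false v).elim
        · exact (IsEmpty.false v).elim
      | refl => rfl
      | symm _ _ _ ih => exact ih.symm
      | trans _ _ _ _ _ ih ih' => exact ih.trans ih'
    have hk : k = 1 := by
      rcases x with v | x | u
      · exact isEmptyElim v
      · refine (Fintype.card_fin k).symm.trans (Fintype.card_eq_one_iff.2 ⟨x, fun y => ?_⟩)
        simpa using hs (.inr (.inl y)) (.inr (.inl x))
      · exact isEmptyElim u.1
    have e := (Equiv.sumEmpty (Fin k) (Σ v, Fin (S.out (G.graph.label v)))).symm.trans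
      (G.graph.wire.trans (Equiv.sumEmpty _ _))
    have := Fintype.card_congr e
    simp at this
    omega
  obtain ⟨rfl, rfl⟩ := key G hG
  obtain ⟨rfl, rfl⟩ := key H hH
  have : IsEmpty (Fin G.size) := by rw [hG]; infer_instance
  refine ⟨Equiv.refl _, Equiv.refl _, finCongr (hG.trans hH.symm), fun v => isEmptyElim v, ?_⟩
  rintro (i | u)
  · have : IsEmpty (Fin H.size) := by rw [hH]; infer_instance
    rcases h : G.graph.wire (.inl i) with o | u
    · rcases h' : H.graph.wire (.inl i) with o' | u
      · simp [h']
        exact Subsingleton.elim _ _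
      · exact isEmptyElim u.1
    · exact isEmptyElim u.1
  · exact isEmptyElim u.1

/-- Over a single operation, two graphs of the same weight, in which internal wires only use
one given output and one given input, agree up to renaming of the inputs and outputs. -/
theorem exists_iso_bdry_of_ports [Subsingleton S.Op] {p₀ q₀ : ℕ} {G : DGraph S l k}
    {H : DGraph S l' k'} (hs : G.size = H.size)
    (hG : ∀ v p w q, G.graph.wire (.inr ⟨v, p⟩) = .inr ⟨w, q⟩ → p.val = p₀ ∧ q.val = q₀)
    (hH : ∀ v p w q, H.graph.wire (.inr ⟨v, p⟩) = .inr ⟨w, q⟩ → p.val = p₀ ∧ q.val = q₀) :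
    ∃ (α : Fin k ≃ Fin k') (β : Fin l' ≃ Fin l), G.graph.Iso (H.graph.bdry α β) := by
  by_cases h0 : G.size = 0
  · exact exists_iso_bdry_of_size_zero h0 (hs.symm.trans h0)
  have : Nonempty (Fin G.size) := ⟨⟨0, by omega⟩⟩
  have : Nonempty (Fin H.size) := ⟨⟨0, by omega⟩⟩
  obtain ⟨e, he⟩ := G.exists_equiv_of_ports hG
  obtain ⟨f, hf⟩ := H.exists_equiv_of_ports hH
  refine Wiring.exists_iso_bdry ((e.trans (finCongr hs)).trans f.symm)
    (fun v => Subsingleton.elim _ _) G.connected.wire_inl_ne H.connected.wire_inl_ne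
    fun v p w q => ?_
  rw [he, hf]
  simp only [Equiv.trans_apply, Equiv.apply_symm_apply, finCongr_apply, Fin.val_cast]
  exact Iff.rfl

end DGraph

/-! ### Combs -/

/-- The starting points of the wires of the right comb with `w` vertices. -/
def combStart (w : ℕ) : Fin (w + 1) ⊕ (Σ _ : Fin w, Fin 1) → Fin w ⊕ Fin (w + 1) :=
  -- Names of the wires: `inl t` is the input wire number `t < w`, which enters the left of the
  -- vertex `t`; `inr t` leaves the vertex `t` for `t < w`; `inr w` is the last input wire. The root
  -- is the vertex `0`, and `inr (t + 1)` enters the right of the vertex `t`.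
  Sum.elim (Fin.lastCases (.inr (Fin.last w)) .inl) (fun u => .inr u.1.castSucc)

/-- The end points of the wires of the right comb with `w` vertices. -/
def combEnd (w : ℕ) : Fin 1 ⊕ (Σ _ : Fin w, Fin 2) → Fin w ⊕ Fin (w + 1) :=
  Sum.elim (fun _ => .inr 0) (fun u => ![.inl u.1, .inr u.1.succ] u.2)

theorem combStart_bijective (w : ℕ) : Function.Bijective (combStart w) := by
      constructor
      · rintro (i | ⟨v, p⟩) (i' | ⟨v', p'⟩) h
        · cases i using Fin.lastCases <;> cases i' using Fin.lastCases <;> simp_all [combStart]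
        · cases i using Fin.lastCases with
          | last =>
            simp [combStart] at h
            exact absurd h (Fin.castSucc_lt_last v').ne'
          | cast i => simp [combStart] at h
        · cases i' using Fin.lastCases with
          | last =>
            simp [combStart] at h
          | cast i => simp [combStart] at h
        · simp [combStart] at h
          subst h
          rw [Subsingleton.elim p p']
      · rintro (i | i)
        · exact ⟨.inl i.castSucc, by simp [combStart]⟩
        · cases i using Fin.lastCases with
          | last => exact ⟨.inl (Fin.last w), by simp [combStart]⟩
          | cast i => exact ⟨.inr ⟨i, (0 : Fin 1)⟩, rfl⟩

theorem combEnd_bijective (w : ℕ) : Function.Bijective (combEnd w) := by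
      have h2 : ∀ p : Fin 2, p = 0 ∨ p = 1 := by decide
      constructor
      · rintro (i | ⟨v, p⟩) (i' | ⟨v', p'⟩) h
        · exact congrArg _ (Subsingleton.elim _ _)
        · rcases h2 p' with rfl | rfl
          · simp [combEnd] at h
          · exact absurd (Sum.inr_injective h) (Fin.succ_ne_zero _).symm
        · rcases h2 p with rfl | rfl
          · simp [combEnd] at h
          · exact absurd (Sum.inr_injective h) (Fin.succ_ne_zero _)
        · rcases h2 p with rfl | rfl <;> rcases h2 p' with rfl | rfl <;> simp [combEnd] at h <;> rw [h]
      · rintro (i | i)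
        · exact ⟨.inr ⟨i, (0 : Fin 2)⟩, rfl⟩
        · cases i using Fin.cases with
          | zero => exact ⟨.inl 0, rfl⟩
          | succ i => exact ⟨.inr ⟨i, (1 : Fin 2)⟩, rfl⟩

/-- The right comb with `w` vertices; its inputs are numbered from left to right. -/
noncomputable def combWiring (w : ℕ) : Wiring mulSig (Fin w) (Fin (w + 1)) (Fin 1) :=
  .ofEnds (fun _ => ()) (combStart w) (combEnd w) (combStart_bijective w) (combEnd_bijective w)

theorem combWiring_wire {w : ℕ} {s t} :
    (combWiring w).wire s = t ↔ combStart w s = combEnd w t :=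
  Wiring.ofEnds_wire

theorem combWiring_castSucc {w : ℕ} (i : Fin w) :
    (combWiring w).wire (.inl i.castSucc) = .inr ⟨i, (0 : Fin 2)⟩ :=
  combWiring_wire.2 (by simp [combStart, combEnd])

theorem combWiring_zero {w : ℕ} (p) :
    (combWiring (w + 1)).wire (.inr ⟨0, p⟩) = .inl 0 :=
  combWiring_wire.2 rfl

theorem combWiring_succ {w : ℕ} (i : Fin w) (p) :
    (combWiring (w + 1)).wire (.inr ⟨i.succ, p⟩) = .inr ⟨i.castSucc, (1 : Fin 2)⟩ :=
  combWiring_wire.2 rfl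

theorem combWiring_last_succ (w : ℕ) :
    (combWiring (w + 1)).wire (.inl (Fin.last (w + 1))) = .inr ⟨Fin.last w, (1 : Fin 2)⟩ :=
  combWiring_wire.2 (by simp [combStart, combEnd])

theorem combWiring_connected (w : ℕ) : (combWiring w).Connected := by
  refine ⟨⟨.inr (.inl 0)⟩, ?_⟩
  rcases w with _ | w
  · have : ∀ x : Fin 0 ⊕ (Fin 1 ⊕ (Σ v, Fin (mulSig.out ((combWiring 0).label v)))),
        x = .inr (.inl 0) := by
      rintro (v | i | u)
      · exact v.elim0
      · exact congrArg _ (congrArg _ (Subsingleton.elim (α := Fin 1) _ _))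
      · exact u.1.elim0
    intro x y
    rw [this x, this y]
    exact .refl _
  · have h0 : ∀ v : Fin (w + 1), Relation.EqvGen (combWiring (w + 1)).Adj (.inl v) (.inl 0) := by
      intro v
      induction v using Fin.induction with
      | zero => exact .refl _
      | succ i ih =>
        refine .trans _ _ _ (.rel _ _ (.leave (G := combWiring (w + 1)) i.succ (0 : Fin 1))) ?_
        exact .trans _ _ _ (.rel _ _ (.enter _ _ _ (combWiring_succ i (0 : Fin 1)))) ih
    have key : ∀ x, Relation.EqvGen (combWiring (w + 1)).Adj x (.inl 0) := by
      rintro (v | i | ⟨v, p⟩)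
      · exact h0 v
      · cases i using Fin.lastCases with
        | last => exact .trans _ _ _ (.rel _ _ (.enter _ _ _ (combWiring_last_succ w))) (h0 _)
        | cast i => exact .trans _ _ _ (.rel _ _ (.enter _ _ _ (combWiring_castSucc i))) (h0 _)
      · exact .trans _ _ _ (.symm _ _ (.rel _ _ (.leave (G := combWiring (w + 1)) v p))) (h0 v)
    exact fun x y => .trans _ _ _ (key x) (.symm _ _ (key y))

theorem combWiring_internal {w : ℕ} {v p v' q}
    (h : (combWiring w).wire (.inr ⟨v, p⟩) = .inr ⟨v', q⟩) : v.val = v'.val + 1 ∧ q.val = 1 := by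
  rcases w with _ | w
  · exact v.elim0
  · cases v using Fin.cases with
    | zero =>
      rw [combWiring_zero] at h
      simp at h
    | succ i =>
      rw [combWiring_succ] at h
      simp at h
      obtain ⟨rfl, h⟩ := h
      subst h
      exact ⟨rfl, rfl⟩

theorem combWiring_acyclic (w : ℕ) : (combWiring w).Acyclic :=
  -- The internal wires lead from the vertex `t + 1` to the vertex `t`, so the levels are reversed.
  ⟨fun v => w - v.val, fun v p v' q h => by
    have := (combWiring_internal h).1
    have := v.isLt
    show w - v.val < w - v'.val
    omega⟩

/-- The right comb, as a graph. -/
noncomputable abbrev combGraph (w : ℕ) : DGraph mulSig 1 (w + 1) :=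
  ⟨w, combWiring w, combWiring_connected w, combWiring_acyclic w⟩

namespace Wiring

/-- The graph upside down. -/
def flip {V I O : Type} (G : Wiring mulSig V I O) : Wiring comulSig V O I where
  label _ := ()
  wire := G.wire.symm

theorem flip_wire {V I O : Type} {G : Wiring mulSig V I O} {s t} :
    G.flip.wire s = t ↔ G.wire t = s :=
  (Equiv.symm_apply_eq G.wire).trans eq_comm

theorem flip_connected {V I O : Type} {G : Wiring mulSig V I O} (h : G.Connected) :
    G.flip.Connected := by
  let f : V ⊕ (I ⊕ (Σ v, Fin (mulSig.out (G.label v)))) →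
    V ⊕ (O ⊕ (Σ v, Fin (comulSig.out (G.flip.label v)))) := Sum.map id G.wire
  have hf : Function.Surjective f :=
    Function.Surjective.sumMap (fun x => ⟨x, rfl⟩) G.wire.surjective
  obtain ⟨⟨x0⟩, h⟩ := h
  refine ⟨⟨f x0⟩, fun x y => ?_⟩
  obtain ⟨x, rfl⟩ := hf x
  obtain ⟨y, rfl⟩ := hf y
  refine eqvGen_map f ?_ (h x y)
  rintro _ _ (⟨v, p⟩ | ⟨s, v, p, hs⟩)
  · exact .symm _ _ (.rel _ _ (.enter (G := G.flip) _ v p (G.wire.symm_apply_apply _)))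
  · have : f (.inr s) = .inr (.inr ⟨v, p⟩) := congrArg Sum.inr hs
    rw [this]
    exact .symm _ _ (.rel _ _ (.leave (G := G.flip) v p))

theorem flip_acyclic {V I O : Type} [Finite V] {G : Wiring mulSig V I O} (h : G.Acyclic) :
    G.flip.Acyclic := by
  obtain ⟨l, hl⟩ := h
  obtain ⟨B, hB⟩ := (Set.finite_range l).bddAbove
  have hB : ∀ v, l v ≤ B := fun v => hB ⟨v, rfl⟩
  refine ⟨fun v => B - l v, fun v p w q hvw => ?_⟩
  have h1 := hl _ _ _ _ (flip_wire.1 hvw)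
  have h2 := hB v
  show B - l v < B - l w
  omega

theorem sat_flip {X : Type} (R : comulSig.Model X) {V I O : Type} {G : Wiring mulSig V I O}
    {x : O → X} {y : I → X} :
    G.flip.Sat R x y ↔ G.Sat (fun _ a b => R () b a) y x := by
  constructor
  · rintro ⟨ν, κ, h, hv⟩
    refine ⟨κ, ν, fun s => ?_, hv⟩
    have := h (G.wire s)
    rw [flip_wire.2 rfl] at this
    exact this.symm
  · rintro ⟨ν, κ, h, hv⟩
    refine ⟨κ, ν, fun s => ?_, hv⟩
    obtain ⟨s, rfl⟩ := G.wire.surjective s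
    rw [flip_wire.2 rfl]
    exact (h s).symm

theorem sat_ofEnds {S : Sig} {X : Type} (R : S.Model X) {V I O E : Type} {label : V → S.Op}
    {st : I ⊕ (Σ v, Fin (S.out (label v))) → E} {en : O ⊕ (Σ v, Fin (S.inp (label v))) → E}
    {hst : Function.Bijective st} {hen : Function.Bijective en} {x : I → X} {y : O → X} :
    (ofEnds label st en hst hen).Sat R x y ↔ ∃ ν : E → X, (∀ i, x i = ν (st (.inl i))) ∧
      (∀ o, y o = ν (en (.inl o))) ∧
        ∀ v, R (label v) (fun q => ν (en (.inr ⟨v, q⟩))) (fun p => ν (st (.inr ⟨v, p⟩))) := by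
  constructor
  · rintro ⟨ν, κ, h, hv⟩
    let e := Equiv.ofBijective st hst
    have hs : ∀ s, Sum.elim x ν s = Sum.elim x ν (e.symm (st s)) := fun s => by
      rw [show e.symm (st s) = s from e.symm_apply_apply s]
    have hn : ∀ t, Sum.elim y κ t = Sum.elim x ν (e.symm (en t)) := fun t => by
      obtain ⟨s, rfl⟩ := (ofEnds label st en hst hen).wire.surjective t
      rw [h s, hs s, (ofEnds_wire (hst := hst) (hen := hen)).1 rfl]
    refine ⟨fun u => Sum.elim x ν (e.symm u), fun i => hs (.inl i), fun o => hn (.inl o),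
      fun v => ?_⟩
    have h1 := hv v
    have h2 : (fun q => κ ⟨v, q⟩) = fun q => Sum.elim x ν (e.symm (en (.inr ⟨v, q⟩))) :=
      funext fun q => hn (.inr ⟨v, q⟩)
    have h3 : (fun p => ν ⟨v, p⟩) = fun p => Sum.elim x ν (e.symm (st (.inr ⟨v, p⟩))) :=
      funext fun p => hs (.inr ⟨v, p⟩)
    rw [h2, h3] at h1
    exact h1
  · rintro ⟨ν, hx, hy, hv⟩
    refine ⟨fun u => ν (st (.inr u)), fun u => ν (en (.inr u)), fun s => ?_, hv⟩
    have h1 : st s = en _ := (ofEnds_wire (hst := hst) (hen := hen)).1 rfl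
    have hs : Sum.elim x (fun u => ν (st (.inr u))) s = ν (st s) := by
      rcases s with i | u
      · exact hx i
      · rfl
    have hn : ∀ t, Sum.elim y (fun u => ν (en (.inr u))) t = ν (en t) := by
      rintro (i | u)
      · exact hy i
      · rfl
    exact (hn _).trans ((congrArg ν h1).symm.trans hs.symm)

/-- The values at the vertices of the comb form a chain `c`. -/
theorem sat_combWiring {X : Type} (R : mulSig.Model X) {w : ℕ} {x : Fin (w + 1) → X}
    {y : Fin 1 → X} : (combWiring w).Sat R x y ↔ ∃ c : Fin (w + 1) → X, c 0 = y 0 ∧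
      c (Fin.last w) = x (Fin.last w) ∧
        ∀ t : Fin w, R () ![x t.castSucc, c t.succ] ![c t.castSucc] := by
  have h2 : ∀ p : Fin 2, p = 0 ∨ p = 1 := by decide
  refine (sat_ofEnds R).trans ⟨?_, ?_⟩
  · rintro ⟨ν, hx, hy, hv⟩
    refine ⟨fun t => ν (.inr t), (hy 0).symm, ?_, fun t => ?_⟩
    · rw [hx]
      simp [combStart]
    · have h1 := hv t
      convert h1 using 1
      · funext p
        rcases h2 p with rfl | rfl
        · rw [hx]
          simp [combStart, combEnd]
        · rfl
      · funext p
        obtain rfl : p = 0 := Subsingleton.elim (α := Fin 1) _ _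
        rfl
  · rintro ⟨c, h0, hl, hv⟩
    refine ⟨Sum.elim (fun t => x t.castSucc) c, fun i => ?_, fun o => ?_, fun t => ?_⟩
    · cases i using Fin.lastCases with
      | last => simp [combStart, hl]
      | cast i => simp [combStart]
    · rw [Subsingleton.elim o 0]
      exact h0.symm
    · have h1 := hv t
      convert h1 using 1
      · funext p
        rcases h2 p with rfl | rfl <;> rfl
      · funext p
        obtain rfl : p = 0 := Subsingleton.elim (α := Fin 1) _ _
        rfl

end Wiring

namespace Monomial

/-- The right comb with `w` vertices. -/
noncomputable def comb (w : ℕ) : Monomial mulSig 1 (w + 1) :=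
  mk ⟨w, combWiring w, combWiring_connected w, combWiring_acyclic w⟩

/-- The right comb of coproducts with `w` vertices. -/
noncomputable def cocomb (w : ℕ) : Monomial comulSig (w + 1) 1 :=
  mk ⟨w, (combWiring w).flip, Wiring.flip_connected (combWiring_connected w),
    Wiring.flip_acyclic (combWiring_acyclic w)⟩

theorem size_comb (w : ℕ) : (comb w).size = w := rfl

theorem size_cocomb (w : ℕ) : (cocomb w).size = w := rfl

/-- The monomials that are right combs, up to the numbering of their inputs. -/
def IsComb {m n : ℕ} (q : Monomial mulSig m n) : Prop :=
  ∃ (w : ℕ) (hm : 1 = m) (hn : w + 1 = n) (g : BiPerm m n), q = g • (hm ▸ hn ▸ comb w)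

/-- The monomials that are right combs of coproducts, up to the numbering of their outputs. -/
def IsCocomb {m n : ℕ} (q : Monomial comulSig m n) : Prop :=
  ∃ (w : ℕ) (hm : w + 1 = m) (hn : 1 = n) (g : BiPerm m n), q = g • (hm ▸ hn ▸ cocomb w)

/-- A product has a single output, so an internal wire is determined in type by the input that it
enters. Without left edges all internal wires enter right inputs, and such graphs are determined by
their weight up to renaming. -/
theorem isComb_of_not_hasEdge {m n : ℕ} {G : DGraph mulSig m n}
    (h : ¬ G.graph.HasEdge () 0 () 0) : IsComb (mk G) := by
  obtain ⟨α, β, hi⟩ := DGraph.exists_iso_bdry_of_ports (p₀ := 0) (q₀ := 1) (G := G)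
    (H := combGraph G.size) rfl (fun v p w q hw => by
      have hp : p.val = 0 := by have := p.isLt; exact Nat.lt_one_iff.1 this
      refine ⟨hp, ?_⟩
      have hq : q.val < 2 := q.isLt
      have : q.val ≠ 0 := fun h0 => h ⟨v, p, w, q, rfl, hp, rfl, h0, hw⟩
      omega) (fun v p w q hw => by
      have hp : p.val = 0 := by have := p.isLt; exact Nat.lt_one_iff.1 this
      exact ⟨hp, (combWiring_internal hw).2⟩)
  exact DGraph.eq_smul_of_iso_bdry α β hi (C := fun _ _ q => IsComb q)
    fun g => ⟨G.size, rfl, rfl, g, rfl⟩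

/-- Dual to `isComb_of_not_hasEdge`: without left edges all internal wires leave right outputs of
coproducts. -/
theorem isCocomb_of_not_hasEdge {m n : ℕ} {G : DGraph comulSig m n}
    (h : ¬ G.graph.HasEdge () 0 () 0) : IsCocomb (mk G) := by
  obtain ⟨α, β, hi⟩ := DGraph.exists_iso_bdry_of_ports (p₀ := 1) (q₀ := 0) (G := G)
    (H := ⟨G.size, (combWiring G.size).flip, Wiring.flip_connected (combWiring_connected _),
    Wiring.flip_acyclic (combWiring_acyclic _)⟩) rfl (fun v p w q hw => by
      have hq : q.val = 0 := by have := q.isLt; exact Nat.lt_one_iff.1 this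
      refine ⟨?_, hq⟩
      have hp : p.val < 2 := p.isLt
      have : p.val ≠ 0 := fun h0 => h ⟨v, p, w, q, rfl, h0, rfl, hq, hw⟩
      omega) (fun v p w q hw => by
      have hq : q.val = 0 := by have := q.isLt; exact Nat.lt_one_iff.1 this
      exact ⟨(combWiring_internal (Wiring.flip_wire.1 hw)).2, hq⟩)
  exact DGraph.eq_smul_of_iso_bdry α β hi (C := fun _ _ q => IsCocomb q)
    fun g => ⟨G.size, rfl, rfl, g, rfl⟩

end Monomial

/-! ### Contexts that add no vertices -/

namespace Wiring
variable {S : Sig}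

theorem exists_equiv_of_isEmpty {V I O : Type} [IsEmpty V] (G : Wiring S V I O) :
    ∃ e : I ≃ O, ∀ i, G.wire (.inl i) = .inl (e i) := by
  have h : ∀ i, ∃ o, G.wire (.inl i) = .inl o := fun i => by
    rcases G.wire (.inl i) with o | u
    · exact ⟨o, rfl⟩
    · exact (IsEmpty.false u.1).elim
  choose f hf using h
  refine ⟨Equiv.ofBijective f ⟨fun i i' hi => ?_, fun o => ?_⟩, hf⟩
  · exact Sum.inl_injective (G.wire.injective ((hf i).trans ((congrArg _ hi).trans (hf i').symm)))
  · rcases h : G.wire.symm (.inl o) with i | u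
    · exact ⟨i, Sum.inl_injective ((hf i).symm.trans ((Equiv.symm_apply_eq _).1 h).symm)⟩
    · exact (IsEmpty.false u.1).elim

theorem Connected.nonempty_unique_of_isEmpty {V I O : Type} [IsEmpty V] {G : Wiring S V I O}
    (h : G.Connected) : Nonempty (Unique I) := by
  obtain ⟨⟨x0⟩, h⟩ := h
  have key : ∀ x y, Relation.EqvGen G.Adj x y → x = y := by
    intro x y hxy
    induction hxy with
    | rel x y h =>
      rcases h with ⟨v, p⟩ | ⟨s, v, p, h⟩
      · exact (IsEmpty.false v).elim
      · exact (IsEmpty.false v).elim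
    | refl => rfl
    | symm _ _ _ ih => exact ih.symm
    | trans _ _ _ _ _ ih ih' => exact ih.trans ih'
  rcases x0 with v | i | u
  · exact (IsEmpty.false v).elim
  · refine ⟨⟨⟨i⟩, fun i' => ?_⟩⟩
    have := key _ _ (h (.inr (.inl i')) (.inr (.inl i)))
    simpa using this
  · exact (IsEmpty.false u.1).elim

theorem ConnectedPerm.symm {ι κ : Type} {J : ι → Type} {K : κ → Type}
    {σ : (Σ i, J i) ≃ Σ r, K r} (h : ConnectedPerm σ) : ConnectedPerm σ.symm := by
  obtain ⟨⟨x⟩, h⟩ := h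
  refine ⟨⟨x.swap⟩, fun u v => ?_⟩
  have := eqvGen_map Sum.swap (t := Link σ.symm) ?_ (h u.swap v.swap)
  · simpa using this
  · rintro _ _ ⟨x, rfl, rfl⟩
    exact .symm _ _ (.rel _ _ ⟨σ x, rfl, by simp⟩)

/-- The block `z` has one entry, so it is linked to a single block of the first level, which has no
other exit. These two blocks form a connected component, hence everything. -/
theorem ConnectedPerm.eq_of_unique {ι κ : Type} {J : ι → Type} {K : κ → Type}
    {σ : (Σ i, J i) ≃ Σ r, K r} (h : ConnectedPerm σ) (hJ : ∀ i, Subsingleton (J i)) (z : κ)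
    (hz : Nonempty (Unique (K z))) (r : κ) : r = z := by
  obtain ⟨hz⟩ := hz
  let x0 := σ.symm ⟨z, default⟩
  have key : ∀ u v, Relation.EqvGen (Link σ) u v →
      ((u = .inr z ∨ u = .inl x0.1) ↔ (v = .inr z ∨ v = .inl x0.1)) := by
    intro u v huv
    induction huv with
    | rel u v h =>
      obtain ⟨x, rfl, rfl⟩ := h
      simp only [reduceCtorEq, false_or, or_false, Sum.inl.injEq, Sum.inr.injEq]
      constructor
      · intro hx
        obtain rfl : x = x0 := by
          obtain ⟨x1, x2⟩ := x
          generalize x0 = w at hx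
          obtain ⟨w1, w2⟩ := w
          subst hx
          rw [(hJ x1).elim x2 w2]
        simp [x0]
      · intro hx
        have : σ x = ⟨z, default⟩ := by
          generalize σ x = w at hx
          obtain ⟨w1, w2⟩ := w
          subst hx
          rw [Subsingleton.elim w2 default]
        have h3 : x = x0 := by rw [← σ.symm_apply_apply x, this]
        rw [h3]
    | refl => rfl
    | symm _ _ _ ih => exact ih.symm
    | trans _ _ _ _ _ ih ih' => exact ih.trans ih'
  have := (key _ _ (h.2 (.inr r) (.inr z))).2 (.inl rfl)
  simpa using this

end Wiring

theorem DGraph.unique_of_size_zero {S : Sig} {m n : ℕ} {G : DGraph S m n} (h : G.size = 0) :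
    Nonempty (Unique (Fin n)) ∧ Nonempty (Unique (Fin m)) ∧
      ∃ e : Fin n ≃ Fin m, ∀ i, G.graph.wire (.inl i) = .inl (e i) := by
  have : IsEmpty (Fin G.size) := by rw [h]; infer_instance
  obtain ⟨e, he⟩ := Wiring.exists_equiv_of_isEmpty G.graph
  obtain ⟨hn⟩ := G.connected.nonempty_unique_of_isEmpty
  exact ⟨⟨hn⟩, ⟨e.symm.unique⟩, e, he⟩

namespace Monomial
variable {S : Sig} {m n l k : ℕ}

theorem mk_surjective (X : Monomial S m n) : ∃ G, mk G = X := Quotient.exists_rep X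

theorem size_comp (s : Shape m n) (Q : ∀ y, Monomial S (s.l y) (s.k y))
    (P : ∀ x, Monomial S (s.j x) (s.i x)) :
    (comp s Q P).size = ∑ y, (Q y).size + ∑ x, (P x).size := by
  obtain ⟨Q, rfl⟩ := exists_rep Q
  obtain ⟨P, rfl⟩ := exists_rep P
  rw [comp_mk]
  refine (Fintype.card_sum).trans ?_
  rw [Fintype.card_sigma, Fintype.card_sigma, add_comm]
  simp only [Fintype.card_fin]
  rfl

theorem size_smul (g : BiPerm m n) (X : Monomial S m n) : (g • X).size = X.size := by
  obtain ⟨G, rfl⟩ := mk_surjective X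
  rfl

theorem size_relabel {T : Type} (f : T → S.Op) (X : Monomial (S.restrict f) m n) :
    (relabel f X).size = X.size := by
  obtain ⟨G, rfl⟩ := mk_surjective X
  rfl

theorem IsCtx.smul {c : Monomial S l k → Monomial S m n} (hc : IsCtx c) (g : BiPerm m n) :
    IsCtx fun X => g • c X := by
  rcases hc with ⟨s, Q, P, y⟩ | ⟨s, Q, P, x⟩
  · simp only [← comp_outer]
    exact .snd (s.outer g) Q P y
  · simp only [← comp_outer]
    exact .fst (s.outer g) Q P x

theorem IsCtx.exists_size {c : Monomial S l k → Monomial S m n} (hc : IsCtx c) :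
    ∃ r, ∀ X, (c X).size = X.size + r := by
  classical
  rcases hc with ⟨s, Q, P, y⟩ | ⟨s, Q, P, x⟩
  · refine ⟨∑ z ∈ Finset.univ.erase y, (Q z).size + ∑ x, (P x).size, fun X => ?_⟩
    rw [size_comp, ← Finset.add_sum_erase _ _ (Finset.mem_univ y), add_assoc]
    congr 1
    · simp
    congr 1
    refine Finset.sum_congr rfl fun z hz => ?_
    rw [Function.update_of_ne (Finset.ne_of_mem_erase hz)]
  · refine ⟨∑ y, (Q y).size + ∑ z ∈ Finset.univ.erase x, (P z).size, fun X => ?_⟩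
    rw [size_comp, ← Finset.add_sum_erase _ (fun x => Monomial.size _) (Finset.mem_univ x),
      add_left_comm]
    congr 1
    · simp
    congr 1
    refine Finset.sum_congr rfl fun z hz => ?_
    rw [Function.update_of_ne (Finset.ne_of_mem_erase hz)]

/-- As in `DGraph.eq_smul_of_iso_bdry`, the equality of biarities is only obtained by counting, and
the property `C` carries the conclusion across it. -/
theorem eq_smul_of_forall_iso {c : Monomial S l k → Monomial S m n} (α : Fin n ≃ Fin k)
    (β : Fin l ≃ Fin m) (h : ∀ G, ∃ H : DGraph S m n, c (mk G) = mk H ∧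
      (G.graph.bdry α β).Iso H.graph)
    {C : ∀ m n, (Monomial S l k → Monomial S m n) → Prop}
    (hC : ∀ g : BiPerm l k, C l k (fun X => g • X)) : C m n c := by
  obtain rfl : n = k := by simpa using Fintype.card_congr α
  obtain rfl : l = m := by simpa using Fintype.card_congr β
  have : c = fun X => ((β, MulOpposite.op α) : BiPerm l n) • X := by
    funext X
    obtain ⟨G, rfl⟩ := mk_surjective X
    obtain ⟨H, h1, h2⟩ := h G
    rw [h1]
    exact (Quotient.sound h2).symm
  rw [this]
  exact hC _

/-- A context that does not add vertices is the action of a pair of permutations. -/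
theorem IsCtx.eq_smul {c : Monomial S l k → Monomial S m n} (hc : IsCtx c)
    (h0 : ∀ X, (c X).size = X.size) (X₀ : Monomial S l k)
    {C : ∀ m n, (Monomial S l k → Monomial S m n) → Prop}
    (hC : ∀ g : BiPerm l k, C l k (fun X => g • X)) : C m n c := by
  classical
  rcases hc with ⟨s, Q, P, y⟩ | ⟨s, Q, P, x⟩
  · have hs := h0 X₀
    rw [size_comp, ← Finset.add_sum_erase _ _ (Finset.mem_univ y)] at hs
    simp only [Function.update_self] at hs
    obtain ⟨Q, rfl⟩ := exists_rep Q
    obtain ⟨P, rfl⟩ := exists_rep P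
    have hP : ∀ x, (P x).size = 0 := by
      have : ∑ x, (P x).size = 0 := Nat.eq_zero_of_add_eq_zero_left
        (Nat.add_left_cancel ((add_assoc _ _ _).symm.trans hs))
      simpa using this
    have hQ : ∀ z, z ≠ y → (Q z).size = 0 := fun z hz => by
      have h1 : ∑ z ∈ Finset.univ.erase y, (Function.update (fun y => mk (Q y)) y X₀ z).size = 0 :=
        Nat.eq_zero_of_add_eq_zero_right
          (Nat.add_left_cancel ((add_assoc _ _ _).symm.trans hs))
      have h2 := Finset.sum_eq_zero_iff.1 h1 z (by simp [hz])
      rw [Function.update_of_ne hz] at h2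
      exact h2
    -- All other entries are bare wires. A further block of the second level would have one entry
    -- and be fed by bare wires, hence be isolated; by connectedness there is none.
    have hy : ∀ z, z = y := by
      intro z
      by_contra hz
      refine hz (s.connected.eq_of_unique (fun x => ?_) z ?_ y).symm
      · obtain ⟨h⟩ := (DGraph.unique_of_size_zero (hP x)).2.1
        infer_instance
      · exact (DGraph.unique_of_size_zero (hQ z hz)).1
    have he : ∀ x, ∃ e : Fin (s.i x) ≃ Fin (s.j x), ∀ i, (P x).graph.wire (.inl i) = .inl (e i) :=
      fun x => (DGraph.unique_of_size_zero (hP x)).2.2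
    choose e he using he
    let _ : Unique (Fin s.b) := ⟨⟨y⟩, hy⟩
    let u : (Σ z, Fin (s.k z)) ≃ Fin (s.k y) := Equiv.uniqueSigma (fun z => Fin (s.k z))
    have hu : ∀ z, (⟨y, u z⟩ : Σ z, Fin (s.k z)) = z := fun z => u.symm_apply_apply z
    let v : (Σ z, Fin (s.l z)) ≃ Fin (s.l y) := Equiv.uniqueSigma (fun z => Fin (s.l z))
    -- An input of the composite reaches the only nontrivial block through `σ₁`, a bare wire of the
    -- first level, and `σ₂`.
    refine eq_smul_of_forall_iso (s.σ₁.trans ((Equiv.sigmaCongrRight e).trans (s.σ₂.trans u)))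
      (v.symm.trans s.σ₃) (fun G => ?_) hC
    obtain ⟨Q', hQ'⟩ := exists_rep (Function.update (fun y => mk (Q y)) y (mk G))
    rw [hQ', comp_mk]
    refine ⟨_, rfl, .trans ?_ (Wiring.reindex_iso _ _).symm⟩
    have hG : (Q' y).graph.Iso G.graph := by
      have := congrFun hQ' y
      rw [Function.update_self] at this
      exact Quotient.exact this.symm
    refine (hG.symm.bdry _ _).trans ?_
    have hbij : Function.Bijective (fun w : Fin (Q' y).size =>
        (.inr ⟨y, w⟩ : (Σ x, Fin (P x).size) ⊕ Σ z, Fin (Q' z).size)) := by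
      constructor
      · intro w w' h
        simpa using h
      · rintro (⟨x, w⟩ | ⟨z, w⟩)
        · exact (Fin.cast (hP x) w).elim0
        · obtain rfl := hy z
          exact ⟨w, rfl⟩
    refine ⟨Equiv.ofBijective _ hbij, fun _ => rfl, ?_⟩
    rintro (i | ⟨w, p⟩)
    · have h1 := he (s.σ₁ i).1 (s.σ₁ i).2
      have h2 := hu (s.σ₂ ⟨(s.σ₁ i).1, e (s.σ₁ i).1 (s.σ₁ i).2⟩)
      have h3 : ∀ o, v.symm o = ⟨y, o⟩ := fun o => rfl
      have h4 : (Equiv.sigmaCongrRight e) (s.σ₁ i) =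
        ⟨(s.σ₁ i).1, e (s.σ₁ i).1 (s.σ₁ i).2⟩ := rfl
      simp [h1, h4]
      generalize s.σ₂ ⟨(s.σ₁ i).1, e (s.σ₁ i).1 (s.σ₁ i).2⟩ = z at h2 ⊢
      have h5 : u ⟨y, u z⟩ = u z := by rw [h2]
      rw [← h2]
      rcases hq : (Q' y).graph.wire (.inl (u z)) with o | q <;> simp [h5, hq, h3]
    · rcases hq : (Q' y).graph.wire (.inr ⟨w, p⟩) with o | q <;> simp [hq]
      rfl
  · have hs := h0 X₀
    rw [size_comp, ← Finset.add_sum_erase _ (fun x => Monomial.size _) (Finset.mem_univ x),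
      add_left_comm] at hs
    simp only [Function.update_self] at hs
    obtain ⟨Q, rfl⟩ := exists_rep Q
    obtain ⟨P, rfl⟩ := exists_rep P
    have hQ : ∀ y, (Q y).size = 0 := by
      have : ∑ y, (Q y).size = 0 := Nat.eq_zero_of_add_eq_zero_right (Nat.add_left_cancel hs)
      simpa using this
    have hP : ∀ z, z ≠ x → (P z).size = 0 := fun z hz => by
      have h1 : ∑ z ∈ Finset.univ.erase x, (Function.update (fun y => mk (P y)) x X₀ z).size = 0 :=
        Nat.eq_zero_of_add_eq_zero_left (Nat.add_left_cancel hs)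
      have h2 := Finset.sum_eq_zero_iff.1 h1 z (by simp [hz])
      rw [Function.update_of_ne hz] at h2
      exact h2
    -- Same argument upside down, with the connected permutation `σ₂.symm`.
    have hx : ∀ z, z = x := by
      intro z
      by_contra hz
      refine hz (s.connected.symm.eq_of_unique (fun y => ?_) z ?_ x).symm
      · obtain ⟨h⟩ := (DGraph.unique_of_size_zero (hQ y)).1
        infer_instance
      · exact (DGraph.unique_of_size_zero (hP z hz)).2.1
    have he : ∀ y, ∃ e : Fin (s.k y) ≃ Fin (s.l y), ∀ i, (Q y).graph.wire (.inl i) = .inl (e i) :=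
      fun y => (DGraph.unique_of_size_zero (hQ y)).2.2
    choose e he using he
    let _ : Unique (Fin s.a) := ⟨⟨x⟩, hx⟩
    let u : (Σ z, Fin (s.i z)) ≃ Fin (s.i x) := Equiv.uniqueSigma (fun z => Fin (s.i z))
    have hu : ∀ z, (⟨x, u z⟩ : Σ z, Fin (s.i z)) = z := fun z => u.symm_apply_apply z
    let v : (Σ z, Fin (s.j z)) ≃ Fin (s.j x) := Equiv.uniqueSigma (fun z => Fin (s.j z))
    refine eq_smul_of_forall_iso (s.σ₁.trans u)
      (v.symm.trans (s.σ₂.trans ((Equiv.sigmaCongrRight e).trans s.σ₃))) (fun G => ?_) hC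
    obtain ⟨P', hP'⟩ := exists_rep (Function.update (fun y => mk (P y)) x (mk G))
    rw [hP', comp_mk]
    refine ⟨_, rfl, .trans ?_ (Wiring.reindex_iso _ _).symm⟩
    have hG : (P' x).graph.Iso G.graph := by
      have := congrFun hP' x
      rw [Function.update_self] at this
      exact Quotient.exact this.symm
    refine (hG.symm.bdry _ _).trans ?_
    have hbij : Function.Bijective (fun w : Fin (P' x).size =>
        (.inl ⟨x, w⟩ : (Σ x, Fin (P' x).size) ⊕ Σ z, Fin (Q z).size)) := by
      constructor
      · intro w w' h
        simpa using h
      · rintro (⟨z, w⟩ | ⟨y, w⟩)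
        · obtain rfl := hx z
          exact ⟨w, rfl⟩
        · exact (Fin.cast (hQ y) w).elim0
    have h3 : ∀ o, v.symm o = ⟨x, o⟩ := fun o => rfl
    have h4 : ∀ o, (Equiv.sigmaCongrRight e) o = ⟨o.1, e o.1 o.2⟩ := fun o => rfl
    refine ⟨Equiv.ofBijective _ hbij, fun _ => rfl, ?_⟩
    rintro (i | ⟨w, p⟩)
    · have h2 := hu (s.σ₁ i)
      simp
      generalize s.σ₁ i = z at h2 ⊢
      have h5 : u ⟨x, u z⟩ = u z := by rw [h2]
      rw [← h2]
      rcases hq : (P' x).graph.wire (.inl (u z)) with o | q <;> simp [h5, hq, h3, h4, he]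
    · rcases hq : (P' x).graph.wire (.inr ⟨w, p⟩) with o | q <;> simp [hq, h3, h4, he]

end Monomial

/-! ### Evaluation of composites and contexts -/

namespace Monomial
variable {S : Sig} {X : Type} {m n l k : ℕ}

theorem eval_comp [Nonempty X] [PartialOrder X] {F : S.FunModel X} (hF : ∀ o, StrictMono (F o))
    (s : Shape m n) (Q : ∀ y, Monomial S (s.l y) (s.k y)) (P : ∀ x, Monomial S (s.j x) (s.i x))
    (x : Fin n → X) (y : Σ y, Fin (s.l y)) :
    (comp s Q P).eval F x (s.σ₃ y) = (Q y.1).eval F (fun t => (P (s.σ₂.symm ⟨y.1, t⟩).1).eval F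
      (fun r => x (s.σ₁.symm ⟨_, r⟩)) (s.σ₂.symm ⟨y.1, t⟩).2) y.2 := by
  obtain ⟨E, hE⟩ : ∃ E : (Σ y, Fin (s.l y)) → X, ∀ y, E y = (Q y.1).eval F
      (fun t => (P (s.σ₂.symm ⟨y.1, t⟩).1).eval F
      (fun r => x (s.σ₁.symm ⟨_, r⟩)) (s.σ₂.symm ⟨y.1, t⟩).2) y.2 := ⟨_, fun _ => rfl⟩
  have h : (comp s Q P).Sat F.rel x (fun o => E (s.σ₃.symm o)) := by
    refine (sat_comp F.rel s Q P).2 ⟨fun z => (P z.1).eval F (fun r => x (s.σ₁.symm ⟨_, r⟩)) z.2,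
      fun b => sat_eval F _ _, fun b => ?_⟩
    simp only [Equiv.symm_apply_apply, hE]
    exact sat_eval F (Q b) _
  rw [eval_unique hF h]
  show E (s.σ₃.symm (s.σ₃ y)) = _
  rw [Equiv.symm_apply_apply, hE]

open Function in
/-- Contexts preserve the strict order of the functions defined by monomials. -/
theorem IsCtx.eval_lt [Nonempty X] [PartialOrder X] {F : S.FunModel X}
    (hF : ∀ o, StrictMono (F o)) {c : Monomial S l k → Monomial S m n} (hc : IsCtx c)
    {A B : Monomial S l k} (h : ∀ x, A.eval F x < B.eval F x) (x : Fin n → X) :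
    (c A).eval F x < (c B).eval F x := by
  have lt_of : ∀ {s : Shape m n} {f g : Fin m → X}, (∀ y t, f (s.σ₃ ⟨y, t⟩) ≤ g (s.σ₃ ⟨y, t⟩)) →
      (∃ y, (fun t => f (s.σ₃ ⟨y, t⟩)) < (fun t => g (s.σ₃ ⟨y, t⟩))) → f < g := by
    intro s f g hle ⟨y, hlt⟩
    obtain ⟨-, t, ht⟩ := Pi.lt_def.1 hlt
    refine Pi.lt_def.2 ⟨fun o => ?_, _, ht⟩
    have := hle (s.σ₃.symm o).1 (s.σ₃.symm o).2
    simpa using this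
  rcases hc with ⟨s, Q, P, y⟩ | ⟨s, Q, P, z⟩
  · refine lt_of (s := s) (fun y' t => ?_) ⟨y, ?_⟩
    · rw [eval_comp hF, eval_comp hF]
      by_cases hy : y' = y
      · subst hy
        simpa using (h _).le t
      · simp [update_of_ne hy]
    · simp only [eval_comp hF, update_self]
      exact h _
  · have hle : ∀ z', (update P z A z').eval F (fun r => x (s.σ₁.symm ⟨_, r⟩)) ≤
        (update P z B z').eval F (fun r => x (s.σ₁.symm ⟨_, r⟩)) := by
      intro z'
      by_cases hz : z' = z
      · subst hz
        simpa using (h _).le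
      · simp [update_of_ne hz]
    -- Some output `t` of the replaced entry decreases strictly. It enters the block `(s.σ₂ ⟨z,
    -- t⟩).1` of the second level, whose outputs decrease strictly in turn.
    obtain ⟨-, t, ht⟩ := Pi.lt_def.1 (h fun r => x (s.σ₁.symm ⟨z, r⟩))
    refine lt_of (s := s) (fun y' t => ?_) ⟨(s.σ₂ ⟨z, t⟩).1, ?_⟩
    · rw [eval_comp hF, eval_comp hF]
      exact (eval_strictMono hF _).monotone (fun t => hle _ _) t
    · simp only [eval_comp hF]
      refine eval_strictMono hF _ (Pi.lt_def.2 ⟨fun t => hle _ _, (s.σ₂ ⟨z, t⟩).2, ?_⟩)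
      have key : ∀ w, w = (⟨z, t⟩ : Σ x, Fin (s.j x)) →
          (update P z A w.1).eval F (fun r => x (s.σ₁.symm ⟨_, r⟩)) w.2 <
            (update P z B w.1).eval F (fun r => x (s.σ₁.symm ⟨_, r⟩)) w.2 := by
        rintro _ rfl
        simpa using ht
      exact key _ (s.σ₂.symm_apply_apply _)

theorem eval_relabel {T : Type} (f : T → S.Op) [Nonempty X] [PartialOrder X] {F : S.FunModel X}
    (hF : ∀ o, StrictMono (F o)) (G : Monomial (S.restrict f) m n) (x : Fin n → X) :
    (relabel f G).eval F x = G.eval (S := S.restrict f) (fun t => F (f t)) x :=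
  eval_unique hF ((sat_relabel f F.rel G).2 (sat_eval (S := S.restrict f) (fun t => F (f t)) G x))

end Monomial

/-! ### The termination measure -/

/-- The interpretation `x y ↦ 2 x + y + 2` of the product, and `x ↦ (2 x + 1, x)` of the
coproduct. -/
def measureModel : bialgSig.FunModel ℕ
  -- The factor `2` on the left penalizes left combs. The constants matter for small values: the `2`
  -- makes `x₍₁₎ y ⊗ x₍₂₎` smaller than `Δ(xy)`, as `4x + y + 4 < 4x + 2y + 5` on the first output,
  -- and the `1` of the coproduct makes coassociativity decrease at `x = 0`.
  | .mul => fun (x : Fin 2 → ℕ) _ => 2 * x 0 + x 1 + 2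
  | .comul => fun (x : Fin 1 → ℕ) => ![2 * x 0 + 1, x 0]

theorem measureModel_strictMono (o : bialgSig.Op) : StrictMono (measureModel o) := by
  cases o with
  | mul =>
    intro (x : Fin 2 → ℕ) (y : Fin 2 → ℕ) h
    obtain ⟨hle, i, hi⟩ := Pi.lt_def.1 h
    refine Pi.lt_def.2 ⟨fun _ => ?_, (0 : Fin 1), ?_⟩
    · show 2 * x 0 + x 1 + 2 ≤ 2 * y 0 + y 1 + 2
      have h0 : x 0 ≤ y 0 := hle (0 : Fin 2)
      have h1 : x 1 ≤ y 1 := hle (1 : Fin 2)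
      omega
    · show 2 * x 0 + x 1 + 2 < 2 * y 0 + y 1 + 2
      have h0 : x 0 ≤ y 0 := hle (0 : Fin 2)
      have h1 : x 1 ≤ y 1 := hle (1 : Fin 2)
      have h2 : ∀ p : Fin 2, p = 0 ∨ p = 1 := by decide
      rcases h2 i with rfl | rfl
      · have hi : x 0 < y 0 := hi
        omega
      · have hi : x 1 < y 1 := hi
        omega
  | comul =>
    intro (x : Fin 1 → ℕ) (y : Fin 1 → ℕ) h
    obtain ⟨hle, i, hi⟩ := Pi.lt_def.1 h
    obtain rfl : i = (0 : Fin 1) := Subsingleton.elim (α := Fin 1) _ _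
    have h2 : ∀ p : Fin 2, p = 0 ∨ p = 1 := by decide
    refine Pi.lt_def.2 ⟨fun i => ?_, (1 : Fin 2), hi⟩
    rcases h2 i with rfl | rfl
    · show 2 * x 0 + 1 ≤ 2 * y 0 + 1
      have h0 : x 0 < y 0 := hi
      omega
    · exact hle (0 : Fin 1)

/-- A size that decreases along the rewriting rules. -/
noncomputable def Monomial.measure {m n : ℕ} (G : Monomial bialgSig m n) : ℕ :=
  ∑ o, G.eval measureModel (fun _ => 0) o

theorem Monomial.measure_lt {m n : ℕ} {A B : Monomial bialgSig m n}
    (h : A.eval measureModel (fun _ => 0) < B.eval measureModel (fun _ => 0)) :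
    A.measure < B.measure := by
  obtain ⟨hle, i, hi⟩ := Pi.lt_def.1 h
  exact Finset.sum_lt_sum (fun i _ => hle i) ⟨i, Finset.mem_univ _, hi⟩

theorem sat_twoVertex {S : Sig} {X : Type} {m n N : ℕ} (R : S.Model X) {label : Fin 2 → S.Op}
    {ins : Fin n → Fin N} {vin : ∀ v, Fin (S.inp (label v)) → Fin N}
    {vout : ∀ v, Fin (S.out (label v)) → Fin N} {outs : Fin m → Fin N} {starts ends touch link order}
    {x : Fin n → X} {y : Fin m → X} :
    (twoVertex N label ins vin vout outs starts ends touch link order).Sat R x y ↔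
      ∃ ν : Fin N → X, (∀ i, x i = ν (ins i)) ∧ (∀ o, y o = ν (outs o)) ∧
        R (label 0) (fun q => ν (vin 0 q)) (fun p => ν (vout 0 p)) ∧
        R (label 1) (fun q => ν (vin 1 q)) (fun p => ν (vout 1 p)) :=
  (Wiring.sat_ofNames R).trans (by simp only [Fin.forall_fin_two])

/-- Evaluation reduces to listing the values `ν` of the five named wires, as is done below for each
side of the rules. -/
theorem eval_twoVertex {S : Sig} {m n N : ℕ} {F : S.FunModel ℕ} (hF : ∀ o, StrictMono (F o))
    {label : Fin 2 → S.Op}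
    {ins : Fin n → Fin N} {vin : ∀ v, Fin (S.inp (label v)) → Fin N}
    {vout : ∀ v, Fin (S.out (label v)) → Fin N} {outs : Fin m → Fin N} {starts ends touch link order}
    {x : Fin n → ℕ} (ν : Fin N → ℕ) (hx : ∀ i, x i = ν (ins i))
    (h0 : (fun p => ν (vout 0 p)) = F (label 0) (fun q => ν (vin 0 q)))
    (h1 : (fun p => ν (vout 1 p)) = F (label 1) (fun q => ν (vin 1 q))) :
    (twoVertex N label ins vin vout outs starts ends touch link order).eval F x =
      fun o => ν (outs o) :=
  Monomial.eval_unique hF ((sat_twoVertex F.rel).2 ⟨ν, hx, fun _ => rfl, h0, h1⟩)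

theorem eval_leftComb (x : Fin 3 → ℕ) :
    leftComb.eval (S := mulSig) (fun _ => measureModel .mul) x =
      ![2 * (2 * x 0 + x 1 + 2) + x 2 + 2] := by
  rw [leftComb, eval_twoVertex (fun _ => measureModel_strictMono .mul)
    ![x 0, x 1, x 2, 2 * x 0 + x 1 + 2, 2 * (2 * x 0 + x 1 + 2) + x 2 + 2]]
  · funext i; fin_cases i; rfl
  · intro i; fin_cases i <;> rfl
  · funext p; obtain rfl : p = (0 : Fin 1) := Subsingleton.elim (α := Fin 1) _ _; rfl
  · funext p; obtain rfl : p = (0 : Fin 1) := Subsingleton.elim (α := Fin 1) _ _; rfl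

theorem eval_rightComb (x : Fin 3 → ℕ) :
    rightComb.eval (S := mulSig) (fun _ => measureModel .mul) x =
      ![2 * x 0 + (2 * x 1 + x 2 + 2) + 2] := by
  rw [rightComb, eval_twoVertex (fun _ => measureModel_strictMono .mul)
    ![x 0, x 1, x 2, 2 * x 1 + x 2 + 2, 2 * x 0 + (2 * x 1 + x 2 + 2) + 2]]
  · funext i; fin_cases i; rfl
  · intro i; fin_cases i <;> rfl
  · funext p; obtain rfl : p = (0 : Fin 1) := Subsingleton.elim (α := Fin 1) _ _; rfl
  · funext p; obtain rfl : p = (0 : Fin 1) := Subsingleton.elim (α := Fin 1) _ _; rfl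

theorem funext_fin_two {X : Type} {f g : Fin 2 → X} (h0 : f 0 = g 0) (h1 : f 1 = g 1) : f = g :=
  funext fun p => by
    have h2 : ∀ p : Fin 2, p = 0 ∨ p = 1 := by decide
    rcases h2 p with rfl | rfl
    exacts [h0, h1]

theorem eval_leftCocomb (x : Fin 1 → ℕ) :
    leftCocomb.eval (S := comulSig) (fun _ => measureModel .comul) x =
      ![2 * (2 * x 0 + 1) + 1, 2 * x 0 + 1, x 0] := by
  rw [leftCocomb, eval_twoVertex (fun _ => measureModel_strictMono .comul)
    ![x 0, 2 * x 0 + 1, x 0, 2 * (2 * x 0 + 1) + 1, 2 * x 0 + 1]]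
  · funext i; fin_cases i <;> rfl
  · intro i; fin_cases i; rfl
  · exact funext_fin_two rfl rfl
  · exact funext_fin_two rfl rfl

theorem eval_rightCocomb (x : Fin 1 → ℕ) :
    rightCocomb.eval (S := comulSig) (fun _ => measureModel .comul) x =
      ![2 * x 0 + 1, 2 * x 0 + 1, x 0] := by
  rw [rightCocomb, eval_twoVertex (fun _ => measureModel_strictMono .comul)
    ![x 0, 2 * x 0 + 1, x 0, 2 * x 0 + 1, x 0]]
  · funext i; fin_cases i <;> rfl
  · intro i; fin_cases i; rfl
  · exact funext_fin_two rfl rfl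
  · exact funext_fin_two rfl rfl

theorem eval_comulMul (x : Fin 2 → ℕ) : comulMul.eval measureModel x =
    ![2 * (2 * x 0 + x 1 + 2) + 1, 2 * x 0 + x 1 + 2] := by
  rw [comulMul, eval_twoVertex measureModel_strictMono
    ![x 0, x 1, 2 * x 0 + x 1 + 2, 2 * (2 * x 0 + x 1 + 2) + 1, 2 * x 0 + x 1 + 2]]
  · funext i; fin_cases i <;> rfl
  · intro i; fin_cases i <;> rfl
  · funext p; obtain rfl : p = (0 : Fin 1) := Subsingleton.elim (α := Fin 1) _ _; rfl
  · exact funext_fin_two rfl rfl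

theorem eval_mulComul (i : Fin 4) (x : Fin 2 → ℕ) : (mulComul i).eval measureModel x =
    ![![2 * x 0 + 1, 2 * x 0 + x 1 + 2], ![2 * x 0 + (2 * x 1 + 1) + 2, x 1],
      ![2 * (2 * x 0 + 1) + x 1 + 2, x 0], ![2 * x 1 + 1, 2 * x 0 + x 1 + 2]] i := by
  fin_cases i
  · show (mulComul 0).eval measureModel x = _
    rw [mulComul, eval_twoVertex measureModel_strictMono
      ![x 0, x 1, 2 * x 0 + 1, x 0, 2 * x 0 + x 1 + 2]]
    · exact funext_fin_two rfl rfl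
    · intro i; fin_cases i <;> rfl
    · exact funext_fin_two rfl rfl
    · funext p; obtain rfl : p = (0 : Fin 1) := Subsingleton.elim (α := Fin 1) _ _; rfl
  · show (mulComul 1).eval measureModel x = _
    rw [mulComul, eval_twoVertex measureModel_strictMono
      ![x 0, x 1, 2 * x 1 + 1, x 1, 2 * x 0 + (2 * x 1 + 1) + 2]]
    · exact funext_fin_two rfl rfl
    · intro i; fin_cases i <;> rfl
    · exact funext_fin_two rfl rfl
    · funext p; obtain rfl : p = (0 : Fin 1) := Subsingleton.elim (α := Fin 1) _ _; rfl
  · show (mulComul 2).eval measureModel x = _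
    rw [mulComul, eval_twoVertex measureModel_strictMono
      ![x 0, x 1, 2 * x 0 + 1, x 0, 2 * (2 * x 0 + 1) + x 1 + 2]]
    · exact funext_fin_two rfl rfl
    · intro i; fin_cases i <;> rfl
    · exact funext_fin_two rfl rfl
    · funext p; obtain rfl : p = (0 : Fin 1) := Subsingleton.elim (α := Fin 1) _ _; rfl
  · show (mulComul 3).eval measureModel x = _
    rw [mulComul, eval_twoVertex measureModel_strictMono
      ![x 0, x 1, 2 * x 1 + 1, x 1, 2 * x 0 + x 1 + 2]]
    · exact funext_fin_two rfl rfl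
    · intro i; fin_cases i <;> rfl
    · exact funext_fin_two rfl rfl
    · funext p; obtain rfl : p = (0 : Fin 1) := Subsingleton.elim (α := Fin 1) _ _; rfl

theorem eval_rightComb_lt (x : Fin 3 → ℕ) :
    rightComb.eval (S := mulSig) (fun _ => measureModel .mul) x <
      leftComb.eval (S := mulSig) (fun _ => measureModel .mul) x := by
  rw [eval_leftComb, eval_rightComb]
  refine Pi.lt_def.2 ⟨fun i => ?_, 0, ?_⟩
  · obtain rfl := Subsingleton.elim i 0
    show 2 * x 0 + (2 * x 1 + x 2 + 2) + 2 ≤ 2 * (2 * x 0 + x 1 + 2) + x 2 + 2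
    omega
  · show 2 * x 0 + (2 * x 1 + x 2 + 2) + 2 < 2 * (2 * x 0 + x 1 + 2) + x 2 + 2
    omega

theorem eval_rightCocomb_lt (x : Fin 1 → ℕ) :
    rightCocomb.eval (S := comulSig) (fun _ => measureModel .comul) x <
      leftCocomb.eval (S := comulSig) (fun _ => measureModel .comul) x := by
  rw [eval_leftCocomb, eval_rightCocomb]
  refine Pi.lt_def.2 ⟨fun i => ?_, 0, ?_⟩
  · fin_cases i
    · show 2 * x 0 + 1 ≤ 2 * (2 * x 0 + 1) + 1
      omega
    · exact le_rfl
    · exact le_rfl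
  · show 2 * x 0 + 1 < 2 * (2 * x 0 + 1) + 1
    omega

theorem eval_mulComul_lt (i : Fin 4) (x : Fin 2 → ℕ) :
    (mulComul i).eval measureModel x < comulMul.eval measureModel x := by
  rw [eval_comulMul, eval_mulComul]
  refine Pi.lt_def.2 ⟨fun j => ?_, 0, ?_⟩
  · fin_cases i <;> fin_cases j <;> simp <;> omega
  · fin_cases i <;> simp <;> omega

theorem size_mulComul (i : Fin 4) : (mulComul i).size = 2 := by
  fin_cases i <;> rfl

/-- The monomials on the right-hand side of a rule have weight two, and define smaller functions
than the left-hand side. -/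
theorem Rule.eval_lt {a : Fin 4 → ℂ} {m n : ℕ} {L : Monomial bialgSig m n}
    {r : (free bialgSig).carrier m n} (h : Rule a m n L r) :
    L.size = 2 ∧ ∀ A ∈ r.support, A.size = 2 ∧
      ∀ x, A.eval measureModel x < L.eval measureModel x := by
  cases h with
  | assoc =>
    refine ⟨Monomial.size_relabel _ leftComb, fun A hA => ?_⟩
    obtain rfl := Finset.mem_singleton.1 (Finsupp.support_single_subset hA)
    refine ⟨Monomial.size_relabel _ rightComb, fun x => ?_⟩
    rw [Monomial.eval_relabel _ measureModel_strictMono,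
      Monomial.eval_relabel _ measureModel_strictMono]
    exact eval_rightComb_lt x
  | coassoc =>
    refine ⟨Monomial.size_relabel _ leftCocomb, fun A hA => ?_⟩
    obtain rfl := Finset.mem_singleton.1 (Finsupp.support_single_subset hA)
    refine ⟨Monomial.size_relabel _ rightCocomb, fun x => ?_⟩
    rw [Monomial.eval_relabel _ measureModel_strictMono,
      Monomial.eval_relabel _ measureModel_strictMono]
    exact eval_rightCocomb_lt x
  | comulMul =>
    classical
    refine ⟨rfl, fun A hA => ?_⟩
    obtain ⟨i, -, hi⟩ := Finset.mem_biUnion.1 (Finsupp.support_finsetSum hA)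
    obtain rfl := Finset.mem_singleton.1
      (Finsupp.support_single_subset (Finsupp.support_smul hi))
    exact ⟨size_mulComul i, eval_mulComul_lt i⟩

/-! ### Linear extension of contexts -/

theorem multilinear_mem {ι W : Type} [Finite ι] {B : ι → Type} [AddCommGroup W] [Module ℂ W]
    (f : MultilinearMap ℂ (fun i => B i →₀ ℂ) W) (J : Submodule ℂ W)
    (h : ∀ g : ∀ i, B i, f (fun i => Finsupp.single (g i) 1) ∈ J) (x : ∀ i, B i →₀ ℂ) :
    f x ∈ J := by
  have : J.mkQ.compMultilinearMap f = 0 := by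
    refine Module.Basis.ext_multilinear (fun _ => Finsupp.basisSingleOne) fun g => ?_
    simp only [Finsupp.coe_basisSingleOne]
    exact (Submodule.Quotient.mk_eq_zero J).2 (h g)
  exact (Submodule.Quotient.mk_eq_zero J).1 (congrArg (fun F => F x) this)

open Function in
-- Multilinearity in the entries other than `i` reduces them to basis vectors, while the entry `i`
-- keeps the fixed vector `x`, which need not be a basis vector.
theorem multilinear_mem_of_update {ι W : Type} [Finite ι] [DecidableEq ι] {B : ι → Type}
    [AddCommGroup W] [Module ℂ W] (f : MultilinearMap ℂ (fun i => B i →₀ ℂ) W)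
    (J : Submodule ℂ W) (i : ι) (x : B i →₀ ℂ)
    (h : ∀ g : ∀ i, B i, f (update (fun i => Finsupp.single (g i) 1) i x) ∈ J)
    (q : ∀ i, B i →₀ ℂ) (hq : q i = x) : f q ∈ J := by
  rcases eq_or_ne x 0 with rfl | hx
  · rw [f.map_coord_zero i hq]
    exact zero_mem _
  obtain ⟨b, -⟩ := Finsupp.support_nonempty_iff.2 hx
  -- Precomposing with a map that sends all basis vectors of the entry `i` to `x` reduces the claim
  -- to a test on basis vectors in every entry. The basis vector `b`, which exists as `x ≠ 0`,
  -- serves to recover `x` itself.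
  let T : ∀ j, (B j →₀ ℂ) →ₗ[ℂ] (B j →₀ ℂ) :=
    update (fun _ => LinearMap.id) i (Finsupp.linearCombination ℂ fun _ : B i => x)
  have hT : ∀ g : ∀ j, B j →₀ ℂ, ∀ b, (fun j => T j (update g i (Finsupp.single b 1) j)) =
      update g i x := by
    intro g b
    funext j
    by_cases hj : j = i
    · subst hj
      simp [T]
    · simp [T, hj]
  have key := multilinear_mem (f.compLinearMap T) J (fun g => ?_) (update q i (Finsupp.single b 1))
  · rw [MultilinearMap.compLinearMap_apply, hT, ← hq, update_eq_self] at key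
    exact key
  · rw [MultilinearMap.compLinearMap_apply]
    have h1 := hT (fun i => Finsupp.single (g i) 1) (g i)
    rw [update_eq_self i (fun i => Finsupp.single (g i) (1 : ℂ))] at h1
    rw [h1]
    exact h g

namespace free
variable {S : Sig} {m n : ℕ}
open Function

/-- Plugging a vector in one entry of a composite of monomials is the linear extension of a context.
This translates the ideal and the induced rules into statements on contexts. -/
theorem comp_update_snd (s : Shape m n) (Q : ∀ y, Monomial S (s.l y) (s.k y))
    (P : ∀ x, Monomial S (s.j x) (s.i x)) (y : Fin s.b) (h : Monomial S (s.l y) (s.k y) →₀ ℂ) :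
    comp s (update (fun z => Finsupp.single (Q z) 1) y h) (fun x => Finsupp.single (P x) 1) =
      h.mapDomain fun X => Monomial.comp s (update Q y X) P := by
  induction h using Finsupp.induction_linear with
  | zero => rw [MultilinearMap.map_update_zero, Finsupp.mapDomain_zero]; rfl
  | add u v hu hv =>
    rw [MultilinearMap.map_update_add, Finsupp.mapDomain_add, ← hu, ← hv]
    rfl
  | single X c =>
    have h1 : update (fun z => Finsupp.single (Q z) (1 : ℂ)) y (Finsupp.single X 1) =
        fun z => Finsupp.single (update Q y X z) 1 := by
      funext z
      exact (apply_update (fun _ G => Finsupp.single G (1 : ℂ)) Q y X z).symm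
    rw [← mul_one c, ← smul_eq_mul, ← Finsupp.smul_single, MultilinearMap.map_update_smul, h1,
      Finsupp.mapDomain_smul, Finsupp.mapDomain_single, ← comp_single s (update Q y X) P]
    rfl

theorem comp_update_fst (s : Shape m n) (Q : ∀ y, Monomial S (s.l y) (s.k y))
    (P : ∀ x, Monomial S (s.j x) (s.i x)) (x : Fin s.a) (h : Monomial S (s.j x) (s.i x) →₀ ℂ) :
    comp s (fun y => Finsupp.single (Q y) 1) (update (fun z => Finsupp.single (P z) 1) x h) =
      h.mapDomain fun X => Monomial.comp s Q (update P x X) := by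
  induction h using Finsupp.induction_linear with
  | zero => rw [MultilinearMap.map_update_zero, Finsupp.mapDomain_zero]
  | add u v hu hv => rw [MultilinearMap.map_update_add, Finsupp.mapDomain_add, ← hu, ← hv]
  | single X c =>
    have h1 : update (fun z => Finsupp.single (P z) (1 : ℂ)) x (Finsupp.single X 1) =
        fun z => Finsupp.single (update P x X z) 1 := by
      funext z
      exact (apply_update (fun _ G => Finsupp.single G (1 : ℂ)) P x X z).symm
    rw [← mul_one c, ← smul_eq_mul, ← Finsupp.smul_single, MultilinearMap.map_update_smul, h1,
      Finsupp.mapDomain_smul, Finsupp.mapDomain_single, ← comp_single s Q (update P x X)]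

/-- By multilinearity the entries other than `x` may be taken to be monomials, and then the
composite is a context applied to `x`. -/
theorem comp_mem_snd (s : Shape m n) (y : Fin s.b) {x : Monomial S (s.l y) (s.k y) →₀ ℂ}
    {J : Submodule ℂ (Monomial S m n →₀ ℂ)}
    (h : ∀ c : Monomial S (s.l y) (s.k y) → Monomial S m n, Monomial.IsCtx c → x.mapDomain c ∈ J)
    {q : ∀ y, Monomial S (s.l y) (s.k y) →₀ ℂ} (hq : q y = x)
    (p : ∀ x, Monomial S (s.j x) (s.i x) →₀ ℂ) : comp s q p ∈ J := by
  refine multilinear_mem (comp s q) J (fun P => ?_) p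
  refine multilinear_mem_of_update
    ((multiEval fun x => Finsupp.single (P x) 1).compMultilinearMap (comp s)) J y x
    (fun Q => ?_) q hq
  have := h _ (.snd s Q P y)
  rw [← comp_update_snd] at this
  exact this

theorem comp_mem_fst (s : Shape m n) (z : Fin s.a) {x : Monomial S (s.j z) (s.i z) →₀ ℂ}
    {J : Submodule ℂ (Monomial S m n →₀ ℂ)}
    (h : ∀ c : Monomial S (s.j z) (s.i z) → Monomial S m n, Monomial.IsCtx c → x.mapDomain c ∈ J)
    (q : ∀ y, Monomial S (s.l y) (s.k y) →₀ ℂ)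
    {p : ∀ x, Monomial S (s.j x) (s.i x) →₀ ℂ} (hp : p z = x) : comp s q p ∈ J := by
  refine multilinear_mem ((multiEval p).compMultilinearMap (comp s)) J (fun Q => ?_) q
  refine multilinear_mem_of_update (comp s fun y => Finsupp.single (Q y) 1) J z x
    (fun P => ?_) p hp
  have := h _ (.fst s Q P z)
  rw [← comp_update_fst] at this
  exact this

theorem mapDomain_mem_ideal {R : ∀ m n, Set ((free S).carrier m n)} {l k : ℕ}
    {c : Monomial S l k → Monomial S m n} (hc : Monomial.IsCtx c) {x : Monomial S l k →₀ ℂ}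
    (hx : x ∈ ideal R l k) : x.mapDomain c ∈ ideal R m n := by
  rcases hc with ⟨s, Q, P, y⟩ | ⟨s, Q, P, z⟩
  · rw [← comp_update_snd]
    exact .snd s _ _ y (by rw [update_self]; exact hx)
  · rw [← comp_update_fst]
    exact .fst s _ _ z (by rw [update_self]; exact hx)

end free

/-! ### Induced rules and the weight three part of the ideal -/

/-- An induced rule is a rule in a context. -/
theorem inducedRule_iff {a : Fin 4 → ℂ} {m n : ℕ} {G : Monomial bialgSig m n}
    {h : (free bialgSig).carrier m n} : InducedRule a m n G h ↔
      ∃ (l k : ℕ) (c : Monomial bialgSig l k → Monomial bialgSig m n) (L : Monomial bialgSig l k)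
        (r : (free bialgSig).carrier l k), Monomial.IsCtx c ∧ Rule a l k L r ∧ G = c L ∧
          h = Finsupp.mapDomain c r := by
  constructor
  · rintro (⟨s, Q, P, y, h, hr⟩ | ⟨s, Q, P, x, h, hr⟩)
    · refine ⟨_, _, _, _, _, .snd s Q P y, hr, ?_, free.comp_update_snd s Q P y h⟩
      rw [Function.update_eq_self]
    · refine ⟨_, _, _, _, _, .fst s Q P x, hr, ?_, free.comp_update_fst s Q P x h⟩
      rw [Function.update_eq_self]
  · rintro ⟨l, k, c, L, r, hc, hr, rfl, rfl⟩
    rcases hc with ⟨s, Q, P, y⟩ | ⟨s, Q, P, x⟩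
    · rw [← free.comp_update_snd]
      have := InducedRule.snd (a := a) s (Function.update Q y L) P y r
        (by rw [Function.update_self]; exact hr)
      convert this using 2
      congr 1
      funext z
      by_cases hz : z = y
      · subst hz; simp
      · simp [hz]
    · rw [← free.comp_update_fst]
      have := InducedRule.fst (a := a) s Q (Function.update P x L) x r
        (by rw [Function.update_self]; exact hr)
      convert this using 2
      funext z
      by_cases hz : z = x
      · subst hz; simp
      · simp [hz]

theorem InducedRule.smul {a : Fin 4 → ℂ} {m n : ℕ} {G : Monomial bialgSig m n}
    {h : (free bialgSig).carrier m n} (hr : InducedRule a m n G h) (g : BiPerm m n) :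
    InducedRule a m n (g • G) ((free bialgSig).rho m n g h) := by
  obtain ⟨l, k, c, L, r, hc, hr', rfl, rfl⟩ := inducedRule_iff.1 hr
  exact inducedRule_iff.2 ⟨l, k, _, L, r, hc.smul g, hr', rfl, Finsupp.mapDomain_comp.symm⟩

/-- This is the termination of the system: contexts add a fixed number of vertices and preserve the
strict decrease of the two sides of a rule. -/
theorem InducedRule.lt {a : Fin 4 → ℂ} {m n : ℕ} {G : Monomial bialgSig m n}
    {h : (free bialgSig).carrier m n} (hr : InducedRule a m n G h) :
    ∀ A ∈ h.support, A.size = G.size ∧ A.measure < G.measure := by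
  classical
  obtain ⟨l, k, c, L, r, hc, hr', rfl, rfl⟩ := inducedRule_iff.1 hr
  intro A hA
  obtain ⟨B, hB, rfl⟩ := Finset.mem_image.1 (Finsupp.mapDomain_support hA)
  obtain ⟨h1, h2⟩ := hr'.eval_lt
  obtain ⟨h3, h4⟩ := h2 B hB
  obtain ⟨d, hd⟩ := hc.exists_size
  exact ⟨by rw [hd, hd, h1, h3], Monomial.measure_lt (hc.eval_lt measureModel_strictMono h4 _)⟩

/-- Since the measure decreases, a step really removes `G` from the support. -/
theorem InducedRule.apply_self {a : Fin 4 → ℂ} {m n : ℕ} {G : Monomial bialgSig m n}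
    {h : (free bialgSig).carrier m n} (hr : InducedRule a m n G h) : h G = 0 := by
  by_contra hG
  exact lt_irrefl _ (hr.lt G (Finsupp.mem_support_iff.2 hG)).2

theorem Rule.sub_mem_ideal {a : Fin 4 → ℂ} {m n : ℕ} {L : Monomial bialgSig m n}
    {r : (free bialgSig).carrier m n} (h : Rule a m n L r) :
    Finsupp.single L 1 - r ∈ ideal (fun m n => {x | BialgRel a m n x}) m n := by
  refine .of ?_
  cases h with
  | assoc =>
    have := BialgRel.assoc (a := a) .mk
    rwa [map_sub, free.incl_single, free.incl_single] at this
  | coassoc =>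
    have := BialgRel.coassoc (a := a) .mk
    rwa [map_sub, free.incl_single, free.incl_single] at this
  | comulMul => exact .comulMul

theorem BialgRel.exists_rule {a : Fin 4 → ℂ} {m n : ℕ} {x : (free bialgSig).carrier m n}
    (h : BialgRel a m n x) : ∃ L r, Rule a m n L r ∧ x = Finsupp.single L 1 - r := by
  cases h with
  | assoc h =>
    cases h
    exact ⟨_, _, .assoc, by simp only [map_sub, free.incl_single]⟩
  | coassoc h =>
    cases h
    exact ⟨_, _, .coassoc, by simp only [map_sub, free.incl_single]⟩
  | comulMul => exact ⟨_, _, .comulMul, rfl⟩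

/-- The span of the differences of the two sides of the induced rules of weight three. -/
noncomputable def rewriteSpan (a : Fin 4 → ℂ) (m n : ℕ) :
    Submodule ℂ ((free bialgSig).carrier m n) :=
  Submodule.span ℂ {x | ∃ G h, InducedRule a m n G h ∧ G.size = 3 ∧ x = Finsupp.single G 1 - h}

theorem rewriteSpan_le_ideal (a : Fin 4 → ℂ) (m n : ℕ) :
    rewriteSpan a m n ≤ ideal (fun m n => {x | BialgRel a m n x}) m n := by
  refine Submodule.span_le.2 ?_
  rintro _ ⟨G, h, hr, -, rfl⟩
  obtain ⟨l, k, c, L, r, hc, hr', rfl, rfl⟩ := inducedRule_iff.1 hr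
  have := free.mapDomain_mem_ideal hc hr'.sub_mem_ideal
  rwa [← Finsupp.lmapDomain_apply ℂ ℂ, map_sub, Finsupp.lmapDomain_apply, Finsupp.lmapDomain_apply,
    Finsupp.mapDomain_single] at this

theorem rewriteSpan_le_freeWeight (a : Fin 4 → ℂ) (m n : ℕ) :
    rewriteSpan a m n ≤ freeWeight bialgSig 3 m n := by
  refine Submodule.span_le.2 ?_
  rintro _ ⟨G, h, hr, hG, rfl⟩
  refine sub_mem (Finsupp.single_mem_supported ℂ _ hG) ?_
  exact fun A hA => ((hr.lt A hA).1.trans hG)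

namespace Monomial

theorem IsCtx.mapDomain_mem_supported {S : Sig} {m n l k w d : ℕ}
    {c : Monomial S l k → Monomial S m n} (hd : ∀ X, (c X).size = X.size + d)
    {x : Monomial S l k →₀ ℂ} (hx : ∀ A ∈ x.support, w ≤ A.size) :
    x.mapDomain c ∈ Finsupp.supported ℂ ℂ {G : Monomial S m n | w + d ≤ G.size} := by
  classical
  intro A hA
  obtain ⟨B, hB, rfl⟩ := Finset.mem_image.1 (Finsupp.mapDomain_support hA)
  have := hx B hB
  show w + d ≤ (c B).size
  rw [hd]
  omega

end Monomial

/-- A subspace that contains the ideal of relations: its elements are sums of a combination of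
relations of weight two, of a combination of induced rules of weight three, and of an element of
weight at least four. -/
noncomputable def relationSpan (a : Fin 4 → ℂ) (m n : ℕ) :
    Submodule ℂ ((free bialgSig).carrier m n) :=
  Submodule.span ℂ {x | ∃ g L r, Rule a m n L r ∧
    x = (free bialgSig).rho m n g (Finsupp.single L 1 - r)} ⊔ rewriteSpan a m n ⊔
      Finsupp.supported ℂ ℂ {G | 4 ≤ G.size}

theorem mapDomain_single_sub {S : Sig} {m n l k : ℕ} (c : Monomial S l k → Monomial S m n)
    (L : Monomial S l k) (r : Monomial S l k →₀ ℂ) :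
    Finsupp.mapDomain c (Finsupp.single L 1 - r) =
      Finsupp.single (c L) 1 - Finsupp.mapDomain c r := by
  rw [← Finsupp.lmapDomain_apply ℂ ℂ, map_sub, Finsupp.lmapDomain_apply, Finsupp.lmapDomain_apply,
    Finsupp.mapDomain_single]

theorem support_single_sub {S : Sig} {m n w : ℕ} {L : Monomial S m n} {r : Monomial S m n →₀ ℂ}
    (hL : L.size = w) (hr : ∀ A ∈ r.support, A.size = w) :
    ∀ A ∈ (Finsupp.single L 1 - r).support, w ≤ A.size := by
  classical
  intro A hA
  rcases Finset.mem_union.1 (Finsupp.support_sub hA) with h | h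
  · obtain rfl := Finset.mem_singleton.1 (Finsupp.support_single_subset h)
    exact hL.ge
  · exact (hr A h).ge

theorem rho_mem_relationSpan {a : Fin 4 → ℂ} {m n : ℕ} (g : BiPerm m n)
    {x : (free bialgSig).carrier m n} (hx : x ∈ relationSpan a m n) :
    (free bialgSig).rho m n g x ∈ relationSpan a m n := by
  have : relationSpan a m n ≤ (relationSpan a m n).comap ((free bialgSig).rho m n g) := by
    refine sup_le (sup_le (Submodule.span_le.2 ?_) (Submodule.span_le.2 ?_)) ?_
    · rintro _ ⟨g', L, r, hr, rfl⟩
      refine Submodule.mem_sup_left (Submodule.mem_sup_left (Submodule.subset_span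
        ⟨g * g', L, r, hr, ?_⟩))
      rw [map_mul]
      rfl
    · rintro _ ⟨G, h, hr, hG, rfl⟩
      refine Submodule.mem_sup_left (Submodule.mem_sup_right (Submodule.subset_span
        ⟨_, _, hr.smul g, (Monomial.size_smul g G).trans hG, ?_⟩))
      exact mapDomain_single_sub _ _ _
    · intro x hx
      exact Submodule.mem_sup_right (Monomial.IsCtx.mapDomain_mem_supported (d := 0)
        (Monomial.size_smul g) hx)
  exact this hx

/-- The argument is a count of the vertices added by the context. A relation of weight two is only
permuted if none is added, becomes an induced rule of weight three if one is added, and has weight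
at least four otherwise. An induced rule of weight three is permuted, or reaches weight at least
four. -/
theorem mapDomain_mem_relationSpan {a : Fin 4 → ℂ} {m n l k : ℕ}
    {c : Monomial bialgSig l k → Monomial bialgSig m n} (hc : Monomial.IsCtx c)
    {x : (free bialgSig).carrier l k} (hx : x ∈ relationSpan a l k) :
    Finsupp.mapDomain c x ∈ relationSpan a m n := by
  have : relationSpan a l k ≤ (relationSpan a m n).comap (Finsupp.lmapDomain ℂ ℂ c) := by
    obtain ⟨d, hd⟩ := hc.exists_size
    refine sup_le (sup_le (Submodule.span_le.2 ?_) (Submodule.span_le.2 ?_)) ?_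
    · rintro _ ⟨g, L, r, hr, rfl⟩
      show Finsupp.mapDomain c (Finsupp.mapDomain (g • ·) (Finsupp.single L 1 - r)) ∈
        relationSpan a m n
      rw [← Finsupp.mapDomain_comp]
      have hc' := hc.comp_smul g
      have hd' : ∀ X, (c (g • X)).size = X.size + d := fun X => by rw [hd, Monomial.size_smul]
      obtain ⟨h1, h2⟩ := hr.eval_lt
      rcases d with _ | _ | d
      · refine hc'.eq_smul hd' L (C := fun m n c => Finsupp.mapDomain c (Finsupp.single L 1 - r) ∈
          relationSpan a m n) fun g => ?_
        exact Submodule.mem_sup_left (Submodule.mem_sup_left (Submodule.subset_span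
          ⟨g, L, r, hr, rfl⟩))
      · rw [mapDomain_single_sub]
        exact Submodule.mem_sup_left (Submodule.mem_sup_right (Submodule.subset_span
          ⟨_, _, inducedRule_iff.2 ⟨l, k, _, L, r, hc', hr, rfl, rfl⟩,
            (hd' L).trans (by rw [h1]), rfl⟩))
      · refine Submodule.mem_sup_right (Finsupp.supported_mono ?_
          (Monomial.IsCtx.mapDomain_mem_supported hd'
            (support_single_sub h1 fun A hA => (h2 A hA).1)))
        intro A hA
        have : 2 + (d + 1 + 1) ≤ A.size := hA
        show 4 ≤ A.size
        omega
    · rintro _ ⟨G, h, hr, hG, rfl⟩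
      show Finsupp.mapDomain c (Finsupp.single G 1 - h) ∈ relationSpan a m n
      rcases d with _ | d
      · refine hc.eq_smul hd G (C := fun m n c => Finsupp.mapDomain c (Finsupp.single G 1 - h) ∈
          relationSpan a m n) fun g => ?_
        exact rho_mem_relationSpan g (Submodule.mem_sup_left (Submodule.mem_sup_right
          (Submodule.subset_span ⟨G, h, hr, hG, rfl⟩)))
      · refine Submodule.mem_sup_right (Finsupp.supported_mono ?_
          (Monomial.IsCtx.mapDomain_mem_supported hd
            (support_single_sub hG fun A hA => (hr.lt A hA).1.trans hG)))
        intro A hA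
        have : 3 + (d + 1) ≤ A.size := hA
        show 4 ≤ A.size
        omega
    · intro x hx
      refine Submodule.mem_sup_right (Finsupp.supported_mono ?_
          (Monomial.IsCtx.mapDomain_mem_supported hd hx))
      intro A hA
      have : 4 + d ≤ A.size := hA
      show 4 ≤ A.size
      omega
  exact this hx

/-- The enlarged span contains the relations, and it is stable under permutations and under
contexts, hence under all the operations that generate the ideal. -/
theorem ideal_le_relationSpan (a : Fin 4 → ℂ) (m n : ℕ) :
    ideal (fun m n => {x | BialgRel a m n x}) m n ≤ relationSpan a m n := by
  intro x hx
  induction (show IdealMem _ _ _ x from hx) with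
  | of h =>
    obtain ⟨L, r, hr, rfl⟩ := BialgRel.exists_rule h
    refine Submodule.mem_sup_left (Submodule.mem_sup_left (Submodule.subset_span
      ⟨1, L, r, hr, ?_⟩))
    rw [map_one]
    rfl
  | zero => exact zero_mem _
  | add h h' ih ih' => exact add_mem (ih h) (ih' h')
  | smul c h ih => exact Submodule.smul_mem _ c (ih h)
  | act g h ih => exact rho_mem_relationSpan g (ih h)
  | snd s q p y h ih =>
    exact free.comp_mem_snd s y (fun c hc => mapDomain_mem_relationSpan hc (ih h)) rfl p
  | fst s q p x h ih =>
    exact free.comp_mem_fst s x (fun c hc => mapDomain_mem_relationSpan hc (ih h)) q rfl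

/-- In weight three, the ideal of relations is spanned by the induced rules. -/
theorem mem_rewriteSpan_iff {a : Fin 4 → ℂ} {m n : ℕ} {x : (free bialgSig).carrier m n}
    (hx : x ∈ freeWeight bialgSig 3 m n) :
    x ∈ rewriteSpan a m n ↔ x ∈ ideal (fun m n => {x | BialgRel a m n x}) m n := by
  refine ⟨fun h => rewriteSpan_le_ideal a m n h, fun h => ?_⟩
  obtain ⟨uv, huv, w, hw, rfl⟩ := Submodule.mem_sup.1 (ideal_le_relationSpan a m n h)
  obtain ⟨u, hu, v, hv, rfl⟩ := Submodule.mem_sup.1 huv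
  have hu : u ∈ Finsupp.supported ℂ ℂ {G : Monomial bialgSig m n | G.size = 2} := by
    refine Submodule.span_le.2 ?_ hu
    rintro _ ⟨g, L, r, hr, rfl⟩
    obtain ⟨h1, h2⟩ := hr.eval_lt
    show Finsupp.mapDomain (g • ·) _ ∈ _
    rw [mapDomain_single_sub]
    refine sub_mem (Finsupp.single_mem_supported ℂ _ ((Monomial.size_smul g L).trans h1)) ?_
    intro A hA
    classical
    obtain ⟨B, hB, rfl⟩ := Finset.mem_image.1 (Finsupp.mapDomain_support hA)
    exact (Monomial.size_smul g B).trans (h2 B hB).1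
  have hv' := rewriteSpan_le_freeWeight a m n hv
  -- The parts `u` of weight two and `w` of weight at least four must cancel, since `x` and `v` have
  -- weight three.
  have : u + w = 0 := by
    have h3 : u + w ∈ freeWeight bialgSig 3 m n := by
      have := sub_mem hx hv'
      rwa [show u + v + w - v = u + w by abel] at this
    ext G
    by_cases hG : G.size = 3
    · have h1 : u G = 0 := by
        by_contra h0
        have : G.size = 2 := hu (Finsupp.mem_support_iff.2 h0)
        omega
      have h2 : w G = 0 := by
        by_contra h0
        have : 4 ≤ G.size := hw (Finsupp.mem_support_iff.2 h0)
        omega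
      simp [h1, h2]
    · by_contra h0
      exact hG (h3 (Finsupp.mem_support_iff.2 h0))
  rw [show u + v + w = u + w + v by abel, this, zero_add]
  exact hv

/-! ### Normal forms and confluence -/

/-- A monomial is reducible if it is the left-hand side of an induced rule; this does not depend
on the coefficients, which are taken to be zero. -/
def Reducible {m n : ℕ} (G : Monomial bialgSig m n) : Prop :=
  ∃ h, InducedRule 0 m n G h

/-- The coefficients only occur on the right-hand sides of the rules. -/
theorem reducible_iff (a : Fin 4 → ℂ) {m n : ℕ} {G : Monomial bialgSig m n} :
    Reducible G ↔ ∃ h, InducedRule a m n G h := by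
  have key : ∀ {a b : Fin 4 → ℂ} {h}, InducedRule a m n G h → ∃ h, InducedRule b m n G h := by
    intro a b h hr
    obtain ⟨l, k, c, L, r, hc, hr', rfl, rfl⟩ := inducedRule_iff.1 hr
    have : ∃ r', Rule b l k L r' := by
      cases hr' with
      | assoc => exact ⟨_, .assoc⟩
      | coassoc => exact ⟨_, .coassoc⟩
      | comulMul => exact ⟨_, .comulMul⟩
    obtain ⟨r', hr''⟩ := this
    exact ⟨_, inducedRule_iff.2 ⟨l, k, c, L, r', hc, hr'', rfl, rfl⟩⟩
  exact ⟨fun ⟨h, hr⟩ => key hr, fun ⟨h, hr⟩ => key hr⟩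

/-- The span of the irreducible monomials of weight three. -/
noncomputable def normalForms (m n : ℕ) : Submodule ℂ ((free bialgSig).carrier m n) :=
  Finsupp.supported ℂ ℂ {G | G.size = 3 ∧ ¬ Reducible G}

theorem normalForms_le_freeWeight (m n : ℕ) : normalForms m n ≤ freeWeight bialgSig 3 m n :=
  Finsupp.supported_mono fun _ h => h.1

section Rewriting
variable {a : Fin 4 → ℂ} {m n : ℕ}

theorem Step.mem_freeWeight {f g : (free bialgSig).carrier m n} (h : Step a f g)
    (hf : f ∈ freeWeight bialgSig 3 m n) :
    g ∈ freeWeight bialgSig 3 m n ∧ g - f ∈ rewriteSpan a m n := by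
  obtain ⟨G, h, hr, hG⟩ := h
  have hG3 : G.size = 3 := hf (Finsupp.mem_support_iff.2 hG)
  have : f - f G • Finsupp.single G 1 + f G • h - f ∈ rewriteSpan a m n := by
    rw [show f - f G • Finsupp.single G 1 + f G • h - f = (- f G) • (Finsupp.single G 1 - h) by
      module]
    exact Submodule.smul_mem _ _ (Submodule.subset_span ⟨G, h, hr, hG3, rfl⟩)
  refine ⟨?_, this⟩
  have h2 := add_mem (rewriteSpan_le_freeWeight a m n this) hf
  rwa [sub_add_cancel] at h2

theorem sub_mem_of_steps {f g : freeWeight bialgSig 3 m n}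
    (h : Relation.ReflTransGen (fun f g : freeWeight bialgSig 3 m n => Step a f.1 g.1) f g) :
    g.1 - f.1 ∈ rewriteSpan a m n := by
  induction h with
  | refl => rw [sub_self]; exact zero_mem _
  | tail _ h ih =>
    have := add_mem (h.mem_freeWeight (Subtype.prop _)).2 ih
    rwa [sub_add_sub_cancel] at this

/-- Double induction, on a strict bound for the measures of the reducible monomials in the support,
and on the number of those that attain the largest value allowed. Rewriting one of these removes it
and only introduces monomials of smaller measure. -/
theorem exists_steps_normalForms (f : freeWeight bialgSig 3 m n) :
    ∃ g, Relation.ReflTransGen (fun f g : freeWeight bialgSig 3 m n => Step a f.1 g.1) f g ∧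
      g.1 ∈ normalForms m n := by
  classical
  have key : ∀ N, ∀ f : freeWeight bialgSig 3 m n,
      (∀ G ∈ f.1.support, Reducible G → G.measure < N) →
      ∃ g, Relation.ReflTransGen (fun f g : freeWeight bialgSig 3 m n => Step a f.1 g.1) f g ∧
        g.1 ∈ normalForms m n := by
    intro N
    induction N with
    | zero =>
      intro f hf
      exact ⟨f, .refl, fun G hG => ⟨f.2 hG, fun hr => absurd (hf G hG hr) (Nat.not_lt_zero _)⟩⟩
    | succ N ih =>
      intro f
      induction hd : (f.1.support.filter fun G => Reducible G ∧ G.measure = N).card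
        using Nat.strong_induction_on generalizing f with
      | _ d ih' =>
        intro hf
        by_cases hG : ∃ G ∈ f.1.support, Reducible G ∧ G.measure = N
        · obtain ⟨G, hG, hred, hN⟩ := hG
          obtain ⟨h, hr⟩ := (reducible_iff a).1 hred
          have hs := Step.mk f.1 G h hr (Finsupp.mem_support_iff.1 hG)
          set f' : freeWeight bialgSig 3 m n := ⟨_, (hs.mem_freeWeight f.2).1⟩ with hf'
          have hG' : f'.1 G = 0 := by
            simp [hf', hr.apply_self]
          have hsupp : ∀ A, A ≠ G → f'.1 A ≠ 0 → f.1 A ≠ 0 ∨ A.measure < N := by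
            intro A hA h0
            by_contra! hc
            have h1 : h A = 0 := by
              by_contra h1
              exact absurd (hr.lt A (Finsupp.mem_support_iff.2 h1)).2 (by omega)
            apply h0
            simp [hf', hc.1, h1, hA.symm]
          have hlt : (f'.1.support.filter fun G => Reducible G ∧ G.measure = N).card < d := by
            rw [← hd]
            refine Finset.card_lt_card (Finset.ssubset_iff_of_subset ?_ |>.2 ⟨G, ?_, ?_⟩)
            · intro A hA
              obtain ⟨h1, h2, h3⟩ := Finset.mem_filter.1 hA
              have h1 := Finsupp.mem_support_iff.1 h1
              refine Finset.mem_filter.2 ⟨Finsupp.mem_support_iff.2 ?_, h2, h3⟩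
              rcases hsupp A (fun h => h1 (h ▸ hG')) h1 with h | h
              · exact h
              · omega
            · exact Finset.mem_filter.2 ⟨hG, hred, hN⟩
            · simp [hG']
          obtain ⟨g, h1, h2⟩ := ih' _ hlt f' rfl (fun A hA hA' => by
            have hA := Finsupp.mem_support_iff.1 hA
            rcases hsupp A (fun h => hA (h ▸ hG')) hA with h | h
            · exact hf A (Finsupp.mem_support_iff.2 h) hA'
            · omega)
          exact ⟨g, .head hs h1, h2⟩
        · push Not at hG
          refine ih f fun G h hr => ?_
          have := hf G h hr
          have := hG G h hr
          omega
  refine key (f.1.support.sup Monomial.measure + 1) f fun G hG _ => ?_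
  exact Nat.lt_succ_of_le (Finset.le_sup hG)

theorem eq_of_steps_of_mem_normalForms {f g : freeWeight bialgSig 3 m n}
    (hf : f.1 ∈ normalForms m n)
    (h : Relation.ReflTransGen (fun f g : freeWeight bialgSig 3 m n => Step a f.1 g.1) f g) :
    f = g := by
  rcases Relation.ReflTransGen.cases_head h with h | ⟨f', h, -⟩
  · exact h
  · exfalso
    generalize f'.1 = f'' at h
    obtain ⟨G, h, hr, hG⟩ := h
    exact (hf (Finsupp.mem_support_iff.2 hG)).2 ((reducible_iff a).2 ⟨h, hr⟩)

/-- Replacing `G` by `h` in both elements gives the same result, because `h` does not contain `G`.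
This takes no step in an element where the coefficient of `G` is zero. -/
theorem join_add_smul {G : Monomial bialgSig m n} {h : (free bialgSig).carrier m n}
    (hr : InducedRule a m n G h) (c : ℂ) {f g : freeWeight bialgSig 3 m n}
    (hg : g.1 = f.1 + c • (Finsupp.single G 1 - h)) :
    Relation.Join (Relation.ReflTransGen
      fun f g : freeWeight bialgSig 3 m n => Step a f.1 g.1) f g := by
  have red : ∀ f : freeWeight bialgSig 3 m n, ∃ f' : freeWeight bialgSig 3 m n,
      f'.1 = f.1 - f.1 G • Finsupp.single G 1 + f.1 G • h ∧ Relation.ReflTransGen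
        (fun f g : freeWeight bialgSig 3 m n => Step a f.1 g.1) f f' := by
    intro f
    by_cases h0 : f.1 G = 0
    · exact ⟨f, by rw [h0]; module, .refl⟩
    · have hs := Step.mk f.1 G h hr h0
      exact ⟨⟨_, (hs.mem_freeWeight f.2).1⟩, rfl, .single hs⟩
  obtain ⟨f', hf', h1⟩ := red f
  obtain ⟨g', hg', h2⟩ := red g
  have hgG : g.1 G = f.1 G + c := by
    rw [hg]
    simp [hr.apply_self]
  have : g' = f' := by
    apply Subtype.ext
    rw [hf', hg', hgG, hg]
    module
  exact ⟨f', h1, this ▸ h2⟩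

/-- The rewriting system is confluent if and only if the irreducible monomials are independent
modulo the relations. -/
theorem inducesConfluentSystem_iff : InducesConfluentSystem a ↔
    ∀ m n, ∀ x ∈ normalForms m n, x ∈ rewriteSpan a m n → x = 0 := by
  constructor
  · intro hc m n x hx hxr
    let r := fun f g : freeWeight bialgSig 3 m n => Step a f.1 g.1
    -- Confluence makes joinability transitive.
    have trans : ∀ f g h, Relation.Join (Relation.ReflTransGen r) f g →
        Relation.Join (Relation.ReflTransGen r) g h → Relation.Join (Relation.ReflTransGen r) f h := by
      rintro f g h ⟨u, hu, hu'⟩ ⟨v, hv, hv'⟩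
      obtain ⟨t, h1, h2⟩ := hc m n g u v hu' hv
      exact ⟨t, hu.trans h1, hv'.trans h2⟩
    -- Hence any two elements congruent modulo the span of the rules are joinable. The scalar `c` is
    -- carried along for the induction on the span.
    have key : ∀ z ∈ rewriteSpan a m n, ∀ (c : ℂ) (f g : freeWeight bialgSig 3 m n),
        g.1 = f.1 + c • z → Relation.Join (Relation.ReflTransGen r) f g := by
      intro z hz
      induction hz using Submodule.span_induction with
      | mem z hz =>
        obtain ⟨G, h, hr, -, rfl⟩ := hz
        exact fun c f g hg => join_add_smul hr c hg
      | zero =>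
        intro c f g hg
        obtain rfl : g = f := Subtype.ext (by rw [hg, smul_zero, add_zero])
        exact ⟨g, .refl, .refl⟩
      | add u v hu hv ih ih' =>
        intro c f g hg
        let f' : freeWeight bialgSig 3 m n := ⟨f.1 + c • u, add_mem f.2 (Submodule.smul_mem _ _
          (rewriteSpan_le_freeWeight a m n hu))⟩
        refine trans f f' g (ih c f f' rfl) (ih' c f' g ?_)
        rw [hg]
        simp only [f']
        module
      | smul d u hu ih =>
        intro c f g hg
        exact ih (c * d) f g (by rw [hg, smul_smul])
    -- Both `x` and `0` are in normal form, so no step starts from them, and being joinable they are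
    -- equal.
    obtain ⟨t, h1, h2⟩ := key x hxr 1 0 ⟨x, normalForms_le_freeWeight m n hx⟩ (by simp)
    have h3 := eq_of_steps_of_mem_normalForms (f := 0) (zero_mem _) h1
    have h4 := eq_of_steps_of_mem_normalForms (f := ⟨x, normalForms_le_freeWeight m n hx⟩) hx h2
    exact congrArg Subtype.val (h4.trans h3.symm)
  · intro hc m n f g h hg hh
    obtain ⟨g', hg1, hg2⟩ := exists_steps_normalForms (a := a) g
    obtain ⟨h', hh1, hh2⟩ := exists_steps_normalForms (a := a) h
    -- Two normal forms of the same element `f` differ by relations, and independence identifies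
    -- them.
    have : g'.1 - h'.1 ∈ rewriteSpan a m n := by
      have := sub_mem (sub_mem_of_steps (hg.trans hg1)) (sub_mem_of_steps (hh.trans hh1))
      rwa [sub_sub_sub_cancel_right] at this
    have := sub_eq_zero.1 (hc m n _ (sub_mem hg2 hh2) this)
    exact ⟨g', hg1, by rw [Subtype.ext this]; exact hh1⟩

end Rewriting

/-! ### Edges and reducibility -/

namespace Wiring
variable {S : Sig}

theorem HasEdge.of_iso {V W I O : Type} {G : Wiring S V I O} {H : Wiring S W I O} (h : G.Iso H)
    {o₁ o₂ : S.Op} {p q : ℕ} (hG : G.HasEdge o₁ p o₂ q) : H.HasEdge o₁ p o₂ q := by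
  obtain ⟨e, he, hw⟩ := h.exists_wire
  obtain ⟨v, p', w, q', rfl, rfl, rfl, rfl, hvw⟩ := hG
  obtain ⟨p₁, q₁, hp, hq, h1⟩ := hw v p' w q' _ _ hvw rfl rfl
  exact ⟨_, p₁, _, q₁, (he v).symm, hp, (he w).symm, hq, h1⟩

theorem HasEdge.bdry {V I O I' O' : Type} {G : Wiring S V I O} (e : I' ≃ I) (f : O ≃ O')
    {o₁ o₂ : S.Op} {p q : ℕ} (hG : G.HasEdge o₁ p o₂ q) : (G.bdry e f).HasEdge o₁ p o₂ q := by
  obtain ⟨v, p', w, q', h1, h2, h3, h4, hvw⟩ := hG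
  exact ⟨v, p', w, q', h1, h2, h3, h4, by simp [hvw]⟩

theorem HasEdge.twoLevel_left {ι κ : Type} {V I J : ι → Type} {W K L : κ → Type}
    {P : ∀ i, Wiring S (V i) (I i) (J i)} (Q : ∀ r, Wiring S (W r) (K r) (L r))
    (σ : (Σ i, J i) ≃ Σ r, K r) {i : ι} {o₁ o₂ : S.Op} {p q : ℕ}
    (h : (P i).HasEdge o₁ p o₂ q) : (twoLevel P Q σ).HasEdge o₁ p o₂ q := by
  obtain ⟨v, p', w, q', h1, h2, h3, h4, hvw⟩ := h
  exact ⟨.inl ⟨i, v⟩, p', .inl ⟨i, w⟩, q', h1, h2, h3, h4, by simp [hvw]⟩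

theorem HasEdge.twoLevel_right {ι κ : Type} {V I J : ι → Type} {W K L : κ → Type}
    (P : ∀ i, Wiring S (V i) (I i) (J i)) {Q : ∀ r, Wiring S (W r) (K r) (L r)}
    (σ : (Σ i, J i) ≃ Σ r, K r) {r : κ} {o₁ o₂ : S.Op} {p q : ℕ}
    (h : (Q r).HasEdge o₁ p o₂ q) : (twoLevel P Q σ).HasEdge o₁ p o₂ q := by
  obtain ⟨v, p', w, q', h1, h2, h3, h4, hvw⟩ := h
  exact ⟨.inr ⟨r, v⟩, p', .inr ⟨r, w⟩, q', h1, h2, h3, h4, by simp [hvw]⟩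

theorem HasEdge.relabel {T V I O : Type} (f : T → S.Op) {G : Wiring (S.restrict f) V I O}
    {o₁ o₂ : T} {p q : ℕ} (hG : G.HasEdge o₁ p o₂ q) :
    (G.relabel f).HasEdge (f o₁) p (f o₂) q := by
  obtain ⟨v, p', w, q', h1, h2, h3, h4, hvw⟩ := hG
  exact ⟨v, p', w, q', congrArg f h1, h2, congrArg f h3, h4, hvw⟩

end Wiring

/-- A representative of a monomial of weight two with an edge of a given kind. -/
def Monomial.IsEdge {S : Sig} {m n : ℕ} (X : Monomial S m n) (o₁ : S.Op) (p : ℕ) (o₂ : S.Op)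
    (q : ℕ) : Prop :=
  ∃ K : DGraph S m n, Monomial.mk K = X ∧ K.size = 2 ∧ K.graph.HasEdge o₁ p o₂ q

theorem isEdge_twoVertex {S : Sig} {m n N : ℕ} {label : Fin 2 → S.Op}
    {ins : Fin n → Fin N} {vin : ∀ v, Fin (S.inp (label v)) → Fin N}
    {vout : ∀ v, Fin (S.out (label v)) → Fin N} {outs : Fin m → Fin N} {starts ends touch link order}
    (p : Fin (S.out (label 0))) (q : Fin (S.inp (label 1))) (h : vout 0 p = vin 1 q) :
    (twoVertex N label ins vin vout outs starts ends touch link order).IsEdge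
      (label 0) p.val (label 1) q.val :=
  ⟨_, rfl, rfl, 0, p, 1, q, rfl, rfl, rfl, rfl, (Wiring.ofNames_wire _ _).2 h⟩

theorem Monomial.IsEdge.relabel {S : Sig} {T : Type} (f : T → S.Op) {m n : ℕ}
    {X : Monomial (S.restrict f) m n} {o₁ o₂ : T} {p q : ℕ} (h : X.IsEdge o₁ p o₂ q) :
    (Monomial.relabel f X).IsEdge (f o₁) p (f o₂) q := by
  obtain ⟨K, rfl, hK, he⟩ := h
  exact ⟨_, rfl, hK, he.relabel f⟩

theorem isEdge_leftComb : leftComb.IsEdge () 0 () 0 :=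
  isEdge_twoVertex (S := mulSig) (label := ![(), ()]) (0 : Fin 1) (0 : Fin 2) rfl

theorem isEdge_leftCocomb : leftCocomb.IsEdge () 0 () 0 :=
  isEdge_twoVertex (S := comulSig) (label := ![(), ()]) (0 : Fin 2) (0 : Fin 1) rfl

theorem isEdge_comulMul : comulMul.IsEdge .mul 0 .comul 0 :=
  isEdge_twoVertex (S := bialgSig) (label := ![.mul, .comul]) (0 : Fin 1) (0 : Fin 1) rfl

namespace Monomial
variable {S : Sig} {m n l k : ℕ}

/-- In weight at most three, a graph with an edge of a given kind is obtained by plugging a graph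
of weight two with such an edge in a context. -/
theorem IsEdge.exists_ctx {L : Monomial S l k} {o₁ o₂ : S.Op} {p q : ℕ}
    (hL : L.IsEdge o₁ p o₂ q) (hu : S.out o₁ = 1 ∨ S.inp o₂ = 1) {G : DGraph S m n}
    (hG : G.size ≤ 3) (h : G.graph.HasEdge o₁ p o₂ q) :
    ∃ c : Monomial S l k → Monomial S m n, IsCtx c ∧ mk G = c L := by
  obtain ⟨K, rfl, hK, hK'⟩ := hL
  obtain ⟨l', k', H, c, hc, hH, hH', hG⟩ := exists_ctx_of_hasEdge G hG h hu
  obtain ⟨α, β, hi⟩ := DGraph.exists_iso_bdry_of_hasEdge hu hH hK hH' hK'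
  rw [hG]
  -- The entry isolated by `exists_ctx_of_hasEdge` agrees with `K` up to renaming its boundary, and
  -- this renaming is absorbed by the context.
  exact DGraph.eq_smul_of_iso_bdry α β hi (C := fun l' k' X => ∀ c : Monomial S l' k' →
    Monomial S m n, IsCtx c → ∃ c' : Monomial S l k → Monomial S m n, IsCtx c' ∧ c X = c' (mk K))
    (fun g c hc => ⟨_, hc.comp_smul g, rfl⟩) c hc

/-- Monomials of weight at most three are congruent, modulo a relation that rewrites an edge and
decreases a measure, to monomials without this kind of edge. -/
theorem exists_congr_of_isEdge {R : ∀ m n, Set ((free S).carrier m n)} {F : S.FunModel ℕ}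
    (hF : ∀ o, StrictMono (F o)) {L L' : Monomial S l k} {o₁ o₂ : S.Op} {p q : ℕ}
    (hL : L.IsEdge o₁ p o₂ q) (hu : S.out o₁ = 1 ∨ S.inp o₂ = 1) (hL' : L'.size = L.size)
    (hlt : ∀ x, L'.eval F x < L.eval F x)
    (hR : Finsupp.single L 1 - Finsupp.single L' 1 ∈ R l k) (X : Monomial S m n) (hX : X.size ≤ 3) :
    ∃ G : DGraph S m n, ¬ G.graph.HasEdge o₁ p o₂ q ∧ G.size = X.size ∧
      Finsupp.single X 1 - Finsupp.single (mk G) 1 ∈ ideal R m n := by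
  induction hN : ∑ o, X.eval F (fun _ => 0) o using Nat.strong_induction_on generalizing X with
  | _ N ih =>
    obtain ⟨G, rfl⟩ := mk_surjective X
    by_cases hG : G.graph.HasEdge o₁ p o₂ q
    · obtain ⟨c, hc, hGc⟩ := hL.exists_ctx hu hX hG
      obtain ⟨d, hd⟩ := hc.exists_size
      have hs : (c L').size = (mk G).size := by rw [hGc, hd, hd, hL']
      have hlt' := hc.eval_lt hF hlt (fun _ => 0)
      rw [← hGc] at hlt'
      obtain ⟨hle, i, hi⟩ := Pi.lt_def.1 hlt'
      obtain ⟨G', h1, h2, h3⟩ := ih _ (by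
        rw [← hN]
        exact Finset.sum_lt_sum (fun i _ => hle i) ⟨i, Finset.mem_univ _, hi⟩) (c L')
        (hs.le.trans hX) rfl
      refine ⟨G', h1, h2.trans hs, ?_⟩
      have h4 := free.mapDomain_mem_ideal hc (R := R) (.of hR)
      rw [mapDomain_single_sub, Finsupp.mapDomain_single, ← hGc] at h4
      have := add_mem h4 h3
      rwa [sub_add_sub_cancel] at this
    · exact ⟨G, hG, rfl, by rw [sub_self]; exact zero_mem _⟩

/-- Rewriting left edges by associativity decreases the measure and preserves the weight. When no
left edge remains, the monomial is a right comb. -/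
theorem exists_comb_congr (X : Monomial mulSig m n) (hX : X.size ≤ 3) :
    ∃ q : Monomial mulSig m n, q.IsComb ∧ q.size = X.size ∧
      Finsupp.single X 1 - Finsupp.single q 1 ∈ ideal (fun m n => {x | AssocRel m n x}) m n := by
  obtain ⟨G, h1, h2, h3⟩ := exists_congr_of_isEdge (R := fun m n => {x | AssocRel m n x})
    (F := fun _ => measureModel .mul)
    (fun _ => measureModel_strictMono .mul) isEdge_leftComb (.inl rfl) (L' := rightComb) rfl
    eval_rightComb_lt .mk X hX
  exact ⟨mk G, isComb_of_not_hasEdge h1, h2, h3⟩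

theorem exists_cocomb_congr (X : Monomial comulSig m n) (hX : X.size ≤ 3) :
    ∃ q : Monomial comulSig m n, q.IsCocomb ∧ q.size = X.size ∧
      Finsupp.single X 1 - Finsupp.single q 1 ∈ ideal (fun m n => {x | CoassocRel m n x}) m n := by
  obtain ⟨G, h1, h2, h3⟩ := exists_congr_of_isEdge (R := fun m n => {x | CoassocRel m n x})
    (F := fun _ => measureModel .comul)
    (fun _ => measureModel_strictMono .comul) isEdge_leftCocomb (.inr rfl) (L' := rightCocomb) rfl
    eval_rightCocomb_lt .mk X hX
  exact ⟨mk G, isCocomb_of_not_hasEdge h1, h2, h3⟩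

end Monomial

/-- Reducibility is thus detected on single wires: the left-hand side of each rule is a graph with
two vertices determined by its only internal wire, up to renaming. -/
theorem reducible_of_hasEdge {m n l k : ℕ} {L : Monomial bialgSig l k}
    {r : (free bialgSig).carrier l k} (hr : Rule 0 l k L r) {o₁ o₂ : BialgOp} {p q : ℕ}
    (hL : L.IsEdge o₁ p o₂ q) (hu : bialgSig.out o₁ = 1 ∨ bialgSig.inp o₂ = 1)
    {G : DGraph bialgSig m n} (hG : G.size ≤ 3) (h : G.graph.HasEdge o₁ p o₂ q) :
    Reducible (Monomial.mk G) := by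
  obtain ⟨c, hc, hGc⟩ := hL.exists_ctx hu hG h
  exact ⟨_, inducedRule_iff.2 ⟨l, k, c, L, r, hc, hr, hGc, rfl⟩⟩

/-! ### Composites of combs -/

/-- The combinatorial data of a two-level composite of one right comb of products for every
output and of one right comb of coproducts for every input. -/
structure CombShape (m n : ℕ) where
  -- The numbers `j x` and `k y` count vertices: a comb with `k` vertices has `k + 1` leaves, and
  -- `0` stands for a bare wire.
  j : Fin n → ℕ
  k : Fin m → ℕ
  σ : (Σ x, Fin (j x + 1)) ≃ Σ y, Fin (k y + 1)
  connected : Wiring.ConnectedPerm σ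

namespace CombShape
variable {m n : ℕ}

/-- The corresponding shape. -/
abbrev shape (D : CombShape m n) : Shape m n where
  b := m
  a := n
  l _ := 1
  k y := D.k y + 1
  j x := D.j x + 1
  i _ := 1
  σ₃ := Equiv.sigmaUnique (Fin m) fun _ => Fin 1
  σ₂ := D.σ
  σ₁ := (Equiv.sigmaUnique (Fin n) fun _ => Fin 1).symm
  connected := D.connected

/-- The number of products and coproducts. -/
def weight (D : CombShape m n) : ℕ := ∑ y, D.k y + ∑ x, D.j x

/-- The composite of the combs. -/
noncomputable def mono (D : CombShape m n) : Monomial bialgSig m n :=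
  Monomial.comp D.shape
    (fun y => (Monomial.comb (D.k y)).relabel (S := bialgSig) fun _ : Unit => BialgOp.mul)
    (fun x => (Monomial.cocomb (D.j x)).relabel (S := bialgSig) fun _ : Unit => BialgOp.comul)

theorem size_mono (D : CombShape m n) : D.mono.size = D.weight := by
  rw [mono, Monomial.size_comp]
  simp only [Monomial.size_relabel, Monomial.size_comb, Monomial.size_cocomb]
  rfl

end CombShape

/-- A function of the entries of a two-level composite, compatible with the action of the
permutations of the blocks and with their renumbering, only has to be computed on the standard
composites of combs. -/
theorem exists_combShape {m n : ℕ} {T : Type} (Φ : ∀ s : Shape m n,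
      (∀ y, Monomial mulSig (s.l y) (s.k y)) → (∀ x, Monomial comulSig (s.j x) (s.i x)) → T)
    (hsnd : ∀ (s : Shape m n) (q : ∀ y, Monomial mulSig (s.l y) (s.k y))
      (p : ∀ x, Monomial comulSig (s.j x) (s.i x)) g,
      Φ s (fun y => g y • q y) p = Φ (s.absorbSnd g) q p)
    (hfst : ∀ (s : Shape m n) (q : ∀ y, Monomial mulSig (s.l y) (s.k y))
      (p : ∀ x, Monomial comulSig (s.j x) (s.i x)) g,
      Φ s q (fun x => g x • p x) = Φ (s.absorbFst g) q p)
    (hblock : ∀ (s : Shape m n) (q : ∀ y, Monomial mulSig (s.l y) (s.k y))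
      (p : ∀ x, Monomial comulSig (s.j x) (s.i x)) ρ τ,
      Φ (s.block ρ τ) (fun y => q (ρ y)) (fun x => p (τ x)) = Φ s q p)
    (s : Shape m n) (q : ∀ y, Monomial mulSig (s.l y) (s.k y))
    (p : ∀ x, Monomial comulSig (s.j x) (s.i x)) (hq : ∀ y, (q y).IsComb)
    (hp : ∀ x, (p x).IsCocomb) :
    ∃ D : CombShape m n, Φ s q p = Φ D.shape (fun y => Monomial.comb (D.k y))
      (fun x => Monomial.cocomb (D.j x)) := by
  obtain ⟨b, a, l, k, j, i, σ₃, σ₂, σ₁, hc⟩ := s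
  replace hq : ∀ y : Fin b, Monomial.IsComb (m := l y) (n := k y) (q y) := hq
  replace hp : ∀ x : Fin a, Monomial.IsCocomb (m := j x) (n := i x) (p x) := hp
  choose w hl hk g hq using hq
  choose w' hj hi g' hp using hp
  obtain rfl : (fun _ => 1) = l := funext hl
  obtain rfl : (fun y => w y + 1) = k := funext hk
  obtain rfl : (fun x => w' x + 1) = j := funext hj
  obtain rfl : (fun _ => 1) = i := funext hi
  obtain rfl : q = fun y => g y • Monomial.comb (w y) := funext hq
  obtain rfl : p = fun x => g' x • Monomial.cocomb (w' x) := funext hp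
  -- Every comb has one output and every comb of coproducts one input, so the blocks are as many as
  -- the outputs and inputs of the composite.
  obtain rfl : b = m := by simpa using Fintype.card_congr σ₃
  obtain rfl : n = a := by simpa using Fintype.card_congr σ₁
  let s : Shape b n :=
    ⟨b, n, fun _ => 1, fun y => w y + 1, fun x => w' x + 1, fun _ => 1, σ₃, σ₂, σ₁, hc⟩
  have h1 := hsnd s (fun y => Monomial.comb (w y)) (fun x => g' x • Monomial.cocomb (w' x)) g
  have h2 := hfst (s.absorbSnd g) (fun y => Monomial.comb (w y))
    (fun x => Monomial.cocomb (w' x)) g'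
  refine Exists.imp (fun D h => (h1.trans h2).trans h) ?_
  have key : ∀ (σ₃ : (Σ _ : Fin b, Fin 1) ≃ Fin b)
      (σ₂ : (Σ x, Fin (w' x + 1)) ≃ Σ y, Fin (w y + 1)) (σ₁ : Fin n ≃ Σ _ : Fin n, Fin 1)
      (hc : Wiring.ConnectedPerm σ₂), ∃ D : CombShape b n,
        Φ ⟨b, n, fun _ => 1, fun y => w y + 1, fun x => w' x + 1, fun _ => 1, σ₃, σ₂, σ₁, hc⟩
          (fun y => Monomial.comb (w y)) (fun x => Monomial.cocomb (w' x)) =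
        Φ D.shape (fun y => Monomial.comb (D.k y)) (fun x => Monomial.cocomb (D.j x)) := by
    intro σ₃ σ₂ σ₁ hc
    -- Renumbering the blocks by the outputs and the inputs to which they are attached makes `σ₃`
    -- and `σ₁` standard.
    let ρ : Equiv.Perm (Fin b) := σ₃.symm.trans (Equiv.sigmaUnique (Fin b) fun _ => Fin 1)
    let τ : Equiv.Perm (Fin n) := σ₁.trans (Equiv.sigmaUnique (Fin n) fun _ => Fin 1)
    let s : Shape b n :=
      ⟨b, n, fun _ => 1, fun y => w y + 1, fun x => w' x + 1, fun _ => 1, σ₃, σ₂, σ₁, hc⟩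
    let D : CombShape b n := ⟨fun x => w' (τ x), fun y => w (ρ y), (s.block ρ τ).σ₂,
      (s.block ρ τ).connected⟩
    refine ⟨D, (hblock s _ _ ρ τ).symm.trans ?_⟩
    have h3 : (s.block ρ τ).σ₃ = Equiv.sigmaUnique (Fin b) fun _ => Fin 1 := by
      ext1 ⟨y, t⟩
      obtain rfl := Subsingleton.elim t 0
      have : (⟨ρ y, 0⟩ : Σ _ : Fin b, Fin 1) = σ₃.symm y :=
        Sigma.ext rfl (heq_of_eq (Subsingleton.elim _ _))
      show σ₃ ⟨ρ y, 0⟩ = y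
      rw [this, Equiv.apply_symm_apply]
    have h1 : (s.block ρ τ).σ₁ = (Equiv.sigmaUnique (Fin n) fun _ => Fin 1).symm := by
      ext1 x
      show (Equiv.sigmaCongrLeft (β := fun _ : Fin n => Fin 1) τ).symm (σ₁ x) = ⟨x, 0⟩
      rw [Equiv.symm_apply_eq]
      exact Sigma.ext rfl (heq_of_eq (Subsingleton.elim _ _))
    have key : ∀ (σ₃ : (Σ _ : Fin b, Fin 1) ≃ Fin b) (σ₁ : Fin n ≃ Σ _ : Fin n, Fin 1),
        (σ₃ = Equiv.sigmaUnique (Fin b) fun _ => Fin 1) →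
        (σ₁ = (Equiv.sigmaUnique (Fin n) fun _ => Fin 1).symm) →
        Φ ⟨b, n, fun _ => 1, fun y => D.k y + 1, fun x => D.j x + 1, fun _ => 1, σ₃, D.σ, σ₁,
          D.connected⟩ (fun y => Monomial.comb (D.k y)) (fun x => Monomial.cocomb (D.j x)) =
        Φ D.shape (fun y => Monomial.comb (D.k y)) (fun x => Monomial.cocomb (D.j x)) := by
      rintro _ _ rfl rfl
      rfl
    exact key _ _ h3 h1
  exact key _ _ _ _

theorem exists_comp_eq_mono {m n : ℕ} (s : Shape m n) {q : ∀ y, Monomial mulSig (s.l y) (s.k y)}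
    {p : ∀ x, Monomial comulSig (s.j x) (s.i x)} (hq : ∀ y, (q y).IsComb)
    (hp : ∀ x, (p x).IsCocomb) : ∃ D : CombShape m n, Monomial.comp s
      (fun y => (q y).relabel (S := bialgSig) fun _ : Unit => BialgOp.mul)
      (fun x => (p x).relabel (S := bialgSig) fun _ : Unit => BialgOp.comul) = D.mono :=
  exists_combShape (fun s q p => Monomial.comp s
    (fun y => (q y).relabel (S := bialgSig) fun _ : Unit => BialgOp.mul)
    (fun x => (p x).relabel (S := bialgSig) fun _ : Unit => BialgOp.comul))
    (fun s q p g => by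
      simp only [Monomial.relabel_smul (S := bialgSig)]
      exact Monomial.comp_absorbSnd s g _ _)
    (fun s q p g => by
      simp only [Monomial.relabel_smul (S := bialgSig)]
      exact Monomial.comp_absorbFst s g _ _)
    (fun s q p ρ τ => Monomial.comp_block s ρ τ
      (fun y => (q y).relabel (S := bialgSig) fun _ : Unit => BialgOp.mul)
      (fun x => (p x).relabel (S := bialgSig) fun _ : Unit => BialgOp.comul)) s q p hq hp

namespace DGraph
variable {m n : ℕ}

/-- A graph all of whose labels are in the image of `f` is relabelled along `f`. -/
theorem exists_relabel {S : Sig} {T : Type} (f : T → S.Op) (G : DGraph S m n)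
    (h : ∀ v, ∃ t, f t = G.graph.label v) : ∃ H : DGraph (S.restrict f) m n,
      Monomial.relabel f (Monomial.mk H) = Monomial.mk G ∧
        ∀ o₁ p o₂ q, H.graph.HasEdge o₁ p o₂ q → G.graph.HasEdge (f o₁) p (f o₂) q := by
  obtain ⟨N, ⟨label, wire⟩, hc, ha⟩ := G
  replace h : ∀ v, ∃ t, f t = label v := h
  choose t ht using h
  obtain rfl : (fun v => f (t v)) = label := funext ht
  exact ⟨⟨N, ⟨t, wire⟩, Wiring.connected_of_relabel f hc, ha⟩, rfl, fun _ _ _ _ h => h.relabel f⟩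

end DGraph

/-- The irreducible monomials of weight at most three are composites of combs. -/
theorem exists_eq_mono {m n : ℕ} {X : Monomial bialgSig m n} (hX : X.size ≤ 3)
    (h : ¬ Reducible X) : ∃ D : CombShape m n, X = D.mono := by
  obtain ⟨G, rfl⟩ := Monomial.mk_surjective X
  have he : ∀ {l k : ℕ} {L : Monomial bialgSig l k} {r} (_ : Rule 0 l k L r) {o₁ o₂ : BialgOp}
      {p q : ℕ} (_ : L.IsEdge o₁ p o₂ q) (_ : bialgSig.out o₁ = 1 ∨ bialgSig.inp o₂ = 1),
      ¬ G.graph.HasEdge o₁ p o₂ q := by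
    intro l k L r hr o₁ o₂ p q hL hu hG
    exact h (reducible_of_hasEdge hr hL hu hX hG)
  -- As no product feeds a coproduct, the coproducts are closed under predecessors and form the
  -- first level.
  obtain ⟨s, Q, P, hQ, hP, hG, hi⟩ := Monomial.exists_comp G (fun o => o = .comul) (by
    intro v p w q hvw hw
    by_contra hv
    have hv : G.graph.label v = .mul := by
      cases h : G.graph.label v with
      | mul => rfl
      | comul => exact absurd h hv
    have hp : ∀ o, o = BialgOp.mul → ∀ p : Fin (bialgSig.out o), p.val = 0 := by
      rintro _ rfl p
      exact Nat.lt_one_iff.1 p.isLt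
    have hq : ∀ o, o = BialgOp.comul → ∀ q : Fin (bialgSig.inp o), q.val = 0 := by
      rintro _ rfl q
      exact Nat.lt_one_iff.1 q.isLt
    exact he .comulMul isEdge_comulMul (.inl rfl) 
      ⟨v, p, w, q, hv, hp _ hv p, hw, hq _ hw q, hvw⟩)
  choose Q' hQ1 hQ2 using fun y => DGraph.exists_relabel (S := bialgSig)
    (fun _ : Unit => BialgOp.mul) (Q y) (fun v => ⟨(), by
      cases h : (Q y).graph.label v with
      | mul => rfl
      | comul => exact absurd h (hQ y v)⟩)
  choose P' hP1 hP2 using fun x => DGraph.exists_relabel (S := bialgSig)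
    (fun _ : Unit => BialgOp.comul) (P x) (fun v => ⟨(), (hP x v).symm⟩)
  -- A left edge inside a block would be a left edge of `G`, which would be reducible.
  have hQc : ∀ y, (Monomial.mk (Q' y)).IsComb := fun y =>
    Monomial.isComb_of_not_hasEdge fun h => he .assoc (isEdge_leftComb.relabel _) (.inl rfl)
      (((hQ2 y _ _ _ _ h).twoLevel_right (fun x => (P x).graph)
        (Q := fun y => (Q y).graph) s.σ₂).bdry _ _ |>.of_iso hi.symm)
  have hPc : ∀ y, (Monomial.mk (P' y)).IsCocomb := fun y =>
    Monomial.isCocomb_of_not_hasEdge fun h => he .coassoc (isEdge_leftCocomb.relabel _) (.inr rfl)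
      (((hP2 y _ _ _ _ h).twoLevel_left (P := fun x => (P x).graph)
        (fun y => (Q y).graph) s.σ₂).bdry _ _ |>.of_iso hi.symm)
  obtain ⟨D, hD⟩ := exists_comp_eq_mono s hQc hPc
  refine ⟨D, hG.trans (Eq.trans ?_ hD)⟩
  simp only [hQ1, hP1]

/-! ### The model on words, for zero coefficients -/

/-- The interpretation of products and coproducts as concatenations and deconcatenations of lists
of nonempty words: the product concatenates lists, and the coproduct splits the word of a list
with one word. -/
def wordModel (α : Type) : bialgSig.Model (List (List α))
  | .mul => fun (x : Fin 2 → List (List α)) (y : Fin 1 → List (List α)) =>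
      x 0 ≠ [] ∧ x 1 ≠ [] ∧ y 0 = x 0 ++ x 1
  | .comul => fun (x : Fin 1 → List (List α)) (y : Fin 2 → List (List α)) =>
      ∃ u v, u ≠ [] ∧ v ≠ [] ∧ x 0 = [u ++ v] ∧ y 0 = [u] ∧ y 1 = [v]

section WordModel
variable {α : Type}

/-- The same condition as in `sat_rightComb`: the model satisfies associativity. The next pair of
lemmas does this for coassociativity. -/
theorem sat_leftComb {x : Fin 3 → List (List α)} {y : Fin 1 → List (List α)} :
    (leftComb.relabel (S := bialgSig) fun _ : Unit => BialgOp.mul).Sat (wordModel α) x y ↔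
      x 0 ≠ [] ∧ x 1 ≠ [] ∧ x 2 ≠ [] ∧ y 0 = x 0 ++ x 1 ++ x 2 := by
  rw [Monomial.sat_relabel, leftComb, sat_twoVertex]
  constructor
  · rintro ⟨ν, hx, hy, ⟨h1, h2, h3⟩, h4, h5, h6⟩
    have e0 : x 0 = ν 0 := hx 0
    have e1 : x 1 = ν 1 := hx 1
    have e2 : x 2 = ν 2 := hx 2
    have ey : y 0 = ν 4 := hy 0
    replace h1 : ν 0 ≠ [] := h1
    replace h2 : ν 1 ≠ [] := h2
    replace h3 : ν 3 = ν 0 ++ ν 1 := h3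
    replace h5 : ν 2 ≠ [] := h5
    replace h6 : ν 4 = ν 3 ++ ν 2 := h6
    rw [e0, e1, e2, ey]
    exact ⟨h1, h2, h5, by rw [h6, h3]⟩
  · rintro ⟨h0, h1, h2, h3⟩
    refine ⟨![x 0, x 1, x 2, x 0 ++ x 1, y 0], ?_, ?_, ⟨h0, h1, rfl⟩, ?_, h2, h3⟩
    · intro i; fin_cases i <;> rfl
    · intro i; fin_cases i; rfl
    · show x 0 ++ x 1 ≠ []
      simp [h0]

theorem sat_rightComb {x : Fin 3 → List (List α)} {y : Fin 1 → List (List α)} :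
    (rightComb.relabel (S := bialgSig) fun _ : Unit => BialgOp.mul).Sat (wordModel α) x y ↔
      x 0 ≠ [] ∧ x 1 ≠ [] ∧ x 2 ≠ [] ∧ y 0 = x 0 ++ x 1 ++ x 2 := by
  rw [Monomial.sat_relabel, rightComb, sat_twoVertex]
  constructor
  · rintro ⟨ν, hx, hy, ⟨h1, h2, h3⟩, h4, h5, h6⟩
    have e0 : x 0 = ν 0 := hx 0
    have e1 : x 1 = ν 1 := hx 1
    have e2 : x 2 = ν 2 := hx 2
    have ey : y 0 = ν 4 := hy 0
    replace h1 : ν 1 ≠ [] := h1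
    replace h2 : ν 2 ≠ [] := h2
    replace h3 : ν 3 = ν 1 ++ ν 2 := h3
    replace h4 : ν 0 ≠ [] := h4
    replace h6 : ν 4 = ν 0 ++ ν 3 := h6
    rw [e0, e1, e2, ey]
    exact ⟨h4, h1, h2, by rw [h6, h3, List.append_assoc]⟩
  · rintro ⟨h0, h1, h2, h3⟩
    refine ⟨![x 0, x 1, x 2, x 1 ++ x 2, y 0], ?_, ?_, ⟨h1, h2, rfl⟩, h0, ?_, ?_⟩
    · intro i; fin_cases i <;> rfl
    · intro i; fin_cases i; rfl
    · show x 1 ++ x 2 ≠ []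
      simp [h1]
    · show y 0 = x 0 ++ (x 1 ++ x 2)
      rw [h3, List.append_assoc]

theorem sat_leftCocomb {x : Fin 1 → List (List α)} {y : Fin 3 → List (List α)} :
    (leftCocomb.relabel (S := bialgSig) fun _ : Unit => BialgOp.comul).Sat (wordModel α) x y ↔
      ∃ u v w, u ≠ [] ∧ v ≠ [] ∧ w ≠ [] ∧ x 0 = [u ++ v ++ w] ∧ y 0 = [u] ∧ y 1 = [v] ∧
        y 2 = [w] := by
  rw [Monomial.sat_relabel, leftCocomb, sat_twoVertex]
  constructor
  · rintro ⟨ν, hx, hy, ⟨t, w, ht, hw, h1, h2, h3⟩, u, v, hu, hv, h4, h5, h6⟩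
    have e0 : x 0 = ν 0 := hx 0
    have e1 : y 0 = ν 3 := hy 0
    have e2 : y 1 = ν 4 := hy 1
    have e3 : y 2 = ν 2 := hy 2
    replace h1 : ν 0 = [t ++ w] := h1
    replace h2 : ν 1 = [t] := h2
    replace h3 : ν 2 = [w] := h3
    replace h4 : ν 1 = [u ++ v] := h4
    obtain rfl : t = u ++ v := by simpa [h2] using h4
    exact ⟨u, v, w, hu, hv, hw, e0.trans h1, e1.trans h5, e2.trans h6, e3.trans h3⟩
  · rintro ⟨u, v, w, hu, hv, hw, h0, h1, h2, h3⟩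
    refine ⟨![x 0, [u ++ v], y 2, y 0, y 1], ?_, ?_, ⟨u ++ v, w, by simp [hu], hw, h0, rfl, h3⟩,
      ⟨u, v, hu, hv, rfl, h1, h2⟩⟩
    · intro i; fin_cases i; rfl
    · intro i; fin_cases i <;> rfl

theorem sat_rightCocomb {x : Fin 1 → List (List α)} {y : Fin 3 → List (List α)} :
    (rightCocomb.relabel (S := bialgSig) fun _ : Unit => BialgOp.comul).Sat (wordModel α) x y ↔
      ∃ u v w, u ≠ [] ∧ v ≠ [] ∧ w ≠ [] ∧ x 0 = [u ++ v ++ w] ∧ y 0 = [u] ∧ y 1 = [v] ∧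
        y 2 = [w] := by
  rw [Monomial.sat_relabel, rightCocomb, sat_twoVertex]
  constructor
  · rintro ⟨ν, hx, hy, ⟨u, t, hu, ht, h1, h2, h3⟩, v, w, hv, hw, h4, h5, h6⟩
    have e0 : x 0 = ν 0 := hx 0
    have e1 : y 0 = ν 1 := hy 0
    have e2 : y 1 = ν 3 := hy 1
    have e3 : y 2 = ν 4 := hy 2
    replace h1 : ν 0 = [u ++ t] := h1
    replace h2 : ν 1 = [u] := h2
    replace h3 : ν 2 = [t] := h3
    replace h4 : ν 2 = [v ++ w] := h4
    obtain rfl : t = v ++ w := by simpa [h3] using h4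
    exact ⟨u, v, w, hu, hv, hw, by rw [e0, h1, List.append_assoc], e1.trans h2, e2.trans h5,
      e3.trans h6⟩
  · rintro ⟨u, v, w, hu, hv, hw, h0, h1, h2, h3⟩
    refine ⟨![x 0, y 0, [v ++ w], y 1, y 2], ?_, ?_, ⟨u, v ++ w, hu, by simp [hv], ?_, h1, rfl⟩,
      ⟨v, w, hv, hw, rfl, h2, h3⟩⟩
    · intro i; fin_cases i; rfl
    · intro i; fin_cases i <;> rfl
    · show x 0 = _
      rw [h0, List.append_assoc]

/-- A product of nonempty lists has at least two words, whereas the coproduct only reads lists with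
one word. This realizes the relation `Δ(xy) = 0` of `P_0`. -/
theorem not_sat_comulMul {x y : Fin 2 → List (List α)} :
    ¬ comulMul.Sat (wordModel α) x y := by
  rw [comulMul, sat_twoVertex]
  rintro ⟨ν, hx, hy, ⟨h1, h2, h3⟩, u, v, hu, hv, h4, h5, h6⟩
  replace h1 : ν 0 ≠ [] := h1
  replace h2 : ν 1 ≠ [] := h2
  replace h3 : ν 2 = ν 0 ++ ν 1 := h3
  replace h4 : ν 2 = [u ++ v] := h4
  have h7 := congrArg List.length (h3.symm.trans h4)
  rw [List.length_append] at h7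
  have := List.length_pos_iff.2 h1
  have := List.length_pos_iff.2 h2
  simp at h7
  omega

end WordModel

namespace Monomial
variable {S : Sig} {X : Type} {m n l k : ℕ}
open Function

theorem IsCtx.sat_imp {R : S.Model X} {c : Monomial S l k → Monomial S m n} (hc : IsCtx c)
    {A B : Monomial S l k} (h : ∀ x y, A.Sat R x y → B.Sat R x y) {x : Fin n → X} {y : Fin m → X}
    (hA : (c A).Sat R x y) : (c B).Sat R x y := by
  rcases hc with ⟨s, Q, P, z⟩ | ⟨s, Q, P, z⟩
  · obtain ⟨v, h1, h2⟩ := (sat_comp R s _ _).1 hA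
    refine (sat_comp R s _ _).2 ⟨v, h1, fun b => ?_⟩
    have := h2 b
    by_cases hb : b = z
    · subst hb
      rw [update_self] at this ⊢
      exact h _ _ this
    · rwa [update_of_ne hb] at this ⊢
  · obtain ⟨v, h1, h2⟩ := (sat_comp R s _ _).1 hA
    refine (sat_comp R s _ _).2 ⟨v, fun b => ?_, h2⟩
    have := h1 b
    by_cases hb : b = z
    · subst hb
      rw [update_self] at this ⊢
      exact h _ _ this
    · rwa [update_of_ne hb] at this ⊢

theorem IsCtx.exists_sat {R : S.Model X} {c : Monomial S l k → Monomial S m n} (hc : IsCtx c)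
    {A : Monomial S l k} {x : Fin n → X} {y : Fin m → X}
    (hA : (c A).Sat R x y) : ∃ x y, A.Sat R x y := by
  rcases hc with ⟨s, Q, P, z⟩ | ⟨s, Q, P, z⟩
  · obtain ⟨v, h1, h2⟩ := (sat_comp R s _ _).1 hA
    have := h2 z
    rw [update_self] at this
    exact ⟨_, _, this⟩
  · obtain ⟨v, h1, h2⟩ := (sat_comp R s _ _).1 hA
    have := h1 z
    rw [update_self] at this
    exact ⟨_, _, this⟩

end Monomial

/-- For zero coefficients, an induced rule either has an unsatisfiable left-hand side and a zero
right-hand side, or replaces a monomial by an equivalent one. -/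
theorem InducedRule.sat {m n : ℕ} {G : Monomial bialgSig m n} {h : (free bialgSig).carrier m n}
    (hr : InducedRule 0 m n G h) {α : Type} (x : Fin n → List (List α))
    (y : Fin m → List (List α)) :
    (¬ G.Sat (wordModel α) x y ∧ h = 0) ∨ ∃ G', h = Finsupp.single G' 1 ∧
      (G.Sat (wordModel α) x y ↔ G'.Sat (wordModel α) x y) := by
  obtain ⟨l, k, c, L, r, hc, hr', rfl, rfl⟩ := inducedRule_iff.1 hr
  cases hr' with
  | assoc =>
    refine .inr ⟨_, Finsupp.mapDomain_single, hc.sat_imp fun x y h => ?_, hc.sat_imp fun x y h => ?_⟩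
    · exact sat_rightComb.2 (sat_leftComb.1 h)
    · exact sat_leftComb.2 (sat_rightComb.1 h)
  | coassoc =>
    refine .inr ⟨_, Finsupp.mapDomain_single, hc.sat_imp fun x y h => ?_, hc.sat_imp fun x y h => ?_⟩
    · exact sat_rightCocomb.2 (sat_leftCocomb.1 h)
    · exact sat_leftCocomb.2 (sat_rightCocomb.1 h)
  | comulMul =>
    refine .inl ⟨fun h => ?_, ?_⟩
    · obtain ⟨x, y, h⟩ := hc.exists_sat h
      exact not_sat_comulMul h
    · simp [comulMulRhs]

section Chains
variable {β : Type}

/-- The list `c t` is the concatenation of the `x s` for `s ≥ t`, by induction on the length of the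
chain. -/
theorem flatten_of_chain : ∀ {w : ℕ} {x c : Fin (w + 1) → List β},
    (∀ t : Fin w, c t.castSucc = x t.castSucc ++ c t.succ) → c (Fin.last w) = x (Fin.last w) →
      c 0 = (List.ofFn x).flatten
  | 0, x, c, _, hl => by
    rw [List.ofFn_succ]
    simpa using hl
  | w + 1, x, c, h, hl => by
    have h0 := h 0
    have ih := flatten_of_chain (x := fun t => x t.succ) (c := fun t => c t.succ)
      (fun t => h t.succ) hl
    rw [List.ofFn_succ, List.flatten_cons, ← ih]
    exact h0

theorem exists_chain : ∀ {w : ℕ} (x : Fin (w + 1) → List β), ∃ c : Fin (w + 1) → List β,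
    c 0 = (List.ofFn x).flatten ∧ c (Fin.last w) = x (Fin.last w) ∧
      ∀ t : Fin w, c t.castSucc = x t.castSucc ++ c t.succ
  | 0, x => ⟨x, by rw [List.ofFn_succ]; simp, rfl, fun t => t.elim0⟩
  | w + 1, x => by
    obtain ⟨c, h0, hl, h⟩ := exists_chain fun t => x t.succ
    refine ⟨Fin.cons (List.ofFn x).flatten c, rfl, ?_, fun t => ?_⟩
    · rw [← Fin.succ_last, Fin.cons_succ, hl]
    · cases t using Fin.cases with
      | zero =>
        rw [Fin.castSucc_zero, Fin.cons_zero, Fin.cons_succ, h0, List.ofFn_succ (f := x)]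
        rfl
      | succ t =>
        rw [Fin.castSucc_succ, Fin.cons_succ, Fin.cons_succ, h]

theorem chain_ne_nil {w : ℕ} {x c : Fin (w + 1) → List β}
    (h : ∀ t : Fin w, c t.castSucc = x t.castSucc ++ c t.succ)
    (hl : c (Fin.last w) = x (Fin.last w)) (hx : ∀ t, x t ≠ []) (t : Fin (w + 1)) : c t ≠ [] := by
  cases t using Fin.lastCases with
  | last => rw [hl]; exact hx _
  | cast t => rw [h]; simp [hx]

end Chains

theorem List.flatten_ofFn_singleton {β : Type} {w : ℕ} (f : Fin w → β) :
    (List.ofFn fun t => [f t]).flatten = List.ofFn f := by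
  have : (List.ofFn fun t => [f t]) = (List.ofFn f).map fun s => [s] := by
    rw [List.map_ofFn]; rfl
  rw [this]
  generalize List.ofFn f = l
  induction l with
  | nil => rfl
  | cons a l ih => simpa using ih

section WordModel
variable {α : Type} {w : ℕ}

theorem Monomial.sat_comb {x : Fin (w + 1) → List (List α)} {y : Fin 1 → List (List α)} :
    ((comb w).relabel (S := bialgSig) fun _ : Unit => BialgOp.mul).Sat (wordModel α) x y ↔
      ∃ c : Fin (w + 1) → List (List α), c 0 = y 0 ∧ c (Fin.last w) = x (Fin.last w) ∧
        ∀ t : Fin w, x t.castSucc ≠ [] ∧ c t.succ ≠ [] ∧ c t.castSucc = x t.castSucc ++ c t.succ :=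
  (sat_relabel _ _ _).trans
    (Wiring.sat_combWiring (fun t : Unit => wordModel α ((fun _ : Unit => BialgOp.mul) t)))

theorem Monomial.sat_cocomb {x : Fin 1 → List (List α)} {y : Fin (w + 1) → List (List α)} :
    ((cocomb w).relabel (S := bialgSig) fun _ : Unit => BialgOp.comul).Sat (wordModel α) x y ↔
      ∃ c : Fin (w + 1) → List (List α), c 0 = x 0 ∧ c (Fin.last w) = y (Fin.last w) ∧
        ∀ t : Fin w, ∃ u v, u ≠ [] ∧ v ≠ [] ∧ c t.castSucc = [u ++ v] ∧ y t.castSucc = [u] ∧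
          c t.succ = [v] :=
  by
  let R : comulSig.Model (List (List α)) := fun t => wordModel α ((fun _ : Unit => BialgOp.comul) t)
  refine (sat_relabel _ _ _).trans ((Wiring.sat_flip R).trans
    (Wiring.sat_combWiring (x := y) (y := x) fun _ a b => R () b a))

theorem Monomial.eq_flatten_of_sat_comb {x : Fin (w + 1) → List (List α)}
    {y : Fin 1 → List (List α)}
    (h : ((comb w).relabel (S := bialgSig) fun _ : Unit => BialgOp.mul).Sat (wordModel α) x y) :
    y 0 = (List.ofFn x).flatten := by
  obtain ⟨c, h0, hl, h⟩ := sat_comb.1 h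
  rw [← h0]
  exact flatten_of_chain (fun t => (h t).2.2) hl

theorem Monomial.sat_comb_of_eq_flatten {x : Fin (w + 1) → List (List α)}
    {y : Fin 1 → List (List α)} (hx : ∀ t, x t ≠ []) (h : y 0 = (List.ofFn x).flatten) :
    ((comb w).relabel (S := bialgSig) fun _ : Unit => BialgOp.mul).Sat (wordModel α) x y := by
  obtain ⟨c, h0, hl, hc⟩ := exists_chain x
  exact sat_comb.2 ⟨c, h0.trans h.symm, hl, fun t => ⟨hx _, chain_ne_nil hc hl hx _, hc t⟩⟩

/-- The comb cuts the word `v` into consecutive pieces. The hypothesis on `x` is needed for a bare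
wire, which imposes no condition on the list that it carries. -/
theorem Monomial.exists_of_sat_cocomb {x : Fin 1 → List (List α)}
    {y : Fin (w + 1) → List (List α)} {v : List α} (hv : x 0 = [v])
    (h : ((cocomb w).relabel (S := bialgSig) fun _ : Unit => BialgOp.comul).Sat
      (wordModel α) x y) :
    ∃ u : Fin (w + 1) → List α, (∀ t, y t = [u t]) ∧ v = (List.ofFn u).flatten := by
  obtain ⟨c, h0, hl, h⟩ := sat_cocomb.1 h
  have hc : ∀ t, c t = [(c t).flatten] := by
    intro t
    cases t using Fin.cases with
    | zero => simp [h0, hv]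
    | succ t =>
      obtain ⟨u, v, -, -, -, -, h⟩ := h t
      simp [h]
  refine ⟨fun t => (y t).flatten, fun t => ?_, ?_⟩
  · cases t using Fin.lastCases with
    | last => exact hl.symm.trans ((hc _).trans (congrArg (fun l => [l.flatten]) hl))
    | cast t =>
      obtain ⟨u, v, -, -, -, h, -⟩ := h t
      simp [h]
  · rw [← flatten_of_chain (x := fun t => (y t).flatten) (c := fun t => (c t).flatten)
      (fun t => ?_) (congrArg List.flatten hl), h0, hv]
    · simp
    · obtain ⟨u, v, -, -, h1, h2, h3⟩ := h t
      simp [h1, h2, h3]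

theorem Monomial.sat_cocomb_of_eq_flatten {x : Fin 1 → List (List α)}
    {y : Fin (w + 1) → List (List α)} {u : Fin (w + 1) → List α} (hu : ∀ t, u t ≠ [])
    (hy : ∀ t, y t = [u t]) (hx : x 0 = [(List.ofFn u).flatten]) :
    ((cocomb w).relabel (S := bialgSig) fun _ : Unit => BialgOp.comul).Sat (wordModel α) x y := by
  obtain ⟨c, h0, hl, hc⟩ := exists_chain u
  refine sat_cocomb.2 ⟨fun t => [c t], by simp [h0, hx], by simp [hl, hy], fun t =>
    ⟨u t.castSucc, c t.succ, hu _, chain_ne_nil hc hl hu _, by simp [hc], hy _, rfl⟩⟩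

end WordModel

/-! ### Composites of combs are determined by their words -/

namespace CombShape
variable {m n : ℕ} (D : CombShape m n)

/-- The letters of the words read by a standard composite of combs. -/
abbrev Letter : Type := Σ x, Fin (D.j x + 1)

/-- The words at the inputs: every input carries the word of its own letters. -/
def inWord (x : Fin n) : List (List D.Letter) := [List.ofFn fun t => ⟨x, t⟩]

/-- The words at the outputs: every output carries the list of the letters that it receives. -/
def outWord (y : Fin m) : List (List D.Letter) := List.ofFn fun t => [D.σ.symm ⟨y, t⟩]

theorem sat_mono {D' : CombShape m n} {α : Type} {x : Fin n → List (List α)}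
    {y : Fin m → List (List α)} : D'.mono.Sat (wordModel α) x y ↔
      ∃ z : (Σ b, Fin (D'.j b + 1)) → List (List α),
        (∀ b, ((Monomial.cocomb (D'.j b)).relabel (S := bialgSig) fun _ : Unit =>
          BialgOp.comul).Sat (wordModel α) (fun _ => x b) (fun t => z ⟨b, t⟩)) ∧
        ∀ b, ((Monomial.comb (D'.k b)).relabel (S := bialgSig) fun _ : Unit =>
          BialgOp.mul).Sat (wordModel α) (fun t => z (D'.σ.symm ⟨b, t⟩)) (fun _ => y b) :=
  Monomial.sat_comp _ _ _ _

theorem sat_mono_self : D.mono.Sat (wordModel D.Letter) D.inWord D.outWord := by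
  -- The intermediate wire `s` carries the list formed by the one-letter word `s`.
  refine sat_mono.2 ⟨fun s => [[s]], fun b => ?_, fun b => ?_⟩
  · refine Monomial.sat_cocomb_of_eq_flatten (u := fun t => [⟨b, t⟩]) (by simp) (fun _ => rfl) ?_
    rw [List.flatten_ofFn_singleton]
    rfl
  · refine Monomial.sat_comb_of_eq_flatten (by simp) ?_
    rw [List.flatten_ofFn_singleton]
    rfl

/-- The words of a standard composite of combs characterize it. -/
theorem eq_of_sat_mono {D' : CombShape m n}
    (h : D'.mono.Sat (wordModel D.Letter) D.inWord D.outWord) : D' = D := by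
  obtain ⟨z, hz, hy⟩ := sat_mono.1 h
  choose u hu hx using fun b => Monomial.exists_of_sat_cocomb rfl (hz b)
  have hz' : z = fun s => [u s.1 s.2] := funext fun s => hu s.1 s.2
  -- The output `b` is the list of the words arriving there. Families are compared together with
  -- their lengths, which are not yet known to agree; the lengths give `k = k'`.
  have ho : ∀ b, (⟨_, fun t => [D.σ.symm ⟨b, t⟩]⟩ : Σ n, Fin n → List D.Letter) =
      ⟨_, fun t => u (D'.σ.symm ⟨b, t⟩).1 (D'.σ.symm ⟨b, t⟩).2⟩ := by
    intro b
    have := Monomial.eq_flatten_of_sat_comb (hy b)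
    rw [hz', List.flatten_ofFn_singleton] at this
    exact List.ofFn_inj'.1 this
  clear hy hu h
  obtain ⟨j', k', σ', hc'⟩ := D'
  obtain rfl : D.k = k' := by
    funext b
    simpa using congrArg Sigma.fst (ho b)
  -- The outputs only contain one-letter words, so every intermediate word is a single letter, and
  -- this letter is known.
  have hU : ∀ b t, u b t = [D.σ.symm (σ' ⟨b, t⟩)] := by
    intro b t
    have h1 := congrFun (eq_of_heq (Sigma.mk.inj (ho (σ' ⟨b, t⟩).1)).2) (σ' ⟨b, t⟩).2
    replace h1 : [D.σ.symm (σ' ⟨b, t⟩)] = u (σ'.symm (σ' ⟨b, t⟩)).1 (σ'.symm (σ' ⟨b, t⟩)).2 := h1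
    rw [Equiv.symm_apply_apply] at h1
    exact h1.symm
  -- The intermediate letters that come from the input `b` concatenate to its word. The lengths give
  -- `j = j'`, and the letters, being distinct, give `σ = σ'`.
  have hi : ∀ b, (⟨_, fun t => ⟨b, t⟩⟩ : Σ n, Fin n → D.Letter) =
      ⟨_, fun t => D.σ.symm (σ' ⟨b, t⟩)⟩ := by
    intro b
    have := hx b
    rw [show u b = fun t => [D.σ.symm (σ' ⟨b, t⟩)] from funext (hU b),
      List.flatten_ofFn_singleton] at this
    exact List.ofFn_inj'.1 this
  clear hx hz hz' hU ho u z
  obtain rfl : D.j = j' := by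
    funext b
    simpa using congrArg Sigma.fst (hi b)
  obtain rfl : D.σ = σ' := by
    ext1 ⟨b, t⟩
    have h1 := congrFun (eq_of_heq (Sigma.mk.inj (hi b)).2) t
    exact (Equiv.eq_symm_apply _).1 h1
  rfl

theorem mono_injective : Function.Injective (mono : CombShape m n → Monomial bialgSig m n) :=
  fun _ D h => D.eq_of_sat_mono (h ▸ D.sat_mono_self)

end CombShape

/-! ### Independence of the normal forms for zero coefficients -/

section Independence
variable {m n : ℕ}

/-- A monomial satisfied by the words of `D` rewrites to `D`. -/
theorem CombShape.measure_mono_le (D : CombShape m n) {X : Monomial bialgSig m n}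
    (hX : X.size ≤ 3) (h : X.Sat (wordModel D.Letter) D.inWord D.outWord) :
    X = D.mono ∨ D.mono.measure < X.measure := by
  induction hN : X.measure using Nat.strong_induction_on generalizing X with
  | _ N ih =>
    by_cases hr : Reducible X
    · obtain ⟨f, hr⟩ := hr
      -- With zero coefficients, a satisfied monomial rewrites to a single monomial, which is again
      -- satisfied and has smaller measure.
      rcases hr.sat D.inWord D.outWord with ⟨h0, -⟩ | ⟨X', rfl, h'⟩
      · exact absurd h h0
      · obtain ⟨hs, hm⟩ := hr.lt X' (by simp)
        have := ih X'.measure (hN ▸ hm) (X := X') (by omega) (h'.1 h) rfl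
        rcases this with rfl | h
        · exact .inr (hN ▸ hm)
        · exact .inr (h.trans (hN ▸ hm))
    · obtain ⟨D', rfl⟩ := exists_eq_mono hX hr
      exact .inl (congrArg mono (D.eq_of_sat_mono h))

/-- Among the monomials of weight at most three satisfied by the words of `D`, the composite
`D.mono` has the least measure, while a rule would produce one with a smaller measure. -/
theorem CombShape.not_reducible_mono (D : CombShape m n) (hD : D.weight ≤ 3) :
    ¬ Reducible D.mono := by
  rintro ⟨f, hr⟩
  rcases hr.sat D.inWord D.outWord with ⟨h0, -⟩ | ⟨X', rfl, h'⟩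
  · exact h0 D.sat_mono_self
  · obtain ⟨hs, hm⟩ := hr.lt X' (by simp)
    rcases D.measure_mono_le (by rw [hs, size_mono]; exact hD) (h'.1 D.sat_mono_self) with rfl | h
    · exact lt_irrefl _ hm
    · exact lt_asymm hm h

/-- For zero coefficients, the irreducible monomials are independent modulo the relations. -/
theorem eq_zero_of_mem_rewriteSpan_zero {x : (free bialgSig).carrier m n}
    (hx : x ∈ normalForms m n) (hr : x ∈ rewriteSpan 0 m n) : x = 0 := by
  classical
  refine Finsupp.ext fun G => ?_
  by_contra hG
  have hG' := hx (Finsupp.mem_support_iff.2 hG)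
  obtain ⟨D, rfl⟩ := exists_eq_mono hG'.1.le hG'.2
  -- The linear form that tests satisfaction by the words of `D`. It vanishes on the relations of
  -- `P_0`, and on normal forms it is the coefficient of `D.mono`, since these words determine `D`.
  let φ : (free bialgSig).carrier m n →ₗ[ℂ] ℂ := Finsupp.linearCombination ℂ fun X =>
    if X.Sat (wordModel D.Letter) D.inWord D.outWord then 1 else 0
  have h0 : φ x = 0 := by
    have : rewriteSpan 0 m n ≤ LinearMap.ker φ := by
      refine Submodule.span_le.2 ?_
      rintro _ ⟨G, h, hr, -, rfl⟩
      refine LinearMap.mem_ker.2 ?_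
      rw [map_sub]
      rcases hr.sat D.inWord D.outWord with ⟨h0, rfl⟩ | ⟨X', rfl, h'⟩
      · simp [φ, h0]
      · simp [φ, h']
    exact this hr
  have h1 : φ x = x D.mono := by
    show x.sum _ = _
    rw [Finsupp.sum, Finset.sum_eq_single D.mono]
    · simp [D.sat_mono_self]
    · intro X hX hne
      have hX' := hx hX
      obtain ⟨D', rfl⟩ := exists_eq_mono hX'.1.le hX'.2
      have : ¬ D'.mono.Sat (wordModel D.Letter) D.inWord D.outWord :=
        fun h => hne (congrArg CombShape.mono (D.eq_of_sat_mono h))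
      simp [this]
    · intro h
      simp [Finsupp.notMem_support_iff.1 h]
  exact hG (h1.symm.trans h0)

end Independence

/-! ### The weight three part of `A ⊠ C` -/

namespace SBimodule
variable {Q P : SBimodule} {m n : ℕ}

theorem box.mk_eq_add_of_rel {u v w : BoxGen Q P m n →₀ ℂ} (h : BoxRel Q P (u - (v + w))) :
    (Submodule.Quotient.mk u : (box Q P).carrier m n) =
      Submodule.Quotient.mk v + Submodule.Quotient.mk w :=
  (Submodule.Quotient.eq _).2 (Submodule.subset_span h)

theorem box.mk_eq_of_rel {u v : BoxGen Q P m n →₀ ℂ} (h : BoxRel Q P (u - v)) :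
    (Submodule.Quotient.mk u : (box Q P).carrier m n) = Submodule.Quotient.mk v :=
  (Submodule.Quotient.eq _).2 (Submodule.subset_span h)

/-- The class of a symbol is multilinear. -/
noncomputable def box.mkMulti (s : Shape m n) :
    MultilinearMap ℂ (fun y => Q.carrier (s.l y) (s.k y))
      (MultilinearMap ℂ (fun x => P.carrier (s.j x) (s.i x)) ((box Q P).carrier m n)) where
  toFun q :=
    { toFun := box.mk s q
      map_update_add' := by
        intro inst p x u v
        obtain rfl := Subsingleton.elim (instDecidableEqFin s.a) inst
        exact box.mk_eq_add_of_rel (.add_fst s q p x u v)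
      map_update_smul' := by
        intro inst p x c u
        obtain rfl := Subsingleton.elim (instDecidableEqFin s.a) inst
        exact box.mk_eq_of_rel (.smul_fst s q p x u c) }
  map_update_add' := by
    intro inst q y u v
    obtain rfl := Subsingleton.elim (instDecidableEqFin s.b) inst
    ext p
    exact box.mk_eq_add_of_rel (.add_snd s q p y u v)
  map_update_smul' := by
    intro inst q y c u
    obtain rfl := Subsingleton.elim (instDecidableEqFin s.b) inst
    ext p
    exact box.mk_eq_of_rel (.smul_snd s q p y u c)

end SBimodule

theorem multilinear_mem_of_span {ι W : Type} [Finite ι] {M : ι → Type} {B : ι → Type}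
    [∀ i, AddCommGroup (M i)] [∀ i, Module ℂ (M i)] [AddCommGroup W] [Module ℂ W]
    (f : MultilinearMap ℂ M W) (v : ∀ i, B i → M i) (J : Submodule ℂ W)
    (h : ∀ g : ∀ i, B i, f (fun i => v i (g i)) ∈ J) (x : ∀ i, M i)
    (hx : ∀ i, x i ∈ Submodule.span ℂ (Set.range (v i))) : f x ∈ J := by
  choose l hl using fun i => (Finsupp.mem_span_range_iff_exists_finsupp).1 (hx i)
  obtain rfl : (fun i => Finsupp.linearCombination ℂ (v i) (l i)) = x := funext hl
  refine multilinear_mem (f.compLinearMap fun i => Finsupp.linearCombination ℂ (v i)) J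
    (fun g => ?_) l
  rw [MultilinearMap.compLinearMap_apply]
  simpa using h g

theorem presentedWeight_eq_span {S : Sig} (R : ∀ m n, Set ((free S).carrier m n)) (w m n : ℕ) :
    presentedWeight S R w m n = Submodule.span ℂ (Set.range
      fun G : {G : Monomial S m n // G.size = w} => presented.mk (Finsupp.single G.1 1)) := by
  rw [presentedWeight, freeWeight, Finsupp.supported_eq_span_single, Submodule.map_span,
    ← Set.image_comp, Set.image_eq_range]
  rfl

namespace CombShape
variable {m n : ℕ}

/-- The composite of combs in `A ⊠ C`. -/
noncomputable def toBox (D : CombShape m n) : (assocProperad.box coassocProperad).carrier m n :=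
  SBimodule.box.mk D.shape (fun y => presented.mk (Finsupp.single (Monomial.comb (D.k y)) 1))
    (fun x => presented.mk (Finsupp.single (Monomial.cocomb (D.j x)) 1))

theorem toBox_mem (D : CombShape m n) : D.toBox ∈ SBimodule.boxWeight assocProperad coassocProperad
    (presentedWeight mulSig _) (presentedWeight comulSig _) D.weight m n := by
  refine Submodule.subset_span ⟨D.shape, _, _, D.k, D.j, fun y => ?_, fun x => ?_, rfl, rfl⟩
  · rw [presentedWeight_eq_span]
    exact Submodule.subset_span ⟨⟨Monomial.comb (D.k y), rfl⟩, rfl⟩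
  · rw [presentedWeight_eq_span]
    exact Submodule.subset_span ⟨⟨Monomial.cocomb (D.j x), rfl⟩, rfl⟩

/-- The entries are classes of monomials, so the inclusions and the composition are computed on
representatives, where they give the composite monomial. -/
theorem phi_toBox (a : Fin 4 → ℂ) (D : CombShape m n) :
    (phi a).toLin m n D.toBox = presented.mk (Finsupp.single D.mono 1) := by
  let s := D.shape
  let i1 := presented.incl (S := bialgSig) (fun _ : Unit => BialgOp.mul)
    (R := fun m n => {x | AssocRel m n x}) (R' := fun m n => {x | BialgRel a m n x})
    fun _ _ _ h => .assoc h
  let i2 := presented.incl (S := bialgSig) (fun _ : Unit => BialgOp.comul)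
    (R := fun m n => {x | CoassocRel m n x}) (R' := fun m n => {x | BialgRel a m n x})
    fun _ _ _ h => .coassoc h
  have h1 : (phi a).toLin m n D.toBox = presented.compLin bialgSig _ m n
      (Finsupp.lmapDomain ℂ ℂ (SBimodule.BoxGen.map i1 i2) (SBimodule.BoxGen.vec s
        (fun y => presented.mk (Finsupp.single (Monomial.comb (D.k y)) 1))
        (fun x => presented.mk (Finsupp.single (Monomial.cocomb (D.j x)) 1)))) := rfl
  rw [h1, Finsupp.lmapDomain_apply, Finsupp.mapDomain_single]
  refine (presented.compLin_vec s
    (fun y => presented.mk (free.incl _ _ _ (Finsupp.single (Monomial.comb (D.k y)) 1)))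
    (fun x => presented.mk (free.incl _ _ _
      (Finsupp.single (Monomial.cocomb (D.j x)) 1)))).trans ?_
  rw [presented.comp_mk s]
  congr 1
  simp only [free.incl_single]
  exact free.comp_single s _ _

end CombShape

/-- The composites of combs span the weight three part of `A ⊠ C`. -/
theorem boxWeight_le_span (m n : ℕ) : SBimodule.boxWeight assocProperad coassocProperad
    (presentedWeight mulSig _) (presentedWeight comulSig _) 3 m n ≤
      Submodule.span ℂ (Set.range fun D : {D : CombShape m n // D.weight = 3} => D.1.toBox) := by
  refine Submodule.span_le.2 ?_
  rintro _ ⟨s, q, p, u, v, hq, hp, hw, rfl⟩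
  -- Each entry has weight at most three, which is the range where monomials have been shown to be
  -- congruent to combs.
  have hu : ∀ y, u y ≤ 3 := fun y => by
    have := Finset.single_le_sum (f := u) (fun _ _ => Nat.zero_le _) (Finset.mem_univ y)
    omega
  have hv : ∀ x, v x ≤ 3 := fun x => by
    have := Finset.single_le_sum (f := v) (fun _ _ => Nat.zero_le _) (Finset.mem_univ x)
    omega
  simp only [presentedWeight_eq_span] at hq hp
  -- By multilinearity the entries may be taken to be classes of monomials, and these are then
  -- replaced by congruent combs.
  refine multilinear_mem_of_span (SBimodule.box.mkMulti s q) _ _ (fun H => ?_) p hp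
  refine multilinear_mem_of_span ((multiEval _).compMultilinearMap (SBimodule.box.mkMulti s)) _ _
    (fun G => ?_) q hq
  choose G' hG1 hG2 hG3 using fun y => Monomial.exists_comb_congr (G y).1 ((G y).2.trans_le (hu y))
  choose H' hH1 hH2 hH3 using fun x => Monomial.exists_cocomb_congr (H x).1
    ((H x).2.trans_le (hv x))
  let cQ : ∀ {m n}, Monomial mulSig m n → assocProperad.carrier m n := fun X =>
    presented.mk (Finsupp.single X 1)
  let cP : ∀ {m n}, Monomial comulSig m n → coassocProperad.carrier m n := fun X =>
    presented.mk (Finsupp.single X 1)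
  -- The class in `A ⊠ C` is paired with the total number of vertices, so that the standard
  -- composite is known to have weight three too.
  obtain ⟨D, hD⟩ := exists_combShape (fun s q p => (SBimodule.box.mk (Q := assocProperad)
      (P := coassocProperad) s (fun y => cQ (q y)) (fun x => cP (p x)),
      ∑ y, (q y).size + ∑ x, (p x).size))
    (fun s q p g => by
      refine Prod.ext ?_ (by simp only [Monomial.size_smul])
      exact (congrArg (fun q => SBimodule.box.mk (Q := assocProperad) (P := coassocProperad) s q
        fun x => cP (p x)) (funext fun y => (congrArg presented.mk
          (permRep_single (g y) (q y) 1)).symm)).trans (SBimodule.box.mk_eq_of_rel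
            (.act_snd s (fun y => cQ (q y)) (fun x => cP (p x)) g)))
    (fun s q p g => by
      refine Prod.ext ?_ (by simp only [Monomial.size_smul])
      exact (congrArg (SBimodule.box.mk (Q := assocProperad) (P := coassocProperad) s
        fun y => cQ (q y)) (funext fun x => (congrArg presented.mk
          (permRep_single (g x) (p x) 1)).symm)).trans (SBimodule.box.mk_eq_of_rel
            (.act_fst s (fun y => cQ (q y)) (fun x => cP (p x)) g)))
    (fun s q p ρ τ => by
      refine Prod.ext ?_ (congrArg₂ (· + ·) (Equiv.sum_comp ρ fun y => (q y).size)
        (Equiv.sum_comp τ fun x => (p x).size))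
      exact SBimodule.box.mk_eq_of_rel (.block s (fun y => cQ (q y)) (fun x => cP (p x)) ρ τ))
    s G' H' hG1 hH1
  have hD1 := congrArg Prod.fst hD
  have hD2 := congrArg Prod.snd hD
  refine Submodule.subset_span ⟨⟨D, hD2.symm.trans (Eq.trans ?_ hw)⟩, hD1.symm.trans ?_⟩
  · simp only [hG2, hH2, (G _).2, (H _).2]
  · have e1 : (fun y => cQ (G' y)) = fun y => cQ (G y).1 :=
      funext fun y => ((Submodule.Quotient.eq _).2 (hG3 y)).symm
    have e2 : (fun x => cP (H' x)) = fun x => cP (H x).1 :=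
      funext fun x => ((Submodule.Quotient.eq _).2 (hH3 x)).symm
    show SBimodule.box.mk s (fun y => cQ (G' y)) (fun x => cP (H' x)) = _
    rw [e1, e2]
    rfl

/-! ### Comparison of `φ_a` with normal forms -/

section Isomorphism
variable {m n : ℕ}

theorem single_mono_mem_normalForms {D : CombShape m n} (hD : D.weight = 3) :
    Finsupp.single D.mono 1 ∈ normalForms m n :=
  Finsupp.single_mem_supported ℂ 1 ⟨D.size_mono.trans hD, D.not_reducible_mono hD.le⟩

theorem linearCombination_mono_mem_normalForms
    (c : {D : CombShape m n // D.weight = 3} →₀ ℂ) :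
    Finsupp.linearCombination ℂ (fun D : {D : CombShape m n // D.weight = 3} =>
      (Finsupp.single D.1.mono 1 : (free bialgSig).carrier m n)) c ∈ normalForms m n :=
  Submodule.sum_mem _ fun D _ => Submodule.smul_mem _ _ (single_mono_mem_normalForms D.2)

theorem exists_linearCombination_mono {x : (free bialgSig).carrier m n} (hx : x ∈ normalForms m n) :
    ∃ c, x = Finsupp.linearCombination ℂ (fun D : {D : CombShape m n // D.weight = 3} =>
      (Finsupp.single D.1.mono 1 : (free bialgSig).carrier m n)) c := by
  have : normalForms m n ≤ Submodule.span ℂ (Set.range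
      fun D : {D : CombShape m n // D.weight = 3} =>
        (Finsupp.single D.1.mono 1 : (free bialgSig).carrier m n)) := by
    rw [normalForms, Finsupp.supported_eq_span_single]
    refine Submodule.span_mono ?_
    rintro _ ⟨G, ⟨hG, hr⟩, rfl⟩
    obtain ⟨D, rfl⟩ := exists_eq_mono hG.le hr
    exact ⟨⟨D, D.size_mono.symm.trans hG⟩, rfl⟩
  obtain ⟨c, hc⟩ := Finsupp.mem_span_range_iff_exists_finsupp.1 (this hx)
  exact ⟨c, hc.symm⟩

theorem linearCombination_mono_injective : Function.Injective (Finsupp.linearCombination ℂ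
    (fun D : {D : CombShape m n // D.weight = 3} =>
      (Finsupp.single D.1.mono 1 : (free bialgSig).carrier m n))) := by
  have h : LinearIndependent ℂ (fun X : Monomial bialgSig m n => (Finsupp.single X (1 : ℂ))) :=
    (Finsupp.basisSingleOne (R := ℂ) (ι := Monomial bialgSig m n)).linearIndependent
  exact h.comp (fun D : {D : CombShape m n // D.weight = 3} => D.1.mono)
    fun D D' h => Subtype.ext (CombShape.mono_injective h)

/-- The composite of `φ_a` with the normal forms in `A ⊠ C` is the projection. -/
theorem phi_linearCombination (a : Fin 4 → ℂ) (c : {D : CombShape m n // D.weight = 3} →₀ ℂ) :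
    (phi a).toLin m n (Finsupp.linearCombination ℂ (fun D => D.1.toBox) c) =
      presented.mk (Finsupp.linearCombination ℂ (fun D : {D : CombShape m n // D.weight = 3} =>
        (Finsupp.single D.1.mono 1 : (free bialgSig).carrier m n)) c) := by
  have : (phi a).toLin m n ∘ₗ Finsupp.linearCombination ℂ
      (fun D : {D : CombShape m n // D.weight = 3} => D.1.toBox) =
      (ideal (fun m n => {x | BialgRel a m n x}) m n).mkQ ∘ₗ Finsupp.linearCombination ℂ
        (fun D : {D : CombShape m n // D.weight = 3} =>
          (Finsupp.single D.1.mono 1 : (free bialgSig).carrier m n)) := by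
    refine Finsupp.lhom_ext' fun D => LinearMap.ext_ring ?_
    simp only [LinearMap.comp_apply, Finsupp.lsingle_apply, Finsupp.linearCombination_single,
      one_smul]
    exact CombShape.phi_toBox a D.1
  exact LinearMap.congr_fun this c

/-- The point is that vanishing in `P_a` is membership in the ideal, which in weight three is
spanned by the induced rules. -/
theorem mk_eq_zero_iff {a : Fin 4 → ℂ} {x : (free bialgSig).carrier m n}
    (hx : x ∈ normalForms m n) :
    (presented.mk x : (bialgProperad a).carrier m n) = 0 ↔ x ∈ rewriteSpan a m n :=
  (Submodule.Quotient.mk_eq_zero _).trans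
    (mem_rewriteSpan_iff (normalForms_le_freeWeight m n hx)).symm

theorem linearCombination_toBox_mem (c : {D : CombShape m n // D.weight = 3} →₀ ℂ) :
    Finsupp.linearCombination ℂ (fun D => D.1.toBox) c ∈ SBimodule.boxWeight assocProperad
      coassocProperad (presentedWeight mulSig _) (presentedWeight comulSig _) 3 m n :=
  Submodule.sum_mem _ fun D _ => Submodule.smul_mem _ _ (by
    have := D.1.toBox_mem
    rwa [D.2] at this)

theorem exists_linearCombination_toBox {t : (assocProperad.box coassocProperad).carrier m n}
    (ht : t ∈ SBimodule.boxWeight assocProperad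
      coassocProperad (presentedWeight mulSig _) (presentedWeight comulSig _) 3 m n) :
    ∃ c : {D : CombShape m n // D.weight = 3} →₀ ℂ,
      Finsupp.linearCombination ℂ (fun D => D.1.toBox) c = t :=
  Finsupp.mem_span_range_iff_exists_finsupp.1 (boxWeight_le_span m n ht)

/-- The composites of combs in `A ⊠ C` are matched with the irreducible monomials, and `φ_a` becomes
the projection of normal forms to `P_a`. Termination gives surjectivity, so only injectivity is at
stake. -/
theorem phi_bijOn_iff (a : Fin 4 → ℂ) : Set.BijOn ((phi a).toLin m n)
      (SBimodule.boxWeight assocProperad coassocProperad (presentedWeight mulSig _)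
        (presentedWeight comulSig _) 3 m n)
      (presentedWeight bialgSig (fun m n => {x | BialgRel a m n x}) 3 m n) ↔
    ∀ x ∈ normalForms m n, x ∈ rewriteSpan a m n → x = 0 := by
  constructor
  · intro h x hx hr
    obtain ⟨c, rfl⟩ := exists_linearCombination_mono hx
    have h1 := phi_linearCombination a c
    rw [(mk_eq_zero_iff hx).2 hr, ← map_zero ((phi a).toLin m n)] at h1
    -- Injectivity of `φ_a` shows that the combination `c` already vanishes in `A ⊠ C`, which does
    -- not depend on `a`. Applying `φ_0` brings it to the case of zero coefficients, where
    -- independence is known.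
    have h2 := phi_linearCombination 0 c
    rw [h.injOn (linearCombination_toBox_mem c) (zero_mem _) h1, map_zero] at h2
    exact eq_zero_of_mem_rewriteSpan_zero hx ((mk_eq_zero_iff hx).1 h2.symm)
  · intro h
    refine ⟨?_, ?_, ?_⟩
    · intro t ht
      obtain ⟨c, rfl⟩ := exists_linearCombination_toBox ht
      rw [phi_linearCombination]
      exact ⟨_, normalForms_le_freeWeight m n (linearCombination_mono_mem_normalForms c), rfl⟩
    · intro t ht t' ht' he
      obtain ⟨c, rfl⟩ := exists_linearCombination_toBox ht
      obtain ⟨c', rfl⟩ := exists_linearCombination_toBox ht'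
      rw [← sub_eq_zero, ← map_sub, ← map_sub, phi_linearCombination] at he
      have h1 := linearCombination_mono_mem_normalForms (c - c')
      have h2 := h _ h1 ((mk_eq_zero_iff h1).1 he)
      rw [← map_zero (Finsupp.linearCombination ℂ _)] at h2
      rw [sub_eq_zero.1 (linearCombination_mono_injective h2)]
    · rintro _ ⟨f, hf, rfl⟩
      -- A class of weight three is also the class of a normal form of a representative, and normal
      -- forms are combinations of composites of combs.
      obtain ⟨g, hg, hg'⟩ := exists_steps_normalForms (a := a) ⟨f, hf⟩
      obtain ⟨c, hc⟩ := exists_linearCombination_mono hg'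
      refine ⟨_, linearCombination_toBox_mem c, (phi_linearCombination a c).trans ?_⟩
      rw [← hc]
      exact (Submodule.Quotient.eq _).2 (rewriteSpan_le_ideal a m n (sub_mem_of_steps hg))

end Isomorphism

theorem mainTheorem5 (a : Fin 4 → ℂ) : InducesConfluentSystem a ↔ PhiIsIsoInWeight a 3 :=
  inducesConfluentSystem_iff.trans
    (forall₂_congr fun _ _ => (phi_bijOn_iff a).symm)
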